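/- \textbf{Theorem.} Let $M_1,M_2$ be reduced complex analytic spaces (Hausdorff, second countable), for instance complex analytic sets in open subsets of $\mathbb C^N$, and let $V_1\subsetneq M_1$, $V_2\subsetneq M_2$ be analytic subvarieties such that $M_1-V_1$ and $M_2-V_2$ are complex manifolds of the same dimension $n$ (all their points are regular points of $M_i$ of dimension $n$). Let $f\colon M_1-V_1\to M_2-V_2$ be an $m$-sheeted holomorphic covering map, $m$ finite (that is, a topological covering map whose fibres have exactly $m$ points and which maps its sheets biholomorphically). Let $\Gamma$ be its deck transformation group and assume that $|\Gamma|=m$. Assume that $M_1-V_1$ is connected or, more generally, that $\Gamma$ acts transitively on the fibres of $f$. For $i=1,2$ let $$K_i(x,\bar y)=i^{\,n^2}\sum_k\varphi_k(x)\wedge\overline{\varphi_k(y)}$$ be the Bergman kernel form of $M_i$. Here $\{\varphi_k\}$ is an orthonormal basis of the Bergman space of all holomorphic $(n,0)$-forms $\varphi$ on the manifold of ($n$-dimensional) regular points of $M_i$ with $i^{\,n^2}\int\varphi\wedge\overline{\varphi}<\infty$, with the inner product $(\varphi,\psi)=i^{\,n^2}\int\varphi\wedge\overline{\psi}$ (and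 $K_i=0$ if this space is $\{0\}$). For every choice of the orthonormal basis this series converges absolutely at every pair of points, and its sum does not depend on the choice. For holomorphic maps $\gamma,\tau$ into the $n$-dimensional regular part of $M_i$, the pull-back of a form given in local coordinates by $K=\widetilde K(x,\bar y)\,dx_1\wedge\cdots\wedge dx_n\wedge d\bar y_1\wedge\cdots\wedge d\bar y_n$ is $$\bigl((\gamma,\tau)^*K\bigr)(z,\bar w)=\widetilde K\bigl(\gamma(z),\overline{\tau(w)}\bigr)\,J_\gamma(z)\,\overline{J_\tau(w)}\;dz_1\wedge\cdots\wedge dz_n\wedge d\bar w_1\wedge\cdots\wedge d\bar w_n ,$$ where $J_\gamma,J_\tau$ are the Jacobian determinants. Then $$\sum_{\gamma\in\Gamma}(\gamma,\mathrm{id})^*K_1=\sum_{\gamma\in\Gamma}(\mathrm{id},\gamma)^*K_1=(f,f)^*K_2\qquad\text{on }(M_1-V_1)\times(M_1-V_1).$$ -/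

import Mathlib

open Set Filter Topology MeasureTheory
open scoped ComplexConjugate ENNReal

/-! ## Reduced complex analytic spaces, given by their holomorphic function germs -/

/-- A reduced complex analytic space structure on a topological space `M` (the Hausdorff and second
countability axioms are separate type classes). The structure sheaf is a sheaf of complex valued
functions; `IsHolAt h x` says that `h` is holomorphic near `x`. Every point has an open
neighbourhood `U` and an embedding `Φ` of `U` onto the analytic subset `{g = 0}` of an open set
`Ω` of some `ℂ^N`, such that the holomorphic functions on `U` are exactly those that are locally
restrictions, through `Φ`, of holomorphic functions of the `N` ambient variables. -/
class ReducedComplexSpace (M : Type*) [TopologicalSpace M] where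
  IsHolAt : (M → ℂ) → M → Prop
  local_model : ∀ x : M, ∃ (U : Set M) (N : ℕ) (Φ : M → (Fin N → ℂ)) (Ω : Set (Fin N → ℂ))
    (k : ℕ) (g : Fin k → (Fin N → ℂ) → ℂ),
    IsOpen U ∧ x ∈ U ∧ IsEmbedding (U.domRestrict Φ) ∧
    IsOpen Ω ∧ (∀ i, AnalyticOnNhd ℂ (g i) Ω) ∧ Φ '' U = {p | p ∈ Ω ∧ ∀ i, g i p = 0} ∧
    ∀ y ∈ U, ∀ h : M → ℂ, IsHolAt h y ↔
      ∃ G : (Fin N → ℂ) → ℂ, AnalyticAt ℂ G (Φ y) ∧ h =ᶠ[𝓝 y] G ∘ Φ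

open ReducedComplexSpace (IsHolAt)

theorem ReducedComplexSpace.continuousAt {M : Type*} [TopologicalSpace M] [ReducedComplexSpace M]
    {h : M → ℂ} {x : M} (hh : IsHolAt h x) : ContinuousAt h x := by
  obtain ⟨U, N, Φ, Ω, k, g, hU, hx, hemb, -, -, -, hiff⟩ :=
    ReducedComplexSpace.local_model x
  obtain ⟨G, hG, hEq⟩ := (hiff x hx h).1 hh
  have hΦ : ContinuousAt Φ x :=
    (continuousOn_iff_continuous_domRestrict.2 hemb.continuous).continuousAt (hU.mem_nhds hx)
  exact (ContinuousAt.comp (g := G) hG.continuousAt hΦ).congr hEq.symm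

/-- A (closed) analytic subvariety of `M`: near every point of `M` it is the common zero set of
finitely many holomorphic functions. -/
structure AnalyticSubvariety (M : Type*) [TopologicalSpace M] [ReducedComplexSpace M] where
  carrier : Set M
  locally_zeros : ∀ x : M, ∃ (U : Set M) (k : ℕ) (h : Fin k → M → ℂ), IsOpen U ∧ x ∈ U ∧
    (∀ i, ∀ y ∈ U, IsHolAt (h i) y) ∧ ∀ y ∈ U, y ∈ carrier ↔ ∀ i, h i y = 0

/-- The complement `M - V`; it is an open subset of `M`. -/
def AnalyticSubvariety.compl {M : Type*} [TopologicalSpace M] [ReducedComplexSpace M]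
    (V : AnalyticSubvariety M) : Set M := V.carrierᶜ

theorem AnalyticSubvariety.isOpen_compl {M : Type*} [TopologicalSpace M] [ReducedComplexSpace M]
    (V : AnalyticSubvariety M) : IsOpen V.compl := by
  rw [isOpen_iff_mem_nhds]
  intro x hx
  obtain ⟨U, k, h, hU, hxU, hh, hiff⟩ := V.locally_zeros x
  have hx' : ¬ ∀ i, h i x = 0 := fun H => hx ((hiff x hxU).2 H)
  push Not at hx'
  obtain ⟨i, hi⟩ := hx'
  have hc := ReducedComplexSpace.continuousAt (hh i x hxU)
  filter_upwards [hU.mem_nhds hxU, hc.eventually_ne hi] with y hy hy0 hyV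
  exact hy0 ((hiff y hy).1 hyV i)

/-- Holomorphic coordinates of dimension `n` on an open subset `source` of `M`: an isomorphism of
`source`, with its holomorphic functions, onto an open subset `target` of `ℂ^n`. -/
structure HolCoord (M : Type*) [TopologicalSpace M] [ReducedComplexSpace M] (n : ℕ)
    extends OpenPartialHomeomorph M (Fin n → ℂ) where
  isHolAt_iff : ∀ y ∈ source, ∀ h : M → ℂ,
    IsHolAt h y ↔ AnalyticAt ℂ (h ∘ toOpenPartialHomeomorph.symm) (toOpenPartialHomeomorph y)

noncomputable instance {M : Type*} [TopologicalSpace M] [ReducedComplexSpace M] (n : ℕ) :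
    CoeFun (HolCoord M n) (fun _ => M → (Fin n → ℂ)) :=
  ⟨fun ζ => ζ.toOpenPartialHomeomorph⟩

/-- The inverse of a coordinate map. -/
noncomputable def HolCoord.inv {M : Type*} [TopologicalSpace M] [ReducedComplexSpace M] {n : ℕ}
    (ζ : HolCoord M n) : (Fin n → ℂ) → M := ζ.toOpenPartialHomeomorph.symm

/-- `x` is a regular (smooth) point of `M`, of dimension `n`. -/
def IsRegularPt {M : Type*} [TopologicalSpace M] [ReducedComplexSpace M] (n : ℕ) (x : M) : Prop :=
  ∃ ζ : HolCoord M n, x ∈ ζ.source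

/-! ## Holomorphic `(n,0)`-forms on the manifold of regular points -/

/-- The Jacobian determinant `∂η/∂ζ` of a change of coordinates at the point `x`. -/
noncomputable def HolCoord.transJac {M : Type*} [TopologicalSpace M] [ReducedComplexSpace M] {n : ℕ}
    (ζ η : HolCoord M n) (x : M) : ℂ :=
  (fderiv ℂ (fun p => η (ζ.inv p)) (ζ x)).det

/-- The holomorphic `(n,0)`-forms on the manifold of the `n`-dimensional regular points of `M`.
A form `φ` is given by its coefficients: `φ = φ ζ · dζ₁ ∧ ⋯ ∧ dζₙ` on the domain of the
coordinates `ζ`, for all holomorphic coordinates `ζ`. (The coefficient function `φ ζ` is given the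
irrelevant value `0` outside of the domain of `ζ`.) -/
def holForms (M : Type*) [TopologicalSpace M] [ReducedComplexSpace M] (n : ℕ) :
    Submodule ℂ (HolCoord M n → M → ℂ) where
  carrier := {φ |
    (∀ ζ : HolCoord M n, ∀ x ∈ ζ.source, IsHolAt (φ ζ) x) ∧
    (∀ ζ η : HolCoord M n, ∀ x, x ∈ ζ.source → x ∈ η.source →
      φ ζ x = φ η x * ζ.transJac η x) ∧
    (∀ ζ : HolCoord M n, ∀ x, x ∉ ζ.source → φ ζ x = 0)}
  zero_mem' := by
    refine ⟨fun ζ x hx => (ζ.isHolAt_iff x hx _).2 ?_, by simp, by simp⟩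
    exact analyticAt_const (v := (0 : ℂ))
  add_mem' := by
    rintro φ ψ ⟨h1, h2, h3⟩ ⟨k1, k2, k3⟩
    refine ⟨fun ζ x hx => (ζ.isHolAt_iff x hx _).2 ?_, fun ζ η x hx hx' => ?_, fun ζ x hx => ?_⟩
    · exact ((ζ.isHolAt_iff x hx _).1 (h1 ζ x hx)).add ((ζ.isHolAt_iff x hx _).1 (k1 ζ x hx))
    · simp only [Pi.add_apply]
      rw [h2 ζ η x hx hx', k2 ζ η x hx hx']
      ring
    · simp [h3 ζ x hx, k3 ζ x hx]
  smul_mem' := by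
    rintro c φ ⟨h1, h2, h3⟩
    refine ⟨fun ζ x hx => (ζ.isHolAt_iff x hx _).2 ?_, fun ζ η x hx hx' => ?_, fun ζ x hx => ?_⟩
    · exact (analyticAt_const (v := c)).mul ((ζ.isHolAt_iff x hx _).1 (h1 ζ x hx))
    · simp only [Pi.smul_apply, smul_eq_mul]
      rw [h2 ζ η x hx hx']
      ring
    · simp [h3 ζ x hx]

/-! ## Integration: the space of square integrable holomorphic forms -/

/-- The regular points of dimension `n` are covered by the domains of a sequence of coordinates
(some of the terms may be missing). -/
theorem exists_coordCover (M : Type*) [TopologicalSpace M] [SecondCountableTopology M]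
    [ReducedComplexSpace M] (n : ℕ) :
    ∃ c : ℕ → Option (HolCoord M n), ∀ x : M, IsRegularPt n x →
      ∃ j, ∃ ζ, c j = some ζ ∧ x ∈ ζ.source := by
  obtain ⟨T, hT, hU⟩ := TopologicalSpace.isOpen_iUnion_countable
    (fun ζ : HolCoord M n => ζ.source) (fun ζ => ζ.open_source)
  by_cases hne : T.Nonempty
  · obtain ⟨c, hc⟩ := hT.exists_eq_range hne
    refine ⟨fun j => some (c j), fun x ⟨ζ, hζ⟩ => ?_⟩
    have hx : x ∈ ⋃ i ∈ T, i.source := by rw [hU]; exact mem_iUnion.2 ⟨ζ, hζ⟩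
    simp only [mem_iUnion] at hx
    obtain ⟨i, hi, hxi⟩ := hx
    rw [hc] at hi
    obtain ⟨j, rfl⟩ := hi
    exact ⟨j, _, rfl, hxi⟩
  · refine ⟨fun _ => none, fun x ⟨ζ, hζ⟩ => ?_⟩
    have hx : x ∈ ⋃ i ∈ T, i.source := by rw [hU]; exact mem_iUnion.2 ⟨ζ, hζ⟩
    rw [Set.not_nonempty_iff_eq_empty.1 hne] at hx
    simp at hx

/-- A chosen sequence of coordinates whose domains cover the regular points of dimension `n`. -/
noncomputable def coordCover (M : Type*) [TopologicalSpace M] [SecondCountableTopology M]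
    [ReducedComplexSpace M] (n : ℕ) : ℕ → Option (HolCoord M n) :=
  Classical.choose (exists_coordCover M n)

/-- The `j`-th domain of the covering minus the previous ones, in the `j`-th coordinates. These
sets are the images of a countable partition of the manifold of regular points of dimension `n`
into Borel sets, each of them lying in a coordinate domain. -/
def coordPiece (M : Type*) [TopologicalSpace M] [SecondCountableTopology M]
    [ReducedComplexSpace M] (n : ℕ) (j : ℕ) : Set (Fin n → ℂ) :=
  {p | ∃ ζ, coordCover M n j = some ζ ∧ p ∈ ζ.target ∧
    ∀ i < j, ∀ η, coordCover M n i = some η → ζ.inv p ∉ η.source}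

/-- The manifold of regular points of dimension `n`, cut into the pieces above, as the disjoint
union of the sets `coordPiece M n j`, the `j`-th of them carrying the measure
`i^(n²) dζ₁ ∧ ⋯ ∧ dζₙ ∧ conj (dζ₁ ∧ ⋯ ∧ dζₙ)`, that is, `2^n` times Lebesgue measure. -/
noncomputable def coordMeasure (M : Type*) [TopologicalSpace M] [SecondCountableTopology M]
    [ReducedComplexSpace M] (n : ℕ) : Measure (ℕ × (Fin n → ℂ)) :=
  Measure.sum fun j =>
    ((2 : ℝ≥0∞) ^ n) • (volume.restrict (coordPiece M n j)).map (fun p => (j, p))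

/-- The coefficients of a form on the pieces: `(j, p)` is sent to the coefficient, in the `j`-th
coordinates `ζ`, at the point whose coordinates are `p`. -/
noncomputable def coordRep {M : Type*} [TopologicalSpace M] [SecondCountableTopology M]
    [ReducedComplexSpace M] {n : ℕ} (φ : HolCoord M n → M → ℂ) (t : ℕ × (Fin n → ℂ)) : ℂ :=
  (coordCover M n t.1).elim 0 (fun ζ => φ ζ (ζ.inv t.2))

/-- The square integrable holomorphic `(n,0)`-forms, as a space of families of coefficients. -/
noncomputable def bergmanSubmodule (M : Type*) [TopologicalSpace M] [SecondCountableTopology M]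
    [ReducedComplexSpace M] (n : ℕ) : Submodule ℂ (HolCoord M n → M → ℂ) where
  carrier := {φ | φ ∈ holForms M n ∧ MemLp (coordRep φ) 2 (coordMeasure M n)}
  zero_mem' := by
    refine ⟨Submodule.zero_mem _, ?_⟩
    have : coordRep (0 : HolCoord M n → M → ℂ) = 0 := by
      funext t
      unfold coordRep
      cases coordCover M n t.1 <;> simp
    rw [this]
    exact MemLp.zero
  add_mem' := by
    rintro φ ψ ⟨h1, h2⟩ ⟨k1, k2⟩
    refine ⟨Submodule.add_mem _ h1 k1, ?_⟩
    have : coordRep (φ + ψ) = coordRep φ + coordRep ψ := by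
      funext t
      simp only [coordRep, Pi.add_apply]
      cases coordCover M n t.1 <;> simp
    rw [this]
    exact h2.add k2
  smul_mem' := by
    rintro c φ ⟨h1, h2⟩
    refine ⟨Submodule.smul_mem _ c h1, ?_⟩
    have : coordRep (c • φ) = c • coordRep φ := by
      funext t
      simp only [coordRep, Pi.smul_apply]
      cases coordCover M n t.1 <;> simp
    rw [this]
    exact h2.const_smul c

/-- The Bergman space `A²_(n,0)` of the manifold of `n`-dimensional regular points of `M`. -/
def BergmanSpace (M : Type*) [TopologicalSpace M] [SecondCountableTopology M]
    [ReducedComplexSpace M] (n : ℕ) : Type _ := ↥(bergmanSubmodule M n)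

noncomputable instance (M : Type*) [TopologicalSpace M] [SecondCountableTopology M]
    [ReducedComplexSpace M] (n : ℕ) : AddCommGroup (BergmanSpace M n) :=
  inferInstanceAs (AddCommGroup ↥(bergmanSubmodule M n))

noncomputable instance (M : Type*) [TopologicalSpace M] [SecondCountableTopology M]
    [ReducedComplexSpace M] (n : ℕ) : Module ℂ (BergmanSpace M n) :=
  inferInstanceAs (Module ℂ ↥(bergmanSubmodule M n))

/-- `φ.coeff ζ x` is the coefficient of `φ` with respect to `dζ₁ ∧ ⋯ ∧ dζₙ` at the point `x`. -/
def BergmanSpace.coeff {M : Type*} [TopologicalSpace M] [SecondCountableTopology M]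
    [ReducedComplexSpace M] {n : ℕ} (φ : BergmanSpace M n) : HolCoord M n → M → ℂ := φ.1

/-- Changes of coordinates are holomorphic. -/
theorem HolCoord.analyticAt_trans {M : Type*} [TopologicalSpace M] [ReducedComplexSpace M] {n : ℕ}
    (ζ η : HolCoord M n) {x : M} (hζ : x ∈ ζ.source) (hη : x ∈ η.source) :
    AnalyticAt ℂ (fun p => η (ζ.inv p)) (ζ x) := by
  rw [analyticAt_pi_iff]
  intro i
  have h : IsHolAt (fun y => η y i) x := by
    refine (η.isHolAt_iff x hη _).2 ?_
    have h1 : AnalyticAt ℂ (fun p : Fin n → ℂ => p i) (η x) :=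
      (ContinuousLinearMap.proj (R := ℂ) (φ := fun _ : Fin n => ℂ) i).analyticAt _
    refine h1.congr ?_
    filter_upwards [η.open_target.mem_nhds (η.map_source hη)] with p hp
    exact (congrFun (η.right_inv hp) i).symm
  exact (ζ.isHolAt_iff x hζ _).1 h

/-- A holomorphic form whose coefficients on the pieces vanish almost everywhere is zero. -/
theorem holForms_eq_zero_of_ae {M : Type*} [TopologicalSpace M] [SecondCountableTopology M]
    [ReducedComplexSpace M] {n : ℕ} {φ : HolCoord M n → M → ℂ} (hφ : φ ∈ holForms M n)
    (h0 : coordRep φ =ᵐ[coordMeasure M n] 0) : φ = 0 := by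
  obtain ⟨h1, h2, h3⟩ := hφ
  have hpiece : ∀ j ζ, coordCover M n j = some ζ →
      volume {p | p ∈ coordPiece M n j ∧ φ ζ (ζ.inv p) ≠ 0} = 0 := by
    intro j ζ hj
    have hle : ((2 : ℝ≥0∞) ^ n) • (volume.restrict (coordPiece M n j)).map (fun p => (j, p)) ≤
        coordMeasure M n := Measure.le_sum (fun j =>
          ((2 : ℝ≥0∞) ^ n) • (volume.restrict (coordPiece M n j)).map (fun p => (j, p))) j
    have hj1 : ∀ᵐ t ∂(((2 : ℝ≥0∞) ^ n) •
        (volume.restrict (coordPiece M n j)).map (fun p => (j, p))), coordRep φ t = 0 :=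
      ae_mono hle h0
    have hj2 := (Measure.ae_ennreal_smul_measure_iff (by simp : ((2 : ℝ≥0∞) ^ n) ≠ 0)).1 hj1
    have hj3 := ae_of_ae_map (measurable_prodMk_left.aemeasurable) hj2
    have hj4 := ae_imp_of_ae_restrict hj3
    rw [ae_iff] at hj4
    refine measure_mono_null ?_ hj4
    rintro p ⟨hp, hne⟩ H
    have := H hp
    simp only [coordRep, hj, Option.elim] at this
    exact hne this
  funext ζ x
  by_cases hx : x ∈ ζ.source
  swap
  · exact h3 ζ x hx
  by_contra hne
  have hne : φ ζ x ≠ 0 := hne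
  have hW : {p | p ∈ ζ.target ∧ φ ζ (ζ.inv p) ≠ 0} ∈ 𝓝 (ζ x) := by
    have hc : ContinuousAt (fun p => φ ζ (ζ.inv p)) (ζ x) :=
      ((ζ.isHolAt_iff x hx _).1 (h1 ζ x hx)).continuousAt
    have hv : φ ζ (ζ.inv (ζ x)) ≠ 0 := by
      have : ζ.inv (ζ x) = x := ζ.left_inv hx
      rwa [this]
    exact inter_mem (ζ.open_target.mem_nhds (ζ.map_source hx)) (hc.eventually_ne hv)
  refine (Measure.measure_pos_of_mem_nhds volume hW).ne' ?_
  have hsub : {p | p ∈ ζ.target ∧ φ ζ (ζ.inv p) ≠ 0} ⊆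
      ⋃ j, {p | ∃ η, coordCover M n j = some η ∧ p ∈ (fun q => ζ (η.inv q)) ''
        {q | (q ∈ coordPiece M n j ∧ φ η (η.inv q) ≠ 0) ∧
          (q ∈ η.target ∧ η.inv q ∈ ζ.source)}} := by
    classical
    rintro p ⟨hp, hpne⟩
    have hy : ζ.inv p ∈ ζ.source := ζ.map_target hp
    have hex := Classical.choose_spec (exists_coordCover M n) (ζ.inv p) ⟨ζ, hy⟩
    obtain ⟨η, hη, hyη⟩ := Nat.find_spec hex
    have hl : η.inv (η (ζ.inv p)) = ζ.inv p := η.left_inv hyη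
    refine mem_iUnion.2 ⟨Nat.find hex, η, hη, η (ζ.inv p), ⟨⟨⟨η, hη, η.map_source hyη, ?_⟩, ?_⟩,
      η.map_source hyη, ?_⟩, ?_⟩
    · intro i hi θ hθ hmem
      rw [hl] at hmem
      exact Nat.find_min hex hi ⟨θ, hθ, hmem⟩
    · rw [hl]
      intro hz
      exact hpne (by rw [h2 ζ η _ hy hyη, hz, zero_mul])
    · rw [hl]
      exact hy
    · change ζ (η.inv (η (ζ.inv p))) = p
      rw [hl]
      exact ζ.right_inv hp
  refine measure_mono_null hsub (measure_iUnion_null fun j => ?_)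
  rcases hj : coordCover M n j with _ | η
  · simp
  · have : {p | ∃ η', some η = some η' ∧ p ∈ (fun q => ζ (η'.inv q)) ''
        {q | (q ∈ coordPiece M n j ∧ φ η' (η'.inv q) ≠ 0) ∧
          (q ∈ η'.target ∧ η'.inv q ∈ ζ.source)}} = (fun q => ζ (η.inv q)) ''
        {q | (q ∈ coordPiece M n j ∧ φ η (η.inv q) ≠ 0) ∧
          (q ∈ η.target ∧ η.inv q ∈ ζ.source)} := by
      ext p
      constructor
      · rintro ⟨η', h, hp⟩
        cases h
        exact hp
      · exact fun hp => ⟨η, rfl, hp⟩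
    rw [this]
    refine addHaar_image_eq_zero_of_differentiableOn_of_addHaar_eq_zero volume ?_
      (measure_mono_null (fun q hq => hq.1) (hpiece j η hj))
    rintro q ⟨-, hq, hq'⟩
    have hr : η (η.inv q) = q := η.right_inv hq
    have han := HolCoord.analyticAt_trans η ζ (x := η.inv q) (η.map_target hq) hq'
    rw [hr] at han
    exact (han.differentiableAt.restrictScalars ℝ).differentiableWithinAt

/-- The Hermitian inner product `⟪φ, ψ⟫ = i^(n²) ∫ ψ ∧ conj φ` of the Bergman space (it is linear
in the second argument). -/
@[reducible] noncomputable def bergmanCore (M : Type*) [TopologicalSpace M] [SecondCountableTopology M]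
    [ReducedComplexSpace M] (n : ℕ) : InnerProductSpace.Core ℂ (BergmanSpace M n) where
  inner φ ψ := ∫ t, coordRep ψ.coeff t * conj (coordRep φ.coeff t) ∂(coordMeasure M n)
  conj_inner_symm φ ψ := by
    rw [← integral_conj]
    congr 1
    funext t
    simp [mul_comm]
  re_inner_nonneg φ := by
    have : ∀ t, coordRep φ.coeff t * conj (coordRep φ.coeff t) =
        ((‖coordRep φ.coeff t‖ ^ 2 : ℝ) : ℂ) := fun t => by
      rw [Complex.mul_conj']
      push_cast
      rfl
    have h2 : ∫ t, coordRep φ.coeff t * conj (coordRep φ.coeff t) ∂(coordMeasure M n) =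
        ((∫ t, ‖coordRep φ.coeff t‖ ^ 2 ∂(coordMeasure M n) : ℝ) : ℂ) := by
      simp_rw [this]
      exact integral_ofReal
    rw [h2]
    exact integral_nonneg fun t => by positivity
  add_left φ ψ χ := by
    have hadd : coordRep (φ + ψ).coeff = coordRep φ.coeff + coordRep ψ.coeff := by
      funext t
      change coordRep (φ.1 + ψ.1) t = _
      simp only [coordRep, Pi.add_apply, BergmanSpace.coeff]
      cases coordCover M n t.1 <;> simp
    rw [hadd, ← integral_add]
    · congr 1
      funext t
      simp [mul_add]
    · exact χ.2.2.integrable_mul φ.2.2.star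
    · exact χ.2.2.integrable_mul ψ.2.2.star
  smul_left φ ψ c := by
    have hsmul : coordRep (c • φ).coeff = c • coordRep φ.coeff := by
      funext t
      change coordRep (c • φ.1) t = _
      simp only [coordRep, Pi.smul_apply, BergmanSpace.coeff]
      cases coordCover M n t.1 <;> simp
    rw [hsmul, ← integral_const_mul]
    congr 1
    funext t
    simp
    ring
  definite φ h := by
    have h' : ∫ t, coordRep φ.coeff t * conj (coordRep φ.coeff t) ∂(coordMeasure M n) = 0 := h
    have : ∀ t, coordRep φ.coeff t * conj (coordRep φ.coeff t) =
        ((‖coordRep φ.coeff t‖ ^ 2 : ℝ) : ℂ) := fun t => by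
      rw [Complex.mul_conj']
      push_cast
      rfl
    have h2 : ∫ t, coordRep φ.coeff t * conj (coordRep φ.coeff t) ∂(coordMeasure M n) =
        ((∫ t, ‖coordRep φ.coeff t‖ ^ 2 ∂(coordMeasure M n) : ℝ) : ℂ) := by
      simp_rw [this]
      exact integral_ofReal
    have hint : Integrable (fun t => ‖coordRep φ.coeff t‖ ^ 2) (coordMeasure M n) :=
      φ.2.2.integrable_norm_pow (by norm_num)
    rw [h2, Complex.ofReal_eq_zero,
      integral_eq_zero_iff_of_nonneg (fun t => by positivity) hint] at h'
    refine Subtype.ext (holForms_eq_zero_of_ae φ.2.1 ?_)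
    filter_upwards [h'] with t ht
    have h3 : coordRep φ.coeff t = 0 := by simpa using ht
    exact h3

noncomputable instance (M : Type*) [TopologicalSpace M] [SecondCountableTopology M]
    [ReducedComplexSpace M] (n : ℕ) : NormedAddCommGroup (BergmanSpace M n) :=
  (bergmanCore M n).toNormedAddCommGroup

noncomputable instance (M : Type*) [TopologicalSpace M] [SecondCountableTopology M]
    [ReducedComplexSpace M] (n : ℕ) : InnerProductSpace ℂ (BergmanSpace M n) :=
  InnerProductSpace.ofCore (bergmanCore M n).toCore

/-! ## The Bergman kernel form -/

/-- `S` is an orthonormal basis of the Bergman space: an orthonormal system that is complete,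
that is, only the zero form is orthogonal to all members of `S`. -/
def IsBergmanBasis {M : Type*} [TopologicalSpace M] [SecondCountableTopology M]
    [ReducedComplexSpace M] {n : ℕ} (S : Set (BergmanSpace M n)) : Prop :=
  Orthonormal ℂ (Subtype.val : S → BergmanSpace M n) ∧
    ∀ ψ : BergmanSpace M n, (∀ φ ∈ S, inner ℂ φ ψ = 0) → ψ = 0

theorem exists_isBergmanBasis (M : Type*) [TopologicalSpace M] [SecondCountableTopology M]
    [ReducedComplexSpace M] (n : ℕ) : ∃ S : Set (BergmanSpace M n), IsBergmanBasis S := by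
  obtain ⟨S, -, hS, hmax⟩ := exists_maximal_orthonormal (𝕜 := ℂ) (E := BergmanSpace M n)
    (s := ∅) (orthonormal_empty ℂ _)
  refine ⟨S, hS, fun ψ hψ => ?_⟩
  have := (maximal_orthonormal_iff_orthogonalComplement_eq_bot hS).1 hmax
  rw [← Submodule.mem_bot ℂ, ← this, Submodule.mem_orthogonal]
  intro u hu
  induction hu using Submodule.span_induction with
  | mem x hx => exact hψ x hx
  | zero => simp
  | add x y _ _ hx hy => rw [inner_add_left, hx, hy, add_zero]
  | smul a x _ hx => rw [inner_smul_left, hx, mul_zero]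

/-- A form `K(x, ȳ)` of degree `n` in `dx` and of degree `n` in `dȳ`, given by its coefficients:
`K ζ η x y` is the coefficient with respect to
`dζ₁ ∧ ⋯ ∧ dζₙ ∧ conj (dη₁ ∧ ⋯ ∧ dηₙ)`, where `ζ` are coordinates at `x` and `η` at `y`. -/
abbrev KernelForm (M : Type*) [TopologicalSpace M] [ReducedComplexSpace M] (n : ℕ) :=
  HolCoord M n → HolCoord M n → M → M → ℂ

/-- The Bergman kernel form `K_M(x, ȳ) = i^(n²) ∑ φₖ(x) ∧ conj φₖ(y)` of `M`, that is, of the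
manifold of the (`n`-dimensional) regular points of `M`; the `φₖ` run through an orthonormal basis
of the Bergman space. -/
noncomputable def bergmanKernel (M : Type*) [TopologicalSpace M] [SecondCountableTopology M]
    [ReducedComplexSpace M] (n : ℕ) : KernelForm M n := fun ζ η x y =>
  Complex.I ^ (n ^ 2) * ∑' φ : ↥(Classical.choose (exists_isBergmanBasis M n)),
    φ.1.coeff ζ x * conj (φ.1.coeff η y)

/-- The Bergman kernel is well defined: for every orthonormal basis of the Bergman space the
defining series converges (absolutely, at every pair of points), and its sum is `K_M`. -/
def BergmanKernelWellDefined (M : Type*) [TopologicalSpace M] [SecondCountableTopology M]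
    [ReducedComplexSpace M] (n : ℕ) : Prop :=
  ∀ S : Set (BergmanSpace M n), IsBergmanBasis S →
    ∀ ζ η : HolCoord M n, ∀ x ∈ ζ.source, ∀ y ∈ η.source,
      HasSum (fun φ : S => Complex.I ^ (n ^ 2) * (φ.1.coeff ζ x * conj (φ.1.coeff η y)))
        (bergmanKernel M n ζ η x y)

/-! ## Holomorphic maps, pull-backs and coverings -/

/-- Chosen coordinates at a regular point. -/
noncomputable def coordAt {M : Type*} [TopologicalSpace M] [ReducedComplexSpace M] {n : ℕ} {x : M}
    (hx : IsRegularPt n x) : HolCoord M n := Classical.choose hx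

/-- The Jacobian determinant at `z ∈ U` of a map `g` from an open subset `U` of `N` to `M`, in the
coordinates `ζ` of `N` at `z` and `α` of `M` at `g z`. -/
noncomputable def jacobian {N M : Type*} [TopologicalSpace N] [ReducedComplexSpace N]
    [TopologicalSpace M] [ReducedComplexSpace M] {n : ℕ} {U : Set N} (g : U → M)
    (ζ : HolCoord N n) (α : HolCoord M n) (z : U) : ℂ :=
  (fderiv ℂ (fun p => Function.extend Subtype.val (fun x : U => α (g x)) 0 (ζ.inv p)) (ζ z)).det

/-- The coefficient, at `(z, w)` and in the coordinates `ζ` at `z` and `ω` at `w`, of the pull-back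
`(g, h)^* K` of a form `K(x, ȳ)` on `M`. It does not depend on the coordinates of `M` that are used
in its computation. -/
noncomputable def pullbackKernel {N M : Type*} [TopologicalSpace N] [ReducedComplexSpace N]
    [TopologicalSpace M] [ReducedComplexSpace M] {n : ℕ} {U : Set N} (g h : U → M)
    (hg : ∀ z, IsRegularPt n (g z)) (hh : ∀ z, IsRegularPt n (h z)) (K : KernelForm M n)
    (ζ ω : HolCoord N n) (z w : U) : ℂ :=
  K (coordAt (hg z)) (coordAt (hh w)) (g z) (h w) *
    jacobian g ζ (coordAt (hg z)) z * conj (jacobian h ω (coordAt (hh w)) w)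

/-- Holomorphy, at a point of an open subset `U`, of a function that is defined on `U` only. -/
def IsHolAtOn {M : Type*} [TopologicalSpace M] [ReducedComplexSpace M] {U : Set M} (h : U → ℂ)
    (x : U) : Prop :=
  IsHolAt (Function.extend Subtype.val h 0) x

/-- An `m`-sheeted holomorphic covering `f : U₁ → U₂`: a topological covering map all of whose
fibres have exactly `m` points, and which maps its sheets biholomorphically, that is, locally the
holomorphic functions `h` downstairs correspond to the holomorphic functions `h ∘ f` upstairs. -/
structure IsHolCovering {M₁ M₂ : Type*} [TopologicalSpace M₁] [ReducedComplexSpace M₁]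
    [TopologicalSpace M₂] [ReducedComplexSpace M₂] {U₁ : Set M₁} {U₂ : Set M₂}
    (f : U₁ → U₂) (m : ℕ) : Prop where
  isCoveringMap : IsCoveringMap f
  card_fibre : ∀ y, (f ⁻¹' {y}).encard = m
  isHolAt_iff : ∀ (x : U₁) (h : U₂ → ℂ), IsHolAtOn h (f x) ↔ IsHolAtOn (h ∘ f) x

/-- The group of deck transformations of `f`. -/
def deckGroup {X Y : Type*} [TopologicalSpace X] (f : X → Y) : Subgroup (X ≃ₜ X) where
  carrier := {γ | ∀ x, f (γ x) = f x}
  one_mem' _ := rfl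
  mul_mem' {a b} ha hb x := (ha (b x)).trans (hb x)
  inv_mem' {a} ha x := by
    have h := ha (a⁻¹ x)
    have h2 : a (a⁻¹ x) = x := a.apply_symm_apply x
    rw [h2] at h
    exact h.symm

/-! ## Holomorphic functions of several variables -/

/-! The Bergman space is a Hilbert space on which reading off a coefficient at a point is
continuous, so this functional is represented by a form `kern ζ x`. Parseval's identity turns the
defining series, for every orthonormal basis, into the inner product of `kern ζ x` and `kern η y`
(`hasSum_coeff_mul_conj_coeff`, `bergmanKernel_eq`). The theorem becomes an identity between
reproducing forms: if F and G_γ are the pull-backs of forms by f and by γ, and J is the Jacobian of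
f at w, then F (conj J • kern at f w) = ∑ G_γ (kern at w). The coefficient of this identity at z is
the first formula (`IsSheeted.sum_inner_kern`); the second follows from it by the Hermitian symmetry
of the kernel.

To prove the identity, pair both sides with a form ψ. The adjoint of G_γ is the pull-back by the
inverse of γ, so the right side gives the coefficient at w of χ = ∑ G_γ ψ. This χ is Γ-invariant and
Γ is transitive on the fibres, so χ = F φ for a square integrable φ downstairs
(`IsSheeted.exists_isPull_apply_eq`). On the left side write k for conj J • kern at f w. As F k is
invariant, m = |Γ| times its pairing with ψ is ⟨F k, χ⟩ = ⟨F k, F φ⟩ = m ⟨k, φ⟩, the last m being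
the number of sheets (`IsSheeted.formMeasure_pullForm`), and by the reproducing property this is m
times the coefficient of F φ at w. For a connected total space, transitivity follows from |Γ| = m
and unique lifting.

Pulled back forms live only on the complement of V₁, so they have to be extended
(`AnalyticSubvariety.exists_extension`). Where the complement is dense near a regular point, V₁ lies
in a proper analytic zero set, and square integrability makes the singularity removable: the
extension is the average over circles that avoid the zeros, in a fixed direction. A subvariety may
also contain entire components of the regular part; there the extension is zero. Hence the pull-back
by the identity is in general only the orthogonal projection onto the forms that vanish off the
closure of the complement, and G_γ and F preserve inner products (up to the factor m) only modulo
such projections.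

Boundedness of evaluations comes from a mean value inequality on balls, and completeness from this
bound together with the theorems of Weierstrass and Osgood. -/

theorem exists_ball_subset_norm_le {E F : Type*} [SeminormedAddCommGroup E]
    [SeminormedAddCommGroup F] {f : E → F} {U : Set E} (hU : IsOpen U)
    (hf : ContinuousOn f U) {a : E} (ha : a ∈ U) :
    ∃ r > 0, ∃ M, Metric.ball a r ⊆ U ∧ ∀ x ∈ Metric.ball a r, ‖f x‖ ≤ M := by
  have hc : ContinuousAt (fun x => ‖f x‖) a := (hf.continuousAt (hU.mem_nhds ha)).norm
  have h1 : ∀ᶠ x in 𝓝 a, x ∈ U ∧ ‖f x‖ < ‖f a‖ + 1 :=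
    (show ∀ᶠ x in 𝓝 a, x ∈ U from hU.mem_nhds ha).and (hc.eventually_lt_const (by simp))
  obtain ⟨r, hr, hs⟩ := Metric.eventually_nhds_iff_ball.1 h1
  exact ⟨r, hr, ‖f a‖ + 1, fun x hx => (hs x hx).1, fun x hx => (hs x hx).2.le⟩

section SeveralVariables

variable {E : Type*} [NormedAddCommGroup E] [NormedSpace ℂ E]
  {F : Type*} [NormedAddCommGroup F] [NormedSpace ℂ F]

/-- Cauchy estimate for the derivative of a bounded holomorphic function on a ball. -/
theorem norm_fderiv_le_of_norm_le_ball {f : E → F} {a : E} {r M : ℝ} (hr : 0 < r)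
    (hf : DifferentiableOn ℂ f (Metric.ball a r)) (hM : ∀ x ∈ Metric.ball a r, ‖f x‖ ≤ M) :
    ‖fderiv ℂ f a‖ ≤ 2 * M / r := by
  -- The values of `f` lie in the closed ball of radius `2 * M` about `f a`, whence the factor 2.
  refine Complex.norm_fderiv_le_div_of_mapsTo_ball hf (fun x hx => ?_) hr
  rw [Metric.mem_closedBall, dist_eq_norm]
  have h1 := hM x hx
  have h2 := hM a (Metric.mem_ball_self hr)
  linarith [norm_sub_le (f x) (f a)]

/-- Weierstrass: a uniform limit of holomorphic functions is holomorphic. -/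
theorem differentiableAt_of_tendstoUniformlyOn_ball [CompleteSpace F] {f : ℕ → E → F} {g : E → F}
    {a : E} {r : ℝ} (hr : 0 < r) (hf : ∀ k, DifferentiableOn ℂ (f k) (Metric.ball a r))
    (hg : TendstoUniformlyOn f g atTop (Metric.ball a r)) : DifferentiableAt ℂ g a := by
  have hsub : ∀ x ∈ Metric.ball a (r / 2), Metric.ball x (r / 2) ⊆ Metric.ball a r := by
    intro x hx
    refine Metric.ball_subset_ball' ?_
    have := Metric.mem_ball.1 hx
    linarith
  have hd : ∀ k, ∀ x ∈ Metric.ball a r, DifferentiableAt ℂ (f k) x := fun k x hx =>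
    (hf k x hx).differentiableAt (Metric.isOpen_ball.mem_nhds hx)
  have hsub' : Metric.ball a (r / 2) ⊆ Metric.ball a r := Metric.ball_subset_ball (by linarith)
  -- The Cauchy estimate on balls of radius `r / 2` turns the uniform Cauchy property of the
  -- functions into that of their derivatives on the half-size ball; `ε * r / 8` is chosen so that
  -- the estimate yields `ε / 2`.
  have hC : UniformCauchySeqOn (fun k => fderiv ℂ (f k)) atTop (Metric.ball a (r / 2)) := by
    rw [Metric.uniformCauchySeqOn_iff]
    intro ε hε
    obtain ⟨N, hN⟩ := Metric.uniformCauchySeqOn_iff.1 hg.uniformCauchySeqOn (ε * r / 8)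
      (by positivity)
    refine ⟨N, fun k hk l hl x hx => ?_⟩
    have h1 : ‖fderiv ℂ (fun y => f k y - f l y) x‖ ≤ 2 * (ε * r / 8) / (r / 2) := by
      refine norm_fderiv_le_of_norm_le_ball (by positivity)
        (((hf k).sub (hf l)).mono (hsub x hx)) fun y hy => ?_
      have := hN k hk l hl y (hsub x hx hy)
      rw [dist_eq_norm] at this
      exact this.le
    rw [fderiv_fun_sub (hd k x (hsub' hx)) (hd l x (hsub' hx))] at h1
    rw [dist_eq_norm]
    refine h1.trans_lt ?_
    have : 2 * (ε * r / 8) / (r / 2) = ε / 2 := by field_simp; ring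
    linarith
  have hlim : ∀ x ∈ Metric.ball a (r / 2), ∃ L, Tendsto (fun k => fderiv ℂ (f k) x) atTop (𝓝 L) :=
    fun x hx => cauchySeq_tendsto_of_complete (hC.cauchySeq hx)
  choose! L hL using hlim
  exact (hasFDerivAt_of_tendstoUniformlyOn Metric.isOpen_ball
    (hC.tendstoUniformlyOn_of_tendsto hL) (fun k x hx => (hd k x (hsub' hx)).hasFDerivAt)
    (fun x hx => hg.tendsto_at (hsub' hx)) (Metric.mem_ball_self (by positivity))).differentiableAt

/-- Directional derivatives of holomorphic functions are holomorphic. -/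
theorem differentiableOn_fderiv_apply [CompleteSpace F] {f : E → F} {U : Set E}
    (hU : IsOpen U) (hf : DifferentiableOn ℂ f U) (v : E) :
    DifferentiableOn ℂ (fun x => fderiv ℂ f x v) U := by
  intro a ha
  obtain ⟨r, hr, M, hrU, hM⟩ := exists_ball_subset_norm_le hU hf.continuousOn ha
  have hM0 : 0 ≤ M := (norm_nonneg _).trans (hM a (Metric.mem_ball_self hr))
  refine DifferentiableAt.differentiableWithinAt ?_
  obtain ⟨δ, hδ, hδv⟩ : ∃ δ > 0, δ * ‖v‖ < r / 2 := by
    refine ⟨r / (4 * (‖v‖ + 1)), by positivity, ?_⟩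
    rw [div_mul_eq_mul_div, div_lt_div_iff₀ (by positivity) (by positivity)]
    nlinarith [norm_nonneg v]
  have hmem : ∀ x ∈ Metric.ball a (r / 2), ∀ t ∈ Metric.ball (0 : ℂ) δ,
      x + t • v ∈ Metric.ball a r := by
    intro x hx t ht
    rw [Metric.mem_ball, dist_eq_norm] at *
    have h1 : ‖t • v‖ ≤ δ * ‖v‖ := by
      rw [norm_smul]
      exact mul_le_mul_of_nonneg_right (by simpa using ht.le) (norm_nonneg _)
    calc ‖x + t • v - a‖ = ‖(x - a) + t • v‖ := by congr 1; abel
      _ ≤ ‖x - a‖ + ‖t • v‖ := norm_add_le _ _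
      _ < r := by linarith
  have hd : ∀ x ∈ Metric.ball a r, DifferentiableAt ℂ f x := fun x hx =>
    (hf x (hrU hx)).differentiableAt (hU.mem_nhds (hrU hx))
  -- The directional derivative will be the uniform limit of difference quotients with steps `h k`.
  -- The summand 2 keeps the step strictly inside the disc of radius `δ` also for `k = 0`.
  let h : ℕ → ℂ := fun k => ((δ / (k + 2) : ℝ) : ℂ)
  have hnorm : ∀ k, ‖h k‖ = δ / (k + 2) := fun k => by
    rw [Complex.norm_real, Real.norm_of_nonneg (by positivity)]
  have hh : ∀ k, h k ∈ Metric.ball (0 : ℂ) δ := fun k => by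
    rw [mem_ball_zero_iff, hnorm]
    refine div_lt_self hδ ?_
    have : (0 : ℝ) ≤ k := k.cast_nonneg
    linarith
  have hh0 : ∀ k, h k ≠ 0 := fun k => by
    rw [← norm_pos_iff, hnorm]
    positivity
  refine differentiableAt_of_tendstoUniformlyOn_ball (r := r / 2)
    (f := fun k x => (h k)⁻¹ • (f (x + h k • v) - f x)) (by positivity) (fun k x hx => ?_) ?_
  · refine DifferentiableAt.differentiableWithinAt (DifferentiableAt.const_smul ?_ _)
    refine DifferentiableAt.sub ?_ (hd x (Metric.ball_subset_ball (by linarith) hx))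
    exact DifferentiableAt.comp x (hd _ (hmem x hx _ (hh k)))
      (differentiableAt_id.add_const _)
  -- On the line through `x` both terms are values of `dslope g 0`, at `0` and at `h k`. This
  -- function is holomorphic and bounded by `2 * M / δ`, so the Schwarz lemma bounds their distance
  -- linearly in the step, uniformly in `x`.
  · have key : ∀ x ∈ Metric.ball a (r / 2), ∀ k,
        dist (fderiv ℂ f x v) ((h k)⁻¹ • (f (x + h k • v) - f x)) ≤
          4 * M / δ / δ * (δ / (k + 2)) := by
      intro x hx k
      have hg : DifferentiableOn ℂ (fun t : ℂ => f (x + t • v)) (Metric.ball 0 δ) := fun t ht =>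
        (DifferentiableAt.comp t (hd _ (hmem x hx t ht))
          ((differentiableAt_id.smul_const v).const_add x)).differentiableWithinAt
      set g : ℂ → F := fun t => f (x + t • v) with hgdef
      have hball : Metric.ball (0 : ℂ) δ ∈ 𝓝 0 := Metric.ball_mem_nhds _ hδ
      have hds := (Complex.differentiableOn_dslope hball).2 hg
      have hb : ∀ t ∈ Metric.ball (0 : ℂ) δ, ‖dslope g 0 t‖ ≤ 2 * M / δ := fun t ht => by
        refine Complex.norm_dslope_le_div_of_mapsTo_ball hg (fun s hs => ?_) ht
        rw [Metric.mem_closedBall, dist_eq_norm]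
        have h1 := hM _ (hmem x hx s hs)
        have h2 := hM _ (hmem x hx 0 (Metric.mem_ball_self hδ))
        linarith [norm_sub_le (g s) (g 0)]
      have hS := Complex.dist_le_div_mul_dist_of_mapsTo_ball (R₂ := 4 * M / δ) hds
        (fun s hs => by
          rw [Metric.mem_closedBall, dist_eq_norm]
          have h1 := hb s hs
          have h2 := hb 0 (Metric.mem_ball_self hδ)
          have h3 : 4 * M / δ = 2 * M / δ + 2 * M / δ := by ring
          linarith [norm_sub_le (dslope g 0 s) (dslope g 0 0)]) (hh k)
      rw [dist_zero_right, hnorm, dslope_same, dslope_of_ne _ (hh0 k), slope_def_module] at hS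
      have hderiv : deriv g 0 = fderiv ℂ f x v := by
        have hx' : x ∈ Metric.ball a r := Metric.ball_subset_ball (by linarith) hx
        have h1 : HasDerivAt (fun t : ℂ => x + t • v) v 0 := by
          simpa using ((hasDerivAt_id (0 : ℂ)).smul_const v).const_add x
        have h2 : HasFDerivAt f (fderiv ℂ f x) (x + (0 : ℂ) • v) := by
          simpa using (hd x hx').hasFDerivAt
        exact (h2.comp_hasDerivAt (0 : ℂ) h1).deriv
      rw [hderiv, dist_comm] at hS
      simpa [hgdef] using hS
    rw [Metric.tendstoUniformlyOn_iff]
    intro ε hε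
    have hlim : Tendsto (fun k : ℕ => 4 * M / δ / δ * (δ / ((k : ℝ) + 2))) atTop (𝓝 0) := by
      have h1 : Tendsto (fun k : ℕ => δ / ((k : ℝ) + 2)) atTop (𝓝 0) :=
        Tendsto.div_atTop tendsto_const_nhds
          (tendsto_atTop_add_const_right _ _ tendsto_natCast_atTop_atTop)
      simpa using h1.const_mul (4 * M / δ / δ)
    filter_upwards [hlim.eventually_lt_const hε] with k hk x hx
    exact (key x hx k).trans_lt hk

/-- Induction on the order: directional derivatives are again holomorphic, and in finite dimension
smoothness of the derivative can be tested on fixed directions. The function is quantified inside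
since the inductive step changes it. -/
theorem contDiffOn_nat_of_differentiableOn [FiniteDimensional ℂ E] [CompleteSpace F]
    {U : Set E} (hU : IsOpen U) (N : ℕ) :
    ∀ f : E → F, DifferentiableOn ℂ f U → ContDiffOn ℂ N f U := by
  induction N with
  | zero => exact fun f hf => contDiffOn_zero.2 hf.continuousOn
  | succ N ih =>
    intro f hf
    rw [Nat.cast_succ, contDiffOn_succ_iff_fderiv_of_isOpen hU]
    refine ⟨hf, by simp, contDiffOn_clm_apply.2 fun v => ih _ (differentiableOn_fderiv_apply hU hf v)⟩

/-- Each derivative costs one Cauchy estimate on a ball of radius `s`: a factor `2 / s`, and a loss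
of `s` in the distance to the boundary. -/
theorem norm_iteratedFDeriv_le_of_norm_le [FiniteDimensional ℂ E] [CompleteSpace F] {f : E → F}
    {U : Set E} (hU : IsOpen U) (hf : DifferentiableOn ℂ f U) {M s : ℝ} (hs : 0 < s)
    (hM : ∀ x ∈ U, ‖f x‖ ≤ M) (k : ℕ) :
    ∀ x ∈ U, Metric.ball x (k * s) ⊆ U → ‖iteratedFDeriv ℂ k f x‖ ≤ M * (2 / s) ^ k := by
  induction k with
  | zero => intro x hx _; simpa using hM x hx
  | succ k ih =>
    intro x hx hxU
    have hsub : ∀ y ∈ Metric.ball x s, Metric.ball y (k * s) ⊆ U := fun y hy =>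
      (Metric.ball_subset_ball' (by
        have := Metric.mem_ball.1 hy
        push_cast
        linarith)).trans hxU
    have hyU : Metric.ball x s ⊆ U := (Metric.ball_subset_ball (by
        push_cast
        nlinarith [(Nat.cast_nonneg k : (0 : ℝ) ≤ k)])).trans hxU
    have hdiff : DifferentiableOn ℂ (iteratedFDeriv ℂ k f) (Metric.ball x s) := by
      have h1 := contDiffOn_nat_of_differentiableOn hU (k + 1) f hf
      intro y hy
      have h2 : ContDiffAt ℂ ((k + 1 : ℕ) : WithTop ℕ∞) f y :=
        (h1 y (hyU hy)).contDiffAt (hU.mem_nhds (hyU hy))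
      exact (h2.differentiableAt_iteratedFDeriv (by exact_mod_cast Nat.lt_succ_self k)).differentiableWithinAt
    have := norm_fderiv_le_of_norm_le_ball hs hdiff fun y hy => ih y (hyU hy) (hsub y hy)
    rw [norm_fderiv_iteratedFDeriv] at this
    refine this.trans_eq ?_
    rw [pow_succ]
    ring

/-- This reduces the convergence of the Taylor series in several variables to the one-variable
theorem on each complex line through the centre. -/
theorem iteratedDeriv_comp_line [FiniteDimensional ℂ E] [CompleteSpace F] {f : E → F} {U : Set E}
    (hU : IsOpen U) (hf : DifferentiableOn ℂ f U) (a y : E) (k : ℕ) :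
    ∀ t : ℂ, a + t • y ∈ U → iteratedDeriv k (fun s : ℂ => f (a + s • y)) t =
      iteratedFDeriv ℂ k f (a + t • y) (fun _ => y) := by
  induction k with
  | zero => intro t _; simp
  | succ k ih =>
    intro t ht
    rw [iteratedDeriv_succ, iteratedFDeriv_succ_apply_left]
    have hc : Continuous fun s : ℂ => a + s • y := by fun_prop
    have hev : iteratedDeriv k (fun s : ℂ => f (a + s • y)) =ᶠ[𝓝 t]
        fun s => iteratedFDeriv ℂ k f (a + s • y) (fun _ => y) := by
      filter_upwards [hc.continuousAt.preimage_mem_nhds (hU.mem_nhds ht)] with s hs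
      exact ih s hs
    rw [hev.deriv_eq]
    have h2 : ContDiffAt ℂ ((k + 1 : ℕ) : WithTop ℕ∞) f (a + t • y) :=
      (contDiffOn_nat_of_differentiableOn hU (k + 1) f hf _ ht).contDiffAt (hU.mem_nhds ht)
    have h3 := (h2.differentiableAt_iteratedFDeriv
      (by exact_mod_cast Nat.lt_succ_self k)).hasFDerivAt
    have h1 : HasDerivAt (fun t : ℂ => a + t • y) y t := by
      simpa using ((hasDerivAt_id t).smul_const y).const_add a
    have h4 := h3.comp_hasDerivAt t h1
    have h5 := ((ContinuousMultilinearMap.apply ℂ (fun _ : Fin k => E) F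
      (fun _ => y)).hasFDerivAt).comp_hasDerivAt t h4
    exact h5.deriv

/-- Osgood: a complex differentiable function on an open subset of a finite dimensional space is
analytic. -/
theorem analyticAt_of_differentiableOn [FiniteDimensional ℂ E] [CompleteSpace F] {f : E → F}
    {U : Set E} (hU : IsOpen U) (hf : DifferentiableOn ℂ f U) {a : E} (ha : a ∈ U) :
    AnalyticAt ℂ f a := by
  obtain ⟨r, hr, M, hrU, hM⟩ := exists_ball_subset_norm_le hU hf.continuousOn ha
  have hM0 : 0 ≤ M := (norm_nonneg _).trans (hM a (Metric.mem_ball_self hr))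
  replace hf := hf.mono hrU
  have hB : IsOpen (Metric.ball a r) := Metric.isOpen_ball
  -- The radius is divided into `k` equal steps `r / k`, one for each derivative.
  have hbound : ∀ k : ℕ, ‖iteratedFDeriv ℂ k f a‖ ≤ M * (2 * k / r) ^ k := by
    intro k
    rcases Nat.eq_zero_or_pos k with rfl | hk
    · simpa using hM a (Metric.mem_ball_self hr)
    · have hk' : (0 : ℝ) < k := by exact_mod_cast hk
      have := norm_iteratedFDeriv_le_of_norm_le hB hf (s := r / k) (by positivity) hM k a
        (Metric.mem_ball_self hr) (by rw [mul_div_cancel₀ _ hk'.ne'])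
      rwa [div_div_eq_mul_div] at this
  let p : FormalMultilinearSeries ℂ E F := fun k => (k.factorial : ℂ)⁻¹ • iteratedFDeriv ℂ k f a
  -- Since `k ^ k / k! ≤ e ^ k`, the growth of the bound is absorbed by the radius `r / (2e)`.
  have hp : ∀ k, ‖p k‖ * (r / (2 * Real.exp 1)) ^ k ≤ M := by
    intro k
    have h1 : ‖p k‖ ≤ (k.factorial : ℝ)⁻¹ * (M * (2 * k / r) ^ k) := by
      change ‖(k.factorial : ℂ)⁻¹ • iteratedFDeriv ℂ k f a‖ ≤ _
      rw [norm_smul, norm_inv, Complex.norm_natCast]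
      exact mul_le_mul_of_nonneg_left (hbound k) (by positivity)
    have h2 : ((k : ℝ) ^ k) / k.factorial ≤ Real.exp k :=
      Real.pow_div_factorial_le_exp _ (by positivity) k
    have h3 : Real.exp k = Real.exp 1 ^ k := by rw [← Real.exp_nat_mul, mul_one]
    calc ‖p k‖ * (r / (2 * Real.exp 1)) ^ k
        ≤ (k.factorial : ℝ)⁻¹ * (M * (2 * k / r) ^ k) * (r / (2 * Real.exp 1)) ^ k :=
          mul_le_mul_of_nonneg_right h1 (by positivity)
      _ = M * (((k : ℝ) ^ k) / k.factorial / Real.exp 1 ^ k) := by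
          rw [div_pow, div_pow, mul_pow, mul_pow]
          field_simp
      _ ≤ M * 1 := by
          refine mul_le_mul_of_nonneg_left ?_ hM0
          rw [div_le_one (by positivity), ← h3]
          exact h2
      _ = M := mul_one M
  let ρ : NNReal := ⟨r / (2 * Real.exp 1), by positivity⟩
  have hρ : 0 < ρ := by
    change (0 : ℝ) < r / (2 * Real.exp 1)
    positivity
  have hρr : (ρ : ℝ) ≤ r := by
    change r / (2 * Real.exp 1) ≤ r
    refine div_le_self hr.le ?_
    linarith [Real.add_one_le_exp 1]
  refine HasFPowerSeriesOnBall.analyticAt (p := p) (r := ρ) ⟨p.le_radius_of_bound M hp,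
    by exact_mod_cast hρ, fun {y} hy => ?_⟩
  have hy' : ‖y‖ < r := by
    have : ‖y‖ < ρ := by simpa [Metric.mem_eball, edist_zero_right, enorm_eq_nnnorm] using hy
    linarith
  obtain ⟨R, hR1, hR2⟩ : ∃ R > 1, R * ‖y‖ < r := by
    have h1 : 0 < (r - ‖y‖) / (2 * (‖y‖ + 1)) := div_pos (by linarith) (by positivity)
    refine ⟨1 + (r - ‖y‖) / (2 * (‖y‖ + 1)), by linarith, ?_⟩
    have h2 : (r - ‖y‖) / (2 * (‖y‖ + 1)) * (2 * (‖y‖ + 1)) = r - ‖y‖ :=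
      div_mul_cancel₀ _ (by positivity)
    nlinarith
  have hmem : ∀ t ∈ Metric.ball (0 : ℂ) R, a + t • y ∈ Metric.ball a r := by
    intro t ht
    rw [Metric.mem_ball, dist_eq_norm, add_sub_cancel_left, norm_smul]
    rw [mem_ball_zero_iff] at ht
    exact (mul_le_mul_of_nonneg_right ht.le (norm_nonneg y)).trans_lt hR2
  have hline : DifferentiableOn ℂ (fun t : ℂ => f (a + t • y)) (Metric.ball 0 R) := fun t ht =>
    (DifferentiableAt.comp t ((hf _ (hmem t ht)).differentiableAt (hB.mem_nhds (hmem t ht)))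
      ((differentiableAt_id.smul_const y).const_add a)).differentiableWithinAt
  -- The one-variable Taylor series of `t ↦ f (a + t • y)` converges on a disc of radius greater
  -- than 1; its value at `t = 1` is the wanted sum.
  have hsum := Complex.hasSum_taylorSeries_on_ball hline (z := 1) (by simpa using hR1)
  have h0 : a + (0 : ℂ) • y ∈ Metric.ball a r := hmem 0 (Metric.mem_ball_self (by linarith))
  simp only [sub_zero, one_pow, one_smul] at hsum
  convert hsum using 2 with k
  rw [iteratedDeriv_comp_line hB hf a y k 0 h0]
  simp [p]

end SeveralVariables

/-! ## Square integrable holomorphic functions -/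

section MeanValue

variable {E : Type*} [NormedAddCommGroup E] [NormedSpace ℂ E] [FiniteDimensional ℂ E]

/-- The real Jacobian of a complex linear map is the squared modulus of its complex determinant. -/
theorem abs_det_restrictScalars (A : E →L[ℂ] E) :
    |(A.restrictScalars ℝ).det| = ‖A.det‖ ^ 2 := by
  have h : (A.restrictScalars ℝ).det = Algebra.norm ℝ A.det :=
    LinearMap.det_restrictScalars
  rw [h, Algebra.norm_complex_apply, Complex.normSq_eq_norm_sq, abs_of_nonneg (by positivity)]

variable [MeasurableSpace E] [BorelSpace E] (μ : Measure E) [μ.IsAddHaarMeasure]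

/-- The complex determinant of the homothety is a power of `c`, of modulus 1, and the real
determinant has its squared modulus as absolute value. -/
theorem measurePreserving_smul_of_norm_eq_one {c : ℂ} (hc : ‖c‖ = 1) :
    MeasurePreserving (fun x : E => c • x) μ μ := by
  have : FiniteDimensional ℝ E := FiniteDimensional.complexToReal E
  refine ⟨by fun_prop, ?_⟩
  let A : E →L[ℂ] E := c • ContinuousLinearMap.id ℂ E
  have hdet : ‖A.det‖ = 1 := by
    have : A.det = c ^ Module.finrank ℂ E := by
      change LinearMap.det (c • (LinearMap.id : E →ₗ[ℂ] E)) = _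
      simp
    rw [this, norm_pow, hc, one_pow]
  have h1 := abs_det_restrictScalars A
  rw [hdet, one_pow] at h1
  have h0 : LinearMap.det ((A.restrictScalars ℝ : E →L[ℝ] E) : E →ₗ[ℝ] E) ≠ 0 := by
    intro h
    change |LinearMap.det ((A.restrictScalars ℝ : E →L[ℝ] E) : E →ₗ[ℝ] E)| = 1 at h1
    rw [h] at h1
    simp at h1
  have h2 := Measure.map_linearMap_addHaar_eq_smul_addHaar μ h0
  change Measure.map (fun x : E => c • x) μ = _ at h2
  rw [h2]
  change ENNReal.ofReal |((A.restrictScalars ℝ).det)⁻¹| • μ = μ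
  rw [abs_inv, h1]
  simp

/-- Mean value inequality on a ball. -/
theorem enorm_mul_measure_ball_le {w : E → ℂ} {a : E} {r : ℝ}
    (hw : DifferentiableOn ℂ w (Metric.ball a r)) :
    ‖w a‖ₑ * μ (Metric.ball a r) ≤ ∫⁻ x in Metric.ball a r, ‖w x‖ₑ ∂μ := by
  have : FiniteDimensional ℝ E := FiniteDimensional.complexToReal E
  classical
  let W : E → ℂ := (Metric.ball a r).indicator w
  have hB : MeasurableSet (Metric.ball a r) := Metric.isOpen_ball.measurableSet
  have hWm : Measurable W := by
    have := ContinuousOn.measurable_piecewise (f := w) (g := (0 : E → ℂ)) hw.continuousOn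
      continuousOn_const hB
    rwa [Set.piecewise_eq_indicator] at this
  have hWint : ∫⁻ x in Metric.ball a r, ‖w x‖ₑ ∂μ = ∫⁻ x, ‖W x‖ₑ ∂μ := by
    rw [← lintegral_indicator hB]
    congr 1
    funext x
    by_cases hx : x ∈ Metric.ball a r <;> simp [W, hx]
  -- One-variable mean value property on the disc `t ↦ a + t • x`. Integrating over `x` and
  -- exchanging the integrals gives the claim, since for each angle the rotation preserves `μ`. The
  -- extension `W` by zero lets the inner integral run over all of `E`.
  have hcirc : ∀ x ∈ Metric.ball (0 : E) r, ‖w a‖ₑ ≤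
      ENNReal.ofReal (2 * Real.pi)⁻¹ *
        ∫⁻ θ in Ioc 0 (2 * Real.pi), ‖W (a + circleMap 0 1 θ • x)‖ₑ := by
    intro x hx
    rw [mem_ball_zero_iff] at hx
    have hmem : ∀ t ∈ Metric.closedBall (0 : ℂ) 1, a + t • x ∈ Metric.ball a r := by
      intro t ht
      rw [Metric.mem_ball, dist_eq_norm, add_sub_cancel_left, norm_smul]
      rw [mem_closedBall_zero_iff] at ht
      exact (mul_le_of_le_one_left (norm_nonneg x) ht).trans_lt hx
    have hd : ∀ t ∈ Metric.closedBall (0 : ℂ) 1,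
        DifferentiableAt ℂ (fun t : ℂ => w (a + t • x)) t := fun t ht =>
      DifferentiableAt.comp t ((hw _ (hmem t ht)).differentiableAt
        (Metric.isOpen_ball.mem_nhds (hmem t ht)))
        ((differentiableAt_id.smul_const x).const_add a)
    have h1 := circleAverage_of_differentiable_on_off_countable (f := fun t : ℂ => w (a + t • x))
      (c := 0) (R := 1) countable_empty
      (fun t ht => (hd t (by simpa using ht)).continuousAt.continuousWithinAt)
      (fun t ht => hd t (Metric.ball_subset_closedBall (by simpa using ht.1)))
    simp only [zero_smul, add_zero] at h1
    rw [← h1, Real.circleAverage_def, enorm_smul, intervalIntegral.integral_of_le (by positivity)]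
    refine mul_le_mul' ?_ ((enorm_integral_le_lintegral_enorm _).trans (lintegral_mono fun θ => ?_))
    · rw [Real.enorm_of_nonneg (by positivity)]
    · have : a + circleMap 0 1 θ • x ∈ Metric.ball a r := hmem _ (by simp)
      simp [W, this]
  have hrot : ∀ θ : ℝ, ∫⁻ x, ‖W (a + circleMap 0 1 θ • x)‖ₑ ∂μ = ∫⁻ x, ‖W x‖ₑ ∂μ := by
    intro θ
    have h1 := (measurePreserving_smul_of_norm_eq_one μ (c := circleMap 0 1 θ)
      (by simp)).lintegral_comp (f := fun x => ‖W (a + x)‖ₑ) (by fun_prop)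
    rw [h1]
    exact lintegral_add_left_eq_self (fun x => ‖W x‖ₑ) a
  have hvol : μ (Metric.ball a r) = μ (Metric.ball 0 r) := Measure.addHaar_ball_center μ a r
  calc ‖w a‖ₑ * μ (Metric.ball a r) = ∫⁻ _ in Metric.ball (0 : E) r, ‖w a‖ₑ ∂μ := by
        rw [setLIntegral_const, hvol]
    _ ≤ ∫⁻ x in Metric.ball (0 : E) r, ENNReal.ofReal (2 * Real.pi)⁻¹ *
          (∫⁻ θ in Ioc 0 (2 * Real.pi), ‖W (a + circleMap 0 1 θ • x)‖ₑ) ∂μ :=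
        setLIntegral_mono' Metric.isOpen_ball.measurableSet hcirc
    _ ≤ ∫⁻ x, ENNReal.ofReal (2 * Real.pi)⁻¹ *
          (∫⁻ θ in Ioc 0 (2 * Real.pi), ‖W (a + circleMap 0 1 θ • x)‖ₑ) ∂μ :=
        setLIntegral_le_lintegral _ _
    _ = ENNReal.ofReal (2 * Real.pi)⁻¹ *
          ∫⁻ θ in Ioc 0 (2 * Real.pi), ∫⁻ x, ‖W (a + circleMap 0 1 θ • x)‖ₑ ∂μ := by
        rw [lintegral_const_mul' _ _ ENNReal.ofReal_ne_top, lintegral_lintegral_swap]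
        refine Measurable.aemeasurable ?_
        have : Measurable fun p : E × ℝ => a + circleMap 0 1 p.2 • p.1 := by
          refine Continuous.measurable ?_
          fun_prop
        exact (hWm.comp this).enorm
    _ = ∫⁻ x, ‖W x‖ₑ ∂μ := by
        simp_rw [hrot]
        rw [setLIntegral_const, Real.volume_Ioc, sub_zero, mul_comm, mul_assoc,
          ← ENNReal.ofReal_mul (by positivity), mul_inv_cancel₀ (by positivity), ENNReal.ofReal_one,
          mul_one]
    _ = _ := hWint.symm

/-- The mean value inequality for the holomorphic function `w ^ 2`. -/
theorem enorm_sq_mul_measure_ball_le {w : E → ℂ} {a : E} {r : ℝ}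
    (hw : DifferentiableOn ℂ w (Metric.ball a r)) :
    ‖w a‖ₑ ^ 2 * μ (Metric.ball a r) ≤ ∫⁻ x in Metric.ball a r, ‖w x‖ₑ ^ 2 ∂μ := by
  simpa [enorm_pow] using enorm_mul_measure_ball_le μ (hw.pow 2)

end MeanValue

/-- An isolated singularity of a square integrable holomorphic function is removable. -/
theorem isLittleO_sub_inv_of_lintegral_lt_top {u : ℂ → ℂ} {c : ℂ} {ρ : ℝ} (hρ : 0 < ρ)
    (hu : DifferentiableOn ℂ u (Metric.ball c ρ \ {c}))
    (hI : ∫⁻ z in Metric.ball c ρ \ {c}, ‖u z‖ₑ ^ 2 ≠ ∞) :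
    (fun z => u z - u c) =o[𝓝[≠] c] fun z => (z - c)⁻¹ := by
  -- Absolute continuity of the integral: the mass of `|u|²` near `c` tends to 0 with the area.
  have hsmall : Tendsto (fun δ : ℝ => ∫⁻ z in Metric.ball c δ,
      ‖u z‖ₑ ^ 2 ∂(volume.restrict (Metric.ball c ρ \ {c}))) (𝓝[>] 0) (𝓝 0) := by
    refine tendsto_setLIntegral_zero hI ?_
    have h1 : Tendsto (fun δ : ℝ => ENNReal.ofReal δ ^ 2 * NNReal.pi) (𝓝[>] 0) (𝓝 0) := by
      have : Tendsto (fun δ : ℝ => ENNReal.ofReal δ ^ 2 * NNReal.pi) (𝓝 0)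
          (𝓝 (ENNReal.ofReal 0 ^ 2 * NNReal.pi)) := by
        refine ENNReal.Tendsto.mul_const ?_ (Or.inr ENNReal.coe_ne_top)
        exact ((ENNReal.continuous_pow 2).comp ENNReal.continuous_ofReal).tendsto 0
      simp only [ENNReal.ofReal_zero, ne_eq, OfNat.ofNat_ne_zero, not_false_eq_true, zero_pow,
        zero_mul] at this
      exact this.mono_left nhdsWithin_le_nhds
    refine tendsto_of_tendsto_of_tendsto_of_le_of_le tendsto_const_nhds h1 (fun _ => zero_le)
      fun δ => ?_
    refine (Measure.restrict_apply_le _ _).trans ?_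
    rw [Complex.volume_ball]
  rw [Asymptotics.isLittleO_iff]
  have key : Tendsto (fun z => ‖u z * (z - c)‖) (𝓝[≠] c) (𝓝 0) := by
    rw [Metric.tendsto_nhds]
    intro ε hε
    have h1 : ∀ᶠ δ : ℝ in 𝓝[>] 0, ∫⁻ z in Metric.ball c δ,
      ‖u z‖ₑ ^ 2 ∂(volume.restrict (Metric.ball c ρ \ {c})) < ENNReal.ofReal ε ^ 2 :=
      hsmall.eventually_lt_const (ENNReal.pow_pos (ENNReal.ofReal_pos.2 hε) 2)
    have h2 : Tendsto (fun z : ℂ => 2 * ‖z - c‖) (𝓝[≠] c) (𝓝[>] 0) := by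
      refine tendsto_nhdsWithin_iff.2 ⟨?_, ?_⟩
      · have : Continuous fun z : ℂ => 2 * ‖z - c‖ := by fun_prop
        have := this.tendsto c
        simp only [sub_self, norm_zero, mul_zero] at this
        exact this.mono_left nhdsWithin_le_nhds
      · filter_upwards [self_mem_nhdsWithin] with z hz
        have : 0 < ‖z - c‖ := norm_pos_iff.2 (sub_ne_zero.2 hz)
        simpa using this
    have h3 : ∀ᶠ z in 𝓝[≠] c, 2 * ‖z - c‖ < ρ :=
      (h2.mono_right nhdsWithin_le_nhds).eventually_lt_const hρ
    filter_upwards [h2.eventually h1, h3, self_mem_nhdsWithin] with z hz hzρ hzc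
    have hpos : 0 < ‖z - c‖ := norm_pos_iff.2 (sub_ne_zero.2 hzc)
    -- The largest ball about `z` that avoids `c`. The mean value inequality on it bounds `π |z -
    -- c|² |u z|²` by the small mass near `c`; the factor `π ≥ 1` is then dropped.
    have hsub : Metric.ball z ‖z - c‖ ⊆ Metric.ball c (2 * ‖z - c‖) := by
      refine Metric.ball_subset_ball' ?_
      rw [dist_eq_norm]
      linarith
    have hsub2 : Metric.ball z ‖z - c‖ ⊆ Metric.ball c ρ \ {c} := by
      refine fun y hy => ⟨Metric.ball_subset_ball hzρ.le (hsub hy), ?_⟩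
      rintro rfl
      rw [Metric.mem_ball, dist_eq_norm, norm_sub_rev] at hy
      exact lt_irrefl _ hy
    have h4 := enorm_sq_mul_measure_ball_le volume (hu.mono hsub2)
    have h5 : ∫⁻ x in Metric.ball z ‖z - c‖, ‖u x‖ₑ ^ 2 < ENNReal.ofReal ε ^ 2 := by
      refine lt_of_le_of_lt ?_ hz
      rw [Measure.restrict_restrict Metric.isOpen_ball.measurableSet]
      exact lintegral_mono_set fun y hy => ⟨hsub hy, hsub2 hy⟩
    rw [Complex.volume_ball] at h4
    have h6 : ‖u z * (z - c)‖ₑ ^ 2 < ENNReal.ofReal ε ^ 2 := by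
      refine lt_of_le_of_lt ?_ (h4.trans_lt h5)
      rw [enorm_mul, mul_pow, ofReal_norm]
      refine mul_le_mul' le_rfl ?_
      refine le_mul_of_one_le_right zero_le ?_
      have : (1 : ℝ) ≤ Real.pi := by linarith [Real.pi_gt_three]
      exact_mod_cast this
    have h7 : ‖u z * (z - c)‖ₑ < ENNReal.ofReal ε := lt_of_pow_lt_pow_left' 2 h6
    rw [← ofReal_norm, ENNReal.ofReal_lt_ofReal_iff hε] at h7
    rw [Real.dist_eq, sub_zero, abs_of_nonneg (norm_nonneg _)]
    exact h7
  -- The value `u c` is arbitrary, but a constant is also negligible against `1 / (z - c)`.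
  have key2 : Tendsto (fun z => ‖u z * (z - c)‖ + ‖u c‖ * ‖z - c‖) (𝓝[≠] c) (𝓝 0) := by
    have h1 : Continuous fun z : ℂ => ‖u c‖ * ‖z - c‖ := by fun_prop
    have h2 := (h1.tendsto c).mono_left (nhdsWithin_le_nhds (s := {c}ᶜ))
    simpa using key.add h2
  intro ε hε
  filter_upwards [key2.eventually_lt_const hε, self_mem_nhdsWithin] with z hz hzc
  have hpos : 0 < ‖z - c‖ := norm_pos_iff.2 (sub_ne_zero.2 hzc)
  rw [norm_inv, ← div_eq_mul_inv, le_div_iff₀ hpos]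
  rw [norm_mul] at hz
  nlinarith [norm_sub_le (u z) (u c)]

/-! ## Zero sets of holomorphic functions and removable singularities along them -/

section ZeroSets

variable {E : Type*} [NormedAddCommGroup E] [NormedSpace ℂ E]

/-- Near a point at which it does not vanish identically, a holomorphic function is not zero on the
boundaries of small parallel discs. -/
theorem exists_disc_direction {g : E → ℂ} {a : E} {W : Set E} (hW : IsOpen W) (ha : a ∈ W)
    (hg : AnalyticOnNhd ℂ g W) (hg0 : ¬ ∀ᶠ x in 𝓝 a, g x = 0) :
    ∃ v : E, ∃ r > 0, ∃ δ > 0,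
      (∀ z ∈ Metric.ball a δ, ∀ t ∈ Metric.closedBall (0 : ℂ) r, z + t • v ∈ W) ∧
      (∀ z ∈ Metric.ball a δ, ∀ t ∈ Metric.sphere (0 : ℂ) r, g (z + t • v) ≠ 0) := by
  obtain ⟨ε, hε, hεW⟩ := Metric.isOpen_iff.1 hW a ha
  obtain ⟨b, hb, hgb⟩ : ∃ b ∈ Metric.ball a ε, g b ≠ 0 := by
    by_contra! H
    exact hg0 (by filter_upwards [Metric.ball_mem_nhds a hε] with x hx using H x hx)
  -- On the complex line through `a` and `b` the function does not vanish identically, so `a` is at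
  -- most an isolated zero on it. A small circle around `a` in this line avoids the zeros, and by
  -- compactness so do its small parallel translates.
  let v := b - a
  have hline : Continuous fun t : ℂ => a + t • v := by fun_prop
  have hline' : AnalyticOnNhd ℂ (fun t : ℂ => a + t • v) univ := fun t _ => by fun_prop
  let D : Set ℂ := (fun t : ℂ => a + t • v) ⁻¹' Metric.ball a ε
  have hDo : IsOpen D := Metric.isOpen_ball.preimage hline
  have hDc : IsPreconnected D := by
    have : Convex ℝ D := by
      intro s hs t ht α β hα hβ hαβ
      have h1 := convex_ball a ε hs ht hα hβ hαβ
      change a + (α • s + β • t) • v ∈ Metric.ball a ε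
      convert h1 using 1
      have : a = (α + β) • a := by rw [hαβ, one_smul]
      nth_rw 1 [this]
      simp only [smul_add, add_smul, smul_assoc]
      abel
    exact this.isPreconnected
  have h0D : (0 : ℂ) ∈ D := by
    change a + (0 : ℂ) • v ∈ Metric.ball a ε
    simpa using hε
  have h1D : (1 : ℂ) ∈ D := by
    change a + (1 : ℂ) • v ∈ Metric.ball a ε
    simpa [v] using hb
  have hG : AnalyticOnNhd ℂ (fun t : ℂ => g (a + t • v)) D := fun t ht =>
    AnalyticAt.comp (f := fun t : ℂ => a + t • v) (hg _ (hεW ht)) (hline' t (mem_univ _))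
  have hne : ∀ᶠ t in 𝓝[≠] (0 : ℂ), g (a + t • v) ≠ 0 := by
    by_contra H
    have h2 := hG.eqOn_zero_of_preconnected_of_frequently_eq_zero hDc h0D
      (by simpa [Filter.not_eventually] using H)
    have h3 := h2 h1D
    simp only [one_smul, v, add_sub_cancel, Pi.zero_apply] at h3
    exact hgb h3
  rw [eventually_nhdsWithin_iff] at hne
  have hW' : ∀ᶠ t in 𝓝 (0 : ℂ), a + t • v ∈ W :=
    hline.continuousAt.eventually_mem (hW.mem_nhds (by simpa using ha))
  obtain ⟨r₁, hr₁, hr₁'⟩ := Metric.eventually_nhds_iff_ball.1 (hne.and hW')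
  have hr : 0 < r₁ / 2 := by positivity
  have hsub : Metric.closedBall (0 : ℂ) (r₁ / 2) ⊆ Metric.ball 0 r₁ :=
    Metric.closedBall_subset_ball (by linarith)
  have hcont : Continuous fun p : E × ℂ => p.1 + p.2 • v := by fun_prop
  have e1 : ∀ᶠ z in 𝓝 a, ∀ t ∈ Metric.closedBall (0 : ℂ) (r₁ / 2), z + t • v ∈ W := by
    refine (isCompact_closedBall _ _).eventually_forall_of_forall_eventually fun t ht => ?_
    exact hcont.continuousAt.eventually_mem (hW.mem_nhds (hr₁' t (hsub ht)).2)
  have e2 : ∀ᶠ z in 𝓝 a, ∀ t ∈ Metric.sphere (0 : ℂ) (r₁ / 2), g (z + t • v) ≠ 0 := by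
    refine (isCompact_sphere _ _).eventually_forall_of_forall_eventually fun t ht => ?_
    have ht' := hr₁' t (hsub (Metric.sphere_subset_closedBall ht))
    have hgc : ContinuousAt g (a + t • v) := (hg _ ht'.2).continuousAt
    have : ContinuousAt (fun p : E × ℂ => g (p.1 + p.2 • v)) (a, t) :=
      ContinuousAt.comp (f := fun p : E × ℂ => p.1 + p.2 • v) hgc hcont.continuousAt
    exact this.eventually_ne (ht'.1 (Metric.ne_of_mem_sphere ht hr.ne'))
  obtain ⟨δ, hδ, hδ'⟩ := Metric.eventually_nhds_iff_ball.1 (e1.and e2)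
  exact ⟨v, r₁ / 2, hr, δ, hδ, fun z hz => (hδ' z hz).1, fun z hz => (hδ' z hz).2⟩

/-- A holomorphic function that has no zeros on the boundary of a disc has isolated zeros. -/
theorem eventually_ne_zero_of_forall_sphere {G : ℂ → ℂ} {r : ℝ} (hr : 0 < r)
    (hG : AnalyticOnNhd ℂ G (Metric.closedBall 0 r)) (h0 : ∀ t ∈ Metric.sphere (0 : ℂ) r, G t ≠ 0)
    {t : ℂ} (ht : t ∈ Metric.closedBall (0 : ℂ) r) : ∀ᶠ s in 𝓝[≠] t, G s ≠ 0 := by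
  by_contra H
  have h2 := hG.eqOn_zero_of_preconnected_of_frequently_eq_zero
    (convex_closedBall (0 : ℂ) r).isPreconnected ht (by simpa [Filter.not_eventually] using H)
  have hr' : (r : ℂ) ∈ Metric.sphere (0 : ℂ) r := by simp [hr.le]
  exact h0 _ hr' (h2 (Metric.sphere_subset_closedBall hr'))

theorem analyticOnNhd_comp_line {F : Type*} [NormedAddCommGroup F] [NormedSpace ℂ F] {g : E → F}
    {W : Set E} (hg : AnalyticOnNhd ℂ g W) (z v : E) {S : Set ℂ} (hS : ∀ t ∈ S, z + t • v ∈ W) :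
    AnalyticOnNhd ℂ (fun t : ℂ => g (z + t • v)) S := fun t ht =>
  AnalyticAt.comp (f := fun t : ℂ => z + t • v) (hg _ (hS t ht)) (by fun_prop)

/-- The averages of a holomorphic function over parallel circles depend holomorphically on the
centre. -/
theorem differentiableAt_circleAverage_line [FiniteDimensional ℂ E] {h : E → ℂ} {O : Set E} (hO : IsOpen O)
    (hh : DifferentiableOn ℂ h O) {z₀ v : E} {r : ℝ} (hr : 0 ≤ r)
    (hz₀ : ∀ t ∈ Metric.sphere (0 : ℂ) r, z₀ + t • v ∈ O) :
    DifferentiableAt ℂ (fun z => Real.circleAverage (fun t => h (z + t • v)) 0 r) z₀ := by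
  have : ProperSpace E := FiniteDimensional.proper ℂ E
  have hcont : Continuous fun p : E × ℂ => p.1 + p.2 • v := by fun_prop
  have hfd : ContinuousOn (fderiv ℂ h) O :=
    (contDiffOn_nat_of_differentiableOn hO 1 h hh).continuousOn_fderiv_of_isOpen hO (by simp)
  have e1 : ∀ᶠ z in 𝓝 z₀, ∀ t ∈ Metric.sphere (0 : ℂ) r, z + t • v ∈ O := by
    refine (isCompact_sphere _ _).eventually_forall_of_forall_eventually fun t ht => ?_
    exact hcont.continuousAt.eventually_mem (hO.mem_nhds (hz₀ t ht))
  obtain ⟨ε, hε, hεO⟩ := Metric.eventually_nhds_iff_ball.1 e1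
  have hsub : Metric.closedBall z₀ (ε / 2) ⊆ Metric.ball z₀ ε :=
    Metric.closedBall_subset_ball (by linarith)
  have hsph : ∀ θ : ℝ, circleMap 0 r θ ∈ Metric.sphere (0 : ℂ) r := fun θ =>
    circleMap_mem_sphere _ hr θ
  obtain ⟨C, hC⟩ := ((isCompact_closedBall z₀ (ε / 2)).prod
    (isCompact_sphere (0 : ℂ) r)).exists_bound_of_continuousOn
    (f := fun p : E × ℂ => fderiv ℂ h (p.1 + p.2 • v))
    (hfd.comp hcont.continuousOn fun p hp => hεO p.1 (hsub hp.1) p.2 hp.2)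
  have hcz : ∀ z ∈ Metric.ball z₀ ε, Continuous fun θ : ℝ => h (z + circleMap 0 r θ • v) :=
    fun z hz => hh.continuousOn.comp_continuous (by fun_prop) fun θ => hεO z hz _ (hsph θ)
  have key := intervalIntegral.hasFDerivAt_integral_of_dominated_of_fderiv_le (𝕜 := ℂ)
    (μ := volume) (a := 0) (b := 2 * Real.pi) (bound := fun _ => C)
    (F := fun z θ => h (z + circleMap 0 r θ • v))
    (F' := fun z θ => fderiv ℂ h (z + circleMap 0 r θ • v))
    (Metric.closedBall_mem_nhds z₀ (by positivity : 0 < ε / 2))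
    (by
      filter_upwards [Metric.ball_mem_nhds z₀ hε] with z hz
      exact (hcz z hz).aestronglyMeasurable)
    ((hcz z₀ (Metric.mem_ball_self hε)).intervalIntegrable _ _)
    (Continuous.aestronglyMeasurable (hfd.comp_continuous (by fun_prop) fun θ =>
      hεO z₀ (Metric.mem_ball_self hε) _ (hsph θ)))
    (Eventually.of_forall fun θ _ z hz => hC (z, circleMap 0 r θ) ⟨hz, hsph θ⟩)
    intervalIntegrable_const
    (Eventually.of_forall fun θ _ z hz => by
      have hm := hεO z (hsub hz) _ (hsph θ)
      exact (hasFDerivAt_comp_add_right _).2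
        ((hh _ hm).differentiableAt (hO.mem_nhds hm)).hasFDerivAt)
  simp_rw [Real.circleAverage_def]
  exact key.differentiableAt.const_smul _

/-- A square integrable holomorphic function on a disc minus the zeros of a holomorphic function
has the mean value property. -/
theorem circleAverage_eq_of_lintegral_lt_top {G u : ℂ → ℂ} {r : ℝ} (hr : 0 < r) {D : Set ℂ}
    (hD : IsOpen D) (hrD : Metric.closedBall 0 r ⊆ D) (hG : AnalyticOnNhd ℂ G D)
    (h0 : ∀ t ∈ Metric.sphere (0 : ℂ) r, G t ≠ 0)
    (hu : DifferentiableOn ℂ u {t ∈ D | G t ≠ 0}) (hG0 : G 0 ≠ 0)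
    (hI : ∫⁻ t in Metric.ball 0 r ∩ {t | G t ≠ 0}, ‖u t‖ₑ ^ 2 ≠ ∞) :
    Real.circleAverage u 0 r = u 0 := by
  classical
  have hO : IsOpen {t ∈ D | G t ≠ 0} :=
    hG.continuousOn.isOpen_inter_preimage hD isOpen_compl_singleton
  -- `u` with its isolated singularities, the zeros of `G`, filled in by limits. On the circle and
  -- at the centre `G` does not vanish, so `w` agrees with `u` there.
  let w : ℂ → ℂ := fun t => if G t = 0 then limUnder (𝓝[≠] t) u else u t
  have hw : ∀ t ∈ Metric.closedBall (0 : ℂ) r, DifferentiableAt ℂ w t := by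
    intro t ht
    by_cases hGt : G t = 0
    · have hiso := eventually_ne_zero_of_forall_sphere hr (hG.mono hrD) h0 ht
      have htb : t ∈ Metric.ball (0 : ℂ) r := by
        rcases (Metric.mem_closedBall.1 ht).lt_or_eq with h | h
        · exact h
        · exact absurd hGt (h0 t h)
      rw [eventually_nhdsWithin_iff] at hiso
      obtain ⟨ρ, hρ, hρ'⟩ := Metric.eventually_nhds_iff_ball.1
        (hiso.and (Metric.isOpen_ball.mem_nhds htb))
      have hsub : Metric.ball t ρ \ {t} ⊆ Metric.ball 0 r ∩ {t | G t ≠ 0} := fun s hs =>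
        ⟨(hρ' s hs.1).2, (hρ' s hs.1).1 hs.2⟩
      have hud : DifferentiableOn ℂ u (Metric.ball t ρ \ {t}) := hu.mono fun s hs =>
        ⟨hrD (Metric.ball_subset_closedBall (hsub hs).1), (hsub hs).2⟩
      have hlo := isLittleO_sub_inv_of_lintegral_lt_top hρ hud
        (ne_top_of_le_ne_top hI (lintegral_mono_set hsub))
      have hupd := Complex.differentiableOn_update_limUnder_of_isLittleO
        (Metric.ball_mem_nhds t hρ) hud hlo
      have hEq : w =ᶠ[𝓝 t] Function.update u t (limUnder (𝓝[≠] t) u) := by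
        filter_upwards [Metric.ball_mem_nhds t hρ] with s hs
        by_cases hst : s = t
        · subst hst
          simp [w, hGt]
        · simp [w, hst, (hρ' s hs).1 hst]
      exact (hupd.differentiableAt (Metric.ball_mem_nhds t hρ)).congr_of_eventuallyEq hEq
    · have hmem : t ∈ {t ∈ D | G t ≠ 0} := ⟨hrD ht, hGt⟩
      have hEq : w =ᶠ[𝓝 t] u := by
        filter_upwards [hO.mem_nhds hmem] with s hs
        simp [w, hs.2]
      exact (hu.differentiableAt (hO.mem_nhds hmem)).congr_of_eventuallyEq hEq
  have h1 := circleAverage_of_differentiable_on_off_countable (f := w) (c := 0) (R := r)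
    countable_empty
    (fun t ht => (hw t (by rwa [abs_of_pos hr] at ht)).continuousAt.continuousWithinAt)
    (fun t ht => hw t (Metric.ball_subset_closedBall (by simpa [abs_of_pos hr] using ht.1)))
  have h2 : Real.circleAverage u 0 r = Real.circleAverage w 0 r := by
    refine Real.circleAverage_congr_sphere fun t ht => ?_
    rw [abs_of_pos hr] at ht
    simp [w, h0 t ht]
  rw [h2, h1]
  simp [w, hG0]

variable [FiniteDimensional ℂ E] [MeasurableSpace E] [BorelSpace E] (μ : Measure E)
  [μ.IsAddHaarMeasure]

/-- The zero set of a holomorphic function is a null set near every point at which the function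
does not vanish identically. -/
theorem exists_ball_measure_zeros_eq_zero {g : E → ℂ} {a : E} {W : Set E} (hW : IsOpen W)
    (ha : a ∈ W) (hg : AnalyticOnNhd ℂ g W) (hg0 : ¬ ∀ᶠ x in 𝓝 a, g x = 0) :
    ∃ ε > 0, μ (Metric.ball a ε ∩ {x ∈ W | g x = 0}) = 0 := by
  have : ProperSpace E := FiniteDimensional.proper ℂ E
  obtain ⟨v, r, hr, δ, hδ, h1, h2⟩ := exists_disc_direction hW ha hg hg0
  have hZm : MeasurableSet {x ∈ W | g x = 0} := by
    have hO : IsOpen (W ∩ g ⁻¹' {0}ᶜ) :=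
      hg.continuousOn.isOpen_inter_preimage hW isOpen_compl_singleton
    have : {x ∈ W | g x = 0} = W \ (W ∩ g ⁻¹' {0}ᶜ) := by
      ext x
      exact ⟨fun hx => ⟨hx.1, fun H => H.2 hx.2⟩,
        fun hx => ⟨hx.1, by_contra fun H => hx.2 ⟨hx.1, H⟩⟩⟩
    rw [this]
    exact hW.measurableSet.diff hO.measurableSet
  have hadd : Measurable fun p : E × ℂ => p.1 + p.2 • v :=
    (by fun_prop : Continuous fun p : E × ℂ => p.1 + p.2 • v).measurable
  -- Fubini for the pairs `(z, t)` with `z + t • v` a zero. For fixed `z` the admissible `t` form a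
  -- discrete, hence null, set; so for almost every `t` the zero set translated by `-t • v` is null
  -- in the ball.
  let S : Set (E × ℂ) := (Metric.ball a δ ×ˢ Metric.ball 0 r) ∩
    (fun p : E × ℂ => p.1 + p.2 • v) ⁻¹' {x ∈ W | g x = 0}
  have hS : MeasurableSet S :=
    (Metric.isOpen_ball.measurableSet.prod Metric.isOpen_ball.measurableSet).inter (hadd hZm)
  have hS0 : (μ.prod volume) S = 0 := by
    rw [Measure.measure_prod_null hS]
    refine Eventually.of_forall fun z => ?_
    change volume (Prod.mk z ⁻¹' S) = 0
    by_cases hz : z ∈ Metric.ball a δ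
    swap
    · have : Prod.mk z ⁻¹' S = ∅ := by
        ext t
        simp [S, hz]
      simp [this]
    have hG := analyticOnNhd_comp_line hg z v (h1 z hz)
    have hcod : {t : ℂ | g (z + t • v) ≠ 0} ∈ codiscreteWithin (Metric.ball (0 : ℂ) r) := by
      rw [mem_codiscreteWithin_iff_forall_mem_nhdsNE]
      intro t ht
      filter_upwards [eventually_ne_zero_of_forall_sphere hr hG (h2 z hz)
        (Metric.ball_subset_closedBall ht)] with s hs using Or.inl hs
    have hae := ae_restrict_le_codiscreteWithin (μ := (volume : Measure ℂ))
      Metric.isOpen_ball.measurableSet hcod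
    rw [mem_ae_iff, Measure.restrict_apply' Metric.isOpen_ball.measurableSet] at hae
    refine measure_mono_null ?_ hae
    rintro t ⟨⟨_, ht⟩, -, ht0⟩
    exact ⟨fun H => H ht0, ht⟩
  rw [Measure.prod_apply_symm hS, lintegral_eq_zero_iff (measurable_measure_prodMk_right hS)] at hS0
  obtain ⟨ρ, hρ, hρr, hρδ⟩ : ∃ ρ > 0, ρ ≤ r ∧ ρ * ‖v‖ < δ / 2 := by
    refine ⟨min r (δ / (4 * (‖v‖ + 1))), by positivity, min_le_left _ _, ?_⟩
    refine (mul_le_mul_of_nonneg_right (min_le_right _ _) (norm_nonneg v)).trans_lt ?_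
    rw [div_mul_eq_mul_div, div_lt_div_iff₀ (by positivity) (by positivity)]
    nlinarith [norm_nonneg v]
  -- A good `t` exists arbitrarily near 0; it is taken so small that translation by `t • v` moves
  -- the ball of radius `δ / 2` inside the ball of radius `δ`.
  obtain ⟨t, htρ, ht0⟩ : ∃ t ∈ Metric.ball (0 : ℂ) ρ, μ ((fun x => (x, t)) ⁻¹' S) = 0 := by
    by_contra! H
    have : volume (Metric.ball (0 : ℂ) ρ) = 0 := by
      refine measure_mono_null (fun t ht => ?_) (mem_ae_iff.1 hS0)
      exact H t ht
    exact (Metric.measure_ball_pos volume (0 : ℂ) hρ).ne' this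
  rw [mem_ball_zero_iff] at htρ
  refine ⟨δ / 2, by positivity, ?_⟩
  rw [← measure_preimage_add_right μ (t • v)]
  refine measure_mono_null ?_ ht0
  rintro x ⟨hx, hxZ⟩
  refine ⟨⟨?_, by simpa using htρ.trans_le hρr⟩, hxZ⟩
  change x ∈ Metric.ball a δ
  rw [Metric.mem_ball, dist_eq_norm] at hx ⊢
  have h3 : ‖t • v‖ ≤ ρ * ‖v‖ := by
    rw [norm_smul]
    exact mul_le_mul_of_nonneg_right htρ.le (norm_nonneg v)
  have h4 : x - a = (x + t • v - a) - t • v := by abel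
  rw [h4]
  linarith [norm_sub_le (x + t • v - a) (t • v)]

/-- A square integrable holomorphic function extends holomorphically over the zeros of a
holomorphic function that does not vanish identically. -/
theorem exists_analyticAt_extension_of_lintegral_lt_top {g h : E → ℂ} {a : E} {W : Set E}
    (hW : IsOpen W) (ha : a ∈ W) (hg : AnalyticOnNhd ℂ g W) (hg0 : ¬ ∀ᶠ x in 𝓝 a, g x = 0)
    (hh : DifferentiableOn ℂ h {x ∈ W | g x ≠ 0})
    (hI : ∫⁻ x in {x ∈ W | g x ≠ 0}, ‖h x‖ₑ ^ 2 ∂μ ≠ ∞) :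
    ∃ F : E → ℂ, AnalyticAt ℂ F a ∧ ∀ᶠ x in 𝓝 a, g x ≠ 0 → h x = F x := by
  classical
  have : ProperSpace E := FiniteDimensional.proper ℂ E
  obtain ⟨v, r, hr, δ, hδ, h1, h2⟩ := exists_disc_direction hW ha hg hg0
  have hO : IsOpen {x ∈ W | g x ≠ 0} :=
    hg.continuousOn.isOpen_inter_preimage hW isOpen_compl_singleton
  -- The circles of integration avoid the zeros of `g`, so `F` is defined and holomorphic on a full
  -- neighbourhood of `a`.
  let F : E → ℂ := fun z => Real.circleAverage (fun t => h (z + t • v)) 0 r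
  have hF : DifferentiableOn ℂ F (Metric.ball a δ) := fun z hz =>
    (differentiableAt_circleAverage_line hO hh hr.le fun t ht =>
      ⟨h1 z hz t (Metric.sphere_subset_closedBall ht), h2 z hz t ht⟩).differentiableWithinAt
  refine ⟨F, analyticAt_of_differentiableOn Metric.isOpen_ball hF (Metric.mem_ball_self hδ), ?_⟩
  let H : E → ℂ := {x ∈ W | g x ≠ 0}.indicator h
  have hHm : Measurable H := by
    have := ContinuousOn.measurable_piecewise (f := h) (g := (0 : E → ℂ)) hh.continuousOn
      continuousOn_const hO.measurableSet
    rwa [Set.piecewise_eq_indicator] at this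
  have hHint : ∫⁻ x, ‖H x‖ₑ ^ 2 ∂μ ≠ ∞ := by
    convert hI using 1
    rw [← lintegral_indicator hO.measurableSet]
    congr 1
    funext x
    by_cases hx : x ∈ {x ∈ W | g x ≠ 0} <;> simp only [H, hx, indicator_of_mem,
      indicator_of_notMem, not_false_eq_true]; simp
  have hHv : Measurable fun p : E × ℂ => ‖H (p.1 + p.2 • v)‖ₑ ^ 2 := by
    have hadd : Measurable fun p : E × ℂ => p.1 + p.2 • v :=
      (by fun_prop : Continuous fun p : E × ℂ => p.1 + p.2 • v).measurable
    exact ((hHm.comp hadd).enorm).pow_const 2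
  -- Fubini and translation invariance: almost every parallel disc carries a square integrable
  -- restriction of `h`. There the one-variable mean value property gives `h z = F z`, and
  -- continuity removes the exceptional null set.
  have hslice : ∀ᵐ z ∂μ, ∫⁻ t in Metric.ball (0 : ℂ) r, ‖H (z + t • v)‖ₑ ^ 2 < ∞ := by
    refine ae_lt_top (Measurable.lintegral_prod_right' hHv) ?_
    rw [lintegral_lintegral_swap hHv.aemeasurable]
    have : ∀ t : ℂ, ∫⁻ z, ‖H (z + t • v)‖ₑ ^ 2 ∂μ = ∫⁻ x, ‖H x‖ₑ ^ 2 ∂μ := fun t =>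
      lintegral_add_right_eq_self (fun x => ‖H x‖ₑ ^ 2) (t • v)
    simp_rw [this]
    rw [setLIntegral_const]
    exact ENNReal.mul_ne_top hHint measure_ball_lt_top.ne
  have hU : IsOpen (Metric.ball a δ ∩ {x ∈ W | g x ≠ 0}) := Metric.isOpen_ball.inter hO
  have hEq : EqOn h F (Metric.ball a δ ∩ {x ∈ W | g x ≠ 0}) := by
    refine Measure.eqOn_open_of_ae_eq (μ := μ) ?_ hU
      (hh.continuousOn.mono inter_subset_right) (hF.continuousOn.mono inter_subset_left)
    filter_upwards [ae_restrict_of_ae hslice, ae_restrict_mem hU.measurableSet] with z hz hzU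
    have hline : Continuous fun t : ℂ => z + t • v := by fun_prop
    have hmv := circleAverage_eq_of_lintegral_lt_top (G := fun t => g (z + t • v))
      (u := fun t => h (z + t • v)) hr (hW.preimage hline) (h1 z hzU.1)
      (analyticOnNhd_comp_line hg z v fun t ht => ht) (h2 z hzU.1)
      (fun t ht => (DifferentiableAt.comp (f := fun t : ℂ => z + t • v) t
        (hh.differentiableAt (hO.mem_nhds ⟨ht.1, ht.2⟩))
        ((differentiableAt_id.smul_const v).const_add z)).differentiableWithinAt)
      (by simpa using hzU.2.2)
      (by
        refine ne_top_of_le_ne_top hz.ne ?_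
        refine le_trans (le_of_eq ?_) (lintegral_mono_set
          (inter_subset_left (t := {t : ℂ | g (z + t • v) ≠ 0})))
        refine setLIntegral_congr_fun_ae ?_ ?_
        · have hop : IsOpen (Metric.ball (0 : ℂ) r ∩
              (fun t : ℂ => z + t • v) ⁻¹' {x ∈ W | g x ≠ 0}) :=
            Metric.isOpen_ball.inter (hO.preimage hline)
          have hset : Metric.ball (0 : ℂ) r ∩ {t : ℂ | g (z + t • v) ≠ 0} = Metric.ball (0 : ℂ) r ∩
              (fun t : ℂ => z + t • v) ⁻¹' {x ∈ W | g x ≠ 0} := Set.ext fun t =>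
            ⟨fun ht => ⟨ht.1, h1 z hzU.1 t (Metric.ball_subset_closedBall ht.1), ht.2⟩,
              fun ht => ⟨ht.1, ht.2.2⟩⟩
          rw [hset]
          exact hop.measurableSet
        · refine Eventually.of_forall fun t ht => ?_
          have : z + t • v ∈ {x ∈ W | g x ≠ 0} :=
            ⟨h1 z hzU.1 t (Metric.ball_subset_closedBall ht.1), ht.2⟩
          simp only [H, indicator_of_mem this])
    simp only [zero_smul, add_zero] at hmv
    exact hmv.symm
  filter_upwards [Metric.ball_mem_nhds a hδ, hW.mem_nhds ha] with x hx hxW hgx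
  exact hEq ⟨hx, hxW, hgx⟩

end ZeroSets

/-! ## Holomorphic maps in coordinates -/

section Maps

variable {M : Type*} [TopologicalSpace M] [ReducedComplexSpace M]
  {M' : Type*} [TopologicalSpace M'] [ReducedComplexSpace M']
  {M'' : Type*} [TopologicalSpace M''] [ReducedComplexSpace M''] {n : ℕ}

/-- `IsHolAt` is an abstract predicate on functions; it is the local model that makes it depend on
the germ only. -/
theorem isHolAt_congr {h h' : M → ℂ} {x : M} (hh : h =ᶠ[𝓝 x] h') : IsHolAt h x ↔ IsHolAt h' x := by
  obtain ⟨U, N, Φ, Ω, k, g, hU, hx, -, -, -, -, hiff⟩ := ReducedComplexSpace.local_model x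
  rw [hiff x hx h, hiff x hx h']
  exact ⟨fun ⟨G, hG, hE⟩ => ⟨G, hG, hh.symm.trans hE⟩, fun ⟨G, hG, hE⟩ => ⟨G, hG, hh.trans hE⟩⟩

namespace HolCoord

theorem inv_apply (ζ : HolCoord M n) {x : M} (hx : x ∈ ζ.source) : ζ.inv (ζ x) = x :=
  ζ.left_inv hx

theorem apply_inv (ζ : HolCoord M n) {p : Fin n → ℂ} (hp : p ∈ ζ.target) : ζ (ζ.inv p) = p :=
  ζ.right_inv hp

theorem apply_mem (ζ : HolCoord M n) {x : M} (hx : x ∈ ζ.source) : ζ x ∈ ζ.target :=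
  ζ.map_source hx

theorem inv_mem (ζ : HolCoord M n) {p : Fin n → ℂ} (hp : p ∈ ζ.target) : ζ.inv p ∈ ζ.source :=
  ζ.map_target hp

theorem continuousAt_inv (ζ : HolCoord M n) {x : M} (hx : x ∈ ζ.source) :
    ContinuousAt ζ.inv (ζ x) :=
  ζ.toOpenPartialHomeomorph.symm.continuousAt (ζ.apply_mem hx)

theorem continuousAt_apply (ζ : HolCoord M n) {x : M} (hx : x ∈ ζ.source) : ContinuousAt ζ x :=
  ζ.toOpenPartialHomeomorph.continuousAt hx

theorem tendsto_inv (ζ : HolCoord M n) {x : M} (hx : x ∈ ζ.source) :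
    Tendsto ζ.inv (𝓝 (ζ x)) (𝓝 x) := by
  have := ζ.continuousAt_inv hx
  rwa [ContinuousAt, ζ.inv_apply hx] at this

theorem isHolAt_iff_inv (ζ : HolCoord M n) {x : M} (hx : x ∈ ζ.source) {h : M → ℂ} :
    IsHolAt h x ↔ AnalyticAt ℂ (fun p => h (ζ.inv p)) (ζ x) :=
  ζ.isHolAt_iff x hx h

theorem isHolAt_apply (ζ : HolCoord M n) {x : M} (hx : x ∈ ζ.source) (i : Fin n) :
    IsHolAt (fun y => ζ y i) x := by
  refine (ζ.isHolAt_iff_inv hx).2 ?_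
  have h1 : AnalyticAt ℂ (fun p : Fin n → ℂ => p i) (ζ x) :=
    (ContinuousLinearMap.proj (R := ℂ) (φ := fun _ : Fin n => ℂ) i).analyticAt _
  refine h1.congr ?_
  filter_upwards [ζ.open_target.mem_nhds (ζ.apply_mem hx)] with p hp
  rw [ζ.apply_inv hp]

theorem isHolAt_comp_apply (ζ : HolCoord M n) {x : M} (hx : x ∈ ζ.source) {F : (Fin n → ℂ) → ℂ}
    (hF : AnalyticAt ℂ F (ζ x)) : IsHolAt (fun y => F (ζ y)) x := by
  refine (ζ.isHolAt_iff_inv hx).2 (hF.congr ?_)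
  filter_upwards [ζ.open_target.mem_nhds (ζ.apply_mem hx)] with p hp
  rw [ζ.apply_inv hp]

end HolCoord

/-- `g` is a holomorphic map near `x`. -/
structure IsHolMapAt (g : M → M') (x : M) : Prop where
  continuousAt : ContinuousAt g x
  comp : ∀ h : M' → ℂ, IsHolAt h (g x) → IsHolAt (h ∘ g) x

theorem isHolMapAt_id (x : M) : IsHolMapAt (id : M → M) x := ⟨continuousAt_id, fun _ hh => hh⟩

theorem IsHolMapAt.analyticAt {g : M → M'} {x : M} (hg : IsHolMapAt g x) {ζ : HolCoord M n}
    {α : HolCoord M' n} (hx : x ∈ ζ.source) (hgx : g x ∈ α.source) :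
    AnalyticAt ℂ (fun p => α (g (ζ.inv p))) (ζ x) := by
  rw [analyticAt_pi_iff]
  exact fun i => (ζ.isHolAt_iff_inv hx).1 (hg.comp _ (α.isHolAt_apply hgx i))

/-- The Jacobian determinant at `x` of a map, in the coordinates `ζ` and `α`. -/
noncomputable def mapJac (g : M → M') (ζ : HolCoord M n) (α : HolCoord M' n) (x : M) : ℂ :=
  (fderiv ℂ (fun p => α (g (ζ.inv p))) (ζ x)).det

theorem mapJac_id (ζ η : HolCoord M n) (x : M) : mapJac id ζ η x = ζ.transJac η x := rfl

theorem mapJac_congr {g g' : M → M'} {x : M} (h : g =ᶠ[𝓝 x] g') {ζ : HolCoord M n}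
    (hx : x ∈ ζ.source) (α : HolCoord M' n) : mapJac g ζ α x = mapJac g' ζ α x := by
  unfold mapJac
  congr 1
  refine Filter.EventuallyEq.fderiv_eq ?_
  filter_upwards [(ζ.tendsto_inv hx).eventually h] with p hp
  rw [hp]

theorem mapJac_comp {g : M → M'} {g' : M' → M''} {x : M} (hg : IsHolMapAt g x)
    (hg' : IsHolMapAt g' (g x)) {ζ : HolCoord M n} {α : HolCoord M' n} {β : HolCoord M'' n}
    (hx : x ∈ ζ.source) (hgx : g x ∈ α.source) (hgx' : g' (g x) ∈ β.source) :
    mapJac (g' ∘ g) ζ β x = mapJac g' α β (g x) * mapJac g ζ α x := by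
  have h1 := (hg.analyticAt hx hgx).differentiableAt.hasFDerivAt
  have h2 := (hg'.analyticAt hgx hgx').differentiableAt.hasFDerivAt
  have h3 : α (g (ζ.inv (ζ x))) = α (g x) := by rw [ζ.inv_apply hx]
  rw [← h3] at h2
  have h4 := h2.comp (ζ x) h1
  have hE : (fun p => β ((g' ∘ g) (ζ.inv p))) =ᶠ[𝓝 (ζ x)]
      (fun q => β (g' (α.inv q))) ∘ fun p => α (g (ζ.inv p)) := by
    have ht : Tendsto (fun p => g (ζ.inv p)) (𝓝 (ζ x)) (𝓝 (g x)) :=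
      Tendsto.comp hg.continuousAt (ζ.tendsto_inv hx)
    filter_upwards [ht.eventually (α.open_source.mem_nhds hgx)] with p hp
    simp only [Function.comp_apply]
    rw [α.inv_apply hp]
  unfold mapJac
  rw [hE.fderiv_eq, h4.fderiv, h3]
  exact LinearMap.det_comp _ _

theorem HolCoord.transJac_self (ζ : HolCoord M n) {x : M} (hx : x ∈ ζ.source) :
    ζ.transJac ζ x = 1 := by
  have hE : (fun p => ζ (ζ.inv p)) =ᶠ[𝓝 (ζ x)] id := by
    filter_upwards [ζ.open_target.mem_nhds (ζ.apply_mem hx)] with p hp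
    exact ζ.apply_inv hp
  unfold HolCoord.transJac
  rw [hE.fderiv_eq, fderiv_id]
  exact LinearMap.det_id

/-- The chain rule for a holomorphic local left inverse; this is the source of all nonvanishing of
Jacobians. -/
theorem mapJac_mul_eq_one {g : M → M'} {s : M' → M} {x : M} (hg : IsHolMapAt g x)
    (hs : IsHolMapAt s (g x)) (hsg : s ∘ g =ᶠ[𝓝 x] id) {ζ : HolCoord M n} {α : HolCoord M' n}
    (hx : x ∈ ζ.source) (hgx : g x ∈ α.source) : mapJac s α ζ (g x) * mapJac g ζ α x = 1 := by
  have hsx : s (g x) = x := hsg.eq_of_nhds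
  rw [← mapJac_comp hg hs hx hgx (by rwa [hsx]), mapJac_congr hsg hx, mapJac_id,
    ζ.transJac_self hx]

/-- Change of coordinates in the target. -/
theorem mapJac_trans_right {g : M → M'} {x : M} (hg : IsHolMapAt g x) {ζ : HolCoord M n}
    {α β : HolCoord M' n} (hx : x ∈ ζ.source) (hα : g x ∈ α.source) (hβ : g x ∈ β.source) :
    mapJac g ζ β x = α.transJac β (g x) * mapJac g ζ α x :=
  mapJac_comp hg (isHolMapAt_id _) hx hα hβ

/-- Change of coordinates in the source. -/
theorem mapJac_trans_left {g : M → M'} {x : M} (hg : IsHolMapAt g x) {ζ η : HolCoord M n}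
    {α : HolCoord M' n} (hζ : x ∈ ζ.source) (hη : x ∈ η.source) (hα : g x ∈ α.source) :
    mapJac g ζ α x = mapJac g η α x * ζ.transJac η x :=
  mapJac_comp (g := id) (isHolMapAt_id _) hg hζ hη hα

theorem HolCoord.transJac_ne_zero {ζ η : HolCoord M n} {x : M} (hζ : x ∈ ζ.source)
    (hη : x ∈ η.source) : ζ.transJac η x ≠ 0 := by
  have := mapJac_mul_eq_one (isHolMapAt_id x) (isHolMapAt_id _) (Filter.EventuallyEq.refl _ _)
    hζ hη
  exact right_ne_zero_of_mul_eq_one this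

/-- By the Leibniz formula the determinant is a polynomial in the matrix entries. -/
theorem analyticAt_det {E : Type*} [NormedAddCommGroup E] [NormedSpace ℂ E]
    {A : E → (Fin n → ℂ) →L[ℂ] (Fin n → ℂ)} {a : E} (hA : AnalyticAt ℂ A a) :
    AnalyticAt ℂ (fun p => (A p).det) a := by
  have h1 : ∀ B : (Fin n → ℂ) →L[ℂ] (Fin n → ℂ),
      B.det = ∑ σ : Equiv.Perm (Fin n), ((Equiv.Perm.sign σ : ℤ) : ℂ) *
        ∏ i, B (Pi.single i 1) (σ i) := by
    intro B
    change LinearMap.det (B : (Fin n → ℂ) →ₗ[ℂ] (Fin n → ℂ)) = _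
    rw [← LinearMap.det_toMatrix', Matrix.det_apply']
    simp only [LinearMap.toMatrix'_apply, ContinuousLinearMap.coe_coe]
  simp_rw [h1]
  refine Finset.analyticAt_fun_sum _ fun σ _ => analyticAt_const.mul ?_
  refine Finset.analyticAt_fun_prod _ fun i _ => ?_
  have h2 : AnalyticAt ℂ (fun p => A p (Pi.single i 1)) a :=
    AnalyticAt.comp (f := A)
      ((ContinuousLinearMap.apply ℂ (Fin n → ℂ) (Pi.single i (1 : ℂ) : Fin n → ℂ)).analyticAt _) hA
  exact analyticAt_pi_iff.1 h2 (σ i)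

theorem isHolAt_mapJac {g : M → M'} {x : M} (hg : ∀ᶠ y in 𝓝 x, IsHolMapAt g y) {ζ : HolCoord M n}
    {α : HolCoord M' n} (hx : x ∈ ζ.source) (hgx : g x ∈ α.source) :
    IsHolAt (fun y => mapJac g ζ α y) x := by
  unfold mapJac
  exact ζ.isHolAt_comp_apply hx (F := fun p => (fderiv ℂ (fun q => α (g (ζ.inv q))) p).det)
    (analyticAt_det (hg.self_of_nhds.analyticAt hx hgx).fderiv)

theorem isHolAt_mul {h h' : M → ℂ} {x : M} (hx : IsRegularPt n x) (hh : IsHolAt h x)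
    (hh' : IsHolAt h' x) : IsHolAt (fun y => h y * h' y) x := by
  obtain ⟨ζ, hζ⟩ := hx
  exact (ζ.isHolAt_iff_inv hζ).2
    (((ζ.isHolAt_iff_inv hζ).1 hh).mul ((ζ.isHolAt_iff_inv hζ).1 hh'))

theorem isHolAt_div {h h' : M → ℂ} {x : M} (hx : IsRegularPt n x) (hh : IsHolAt h x)
    (hh' : IsHolAt h' x) (h0 : h' x ≠ 0) : IsHolAt (fun y => h y / h' y) x := by
  obtain ⟨ζ, hζ⟩ := hx
  exact (ζ.isHolAt_iff_inv hζ).2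
    (((ζ.isHolAt_iff_inv hζ).1 hh).div ((ζ.isHolAt_iff_inv hζ).1 hh') (by rwa [ζ.inv_apply hζ]))

/-! ## Finite holomorphic coverings of open sets -/

/-- `g` maps the open set `U` onto `U'` as a local biholomorphism with fibres of `k` points. -/
structure IsSheeted (g : M → M') (U : Set M) (U' : Set M') (k : ℕ) : Prop where
  isOpen : IsOpen U
  isOpen' : IsOpen U'
  mapsTo : MapsTo g U U'
  exists_local : ∀ x ∈ U, ∃ e : OpenPartialHomeomorph M M',
    x ∈ e.source ∧ e.source ⊆ U ∧ EqOn e g e.source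
  isHolAt_iff : ∀ x ∈ U, ∀ h : M' → ℂ, IsHolAt h (g x) ↔ IsHolAt (h ∘ g) x
  card_fibre : ∀ y ∈ U', (U ∩ g ⁻¹' {y}).encard = k

namespace IsSheeted

variable {g : M → M'} {U : Set M} {U' : Set M'} {k : ℕ}

theorem isHolMapAt (hg : IsSheeted g U U' k) {x : M} (hx : x ∈ U) : IsHolMapAt g x := by
  obtain ⟨e, hxe, -, heq⟩ := hg.exists_local x hx
  refine ⟨(e.continuousAt hxe).congr ?_, fun h hh => (hg.isHolAt_iff x hx h).1 hh⟩
  filter_upwards [e.open_source.mem_nhds hxe] with y hy using heq hy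

theorem eventually_isHolMapAt (hg : IsSheeted g U U' k) {x : M} (hx : x ∈ U) :
    ∀ᶠ y in 𝓝 x, IsHolMapAt g y := by
  filter_upwards [hg.isOpen.mem_nhds hx] with y hy using hg.isHolMapAt hy

/-- The local inverse is holomorphic because `isHolAt_iff` is an equivalence: functions upstairs are
holomorphic when they come from holomorphic functions downstairs, and conversely. -/
theorem mapJac_ne_zero (hg : IsSheeted g U U' k) {x : M} (hx : x ∈ U) {ζ : HolCoord M n}
    {α : HolCoord M' n} (hζ : x ∈ ζ.source) (hα : g x ∈ α.source) : mapJac g ζ α x ≠ 0 := by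
  obtain ⟨e, hxe, -, heq⟩ := hg.exists_local x hx
  have hs : e.symm ∘ g =ᶠ[𝓝 x] id := by
    filter_upwards [e.open_source.mem_nhds hxe] with y hy
    simp [← heq hy, e.left_inv hy]
  have hgx : g x ∈ e.target := by rw [← heq hxe]; exact e.map_source hxe
  have hsx : e.symm (g x) = x := hs.eq_of_nhds
  have hS : IsHolMapAt e.symm (g x) := by
    refine ⟨e.symm.continuousAt hgx, fun h hh => ?_⟩
    rw [hsx] at hh
    rw [hg.isHolAt_iff x hx]
    exact (isHolAt_congr (hs.fun_comp h)).2 hh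
  exact right_ne_zero_of_mul_eq_one (mapJac_mul_eq_one (hg.isHolMapAt hx) hS hs hζ hα)

theorem exists_preimage (hg : IsSheeted g U U' k) (hk : k ≠ 0) {y : M'} (hy : y ∈ U') :
    ∃ x ∈ U, g x = y := by
  have h : (U ∩ g ⁻¹' {y}).Nonempty := by
    rw [← Set.encard_ne_zero, hg.card_fibre y hy]
    exact_mod_cast hk
  obtain ⟨x, hx, hxy⟩ := h
  exact ⟨x, hx, hxy⟩

theorem id_of_isOpen {U : Set M} (hU : IsOpen U) : IsSheeted (id : M → M) U U 1 where
  isOpen := hU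
  isOpen' := hU
  mapsTo := mapsTo_id U
  exists_local x hx := ⟨OpenPartialHomeomorph.ofSet U hU, hx, Subset.rfl, fun _ _ => rfl⟩
  isHolAt_iff _ _ _ := Iff.rfl
  card_fibre y hy := by
    have : U ∩ id ⁻¹' {y} = {y} := by
      ext x
      simp only [preimage_id, mem_inter_iff, mem_singleton_iff, and_iff_right_iff_imp]
      rintro rfl
      exact hy
    rw [this]
    simp

end IsSheeted

/-! ## Forms on open sets, pull-back and push-forward -/

/-- A family of coefficients that defines a holomorphic `(n,0)`-form on the regular points of
dimension `n` in `U`. -/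
structure IsFormOn (U : Set M) (φ : HolCoord M n → M → ℂ) : Prop where
  isHolAt : ∀ ζ : HolCoord M n, ∀ x ∈ U, x ∈ ζ.source → IsHolAt (φ ζ) x
  trans : ∀ ζ η : HolCoord M n, ∀ x ∈ U, x ∈ ζ.source → x ∈ η.source →
    φ ζ x = φ η x * ζ.transJac η x

theorem isFormOn_of_mem_holForms {φ : HolCoord M n → M → ℂ} (hφ : φ ∈ holForms M n) (U : Set M) :
    IsFormOn U φ :=
  ⟨fun ζ x _ hx => hφ.1 ζ x hx, fun ζ η x _ hx hx' => hφ.2.1 ζ η x hx hx'⟩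

open Classical in
/-- The pull-back of a form by a map that is defined on `U`. -/
noncomputable def pullForm (g : M → M') (U : Set M) (φ : HolCoord M' n → M' → ℂ) :
    HolCoord M n → M → ℂ := fun ζ x =>
  if h : (x ∈ U ∧ x ∈ ζ.source) ∧ IsRegularPt n (g x) then
    φ (coordAt h.2) (g x) * mapJac g ζ (coordAt h.2) x
  else 0

open Classical in
/-- The push-forward of a form on `U` that is invariant under the symmetries of `g`. -/
noncomputable def pushForm (g : M → M') (U : Set M) (χ : HolCoord M n → M → ℂ) :
    HolCoord M' n → M' → ℂ := fun α y =>
  if h : y ∈ α.source ∧ ∃ x ∈ U, g x = y ∧ IsRegularPt n x then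
    χ (coordAt (Classical.choose_spec h.2).2.2) (Classical.choose h.2) /
      mapJac g (coordAt (Classical.choose_spec h.2).2.2) α (Classical.choose h.2)
  else 0

theorem mem_coordAt {x : M} (hx : IsRegularPt n x) : x ∈ (coordAt hx).source :=
  Classical.choose_spec hx

variable {g : M → M'} {U : Set M} {U' : Set M'} {k : ℕ}

theorem pullForm_eq (hg : IsSheeted g U U' k) {φ : HolCoord M' n → M' → ℂ} (hφ : IsFormOn U' φ)
    {ζ : HolCoord M n} {α : HolCoord M' n} {x : M} (hx : x ∈ U) (hζ : x ∈ ζ.source)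
    (hα : g x ∈ α.source) : pullForm g U φ ζ x = φ α (g x) * mapJac g ζ α x := by
  have h : (x ∈ U ∧ x ∈ ζ.source) ∧ IsRegularPt n (g x) := ⟨⟨hx, hζ⟩, α, hα⟩
  rw [pullForm, dif_pos h, hφ.trans α (coordAt h.2) _ (hg.mapsTo hx) hα (mem_coordAt h.2),
    mapJac_trans_right (hg.isHolMapAt hx) hζ hα (mem_coordAt h.2)]
  ring

theorem isFormOn_pullForm (hg : IsSheeted g U U' k) (hreg' : ∀ y ∈ U', IsRegularPt n y)
    {φ : HolCoord M' n → M' → ℂ} (hφ : IsFormOn U' φ) : IsFormOn U (pullForm g U φ) := by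
  constructor
  · intro ζ x hx hζ
    obtain ⟨α, hα⟩ := hreg' _ (hg.mapsTo hx)
    have hE : (fun y => φ α (g y) * mapJac g ζ α y) =ᶠ[𝓝 x] pullForm g U φ ζ := by
      filter_upwards [hg.isOpen.mem_nhds hx, ζ.open_source.mem_nhds hζ,
        (hg.isHolMapAt hx).continuousAt.eventually_mem (α.open_source.mem_nhds hα)] with y h1 h2 h3
      exact (pullForm_eq hg hφ h1 h2 h3).symm
    refine (isHolAt_congr hE).1 (isHolAt_mul ⟨ζ, hζ⟩ ?_
      (isHolAt_mapJac (hg.eventually_isHolMapAt hx) hζ hα))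
    exact (hg.isHolMapAt hx).comp _ (hφ.isHolAt α _ (hg.mapsTo hx) hα)
  · intro ζ η x hx hζ hη
    obtain ⟨α, hα⟩ := hreg' _ (hg.mapsTo hx)
    rw [pullForm_eq hg hφ hx hζ hα, pullForm_eq hg hφ hx hη hα,
      mapJac_trans_left (hg.isHolMapAt hx) hζ hη hα]
    ring

/-- `hinv` is invariance along the fibres with denominators cleared: the quotient of coefficient and
Jacobian is the same at all points over a given point. So the preimage and the coordinates chosen in
`pushForm` do not matter. -/
theorem pushForm_eq (hg : IsSheeted g U U' k) {χ : HolCoord M n → M → ℂ}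
    (hinv : ∀ x ∈ U, ∀ x' ∈ U, g x = g x' → ∀ (ζ ζ' : HolCoord M n) (α : HolCoord M' n),
      x ∈ ζ.source → x' ∈ ζ'.source → g x ∈ α.source →
      χ ζ x * mapJac g ζ' α x' = χ ζ' x' * mapJac g ζ α x)
    {ζ : HolCoord M n} {α : HolCoord M' n} {x : M} (hx : x ∈ U) (hζ : x ∈ ζ.source)
    (hα : g x ∈ α.source) : pushForm g U χ α (g x) = χ ζ x / mapJac g ζ α x := by
  have h : g x ∈ α.source ∧ ∃ x' ∈ U, g x' = g x ∧ IsRegularPt n x' := ⟨hα, x, hx, rfl, ζ, hζ⟩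
  have hs := Classical.choose_spec h.2
  rw [pushForm, dif_pos h, div_eq_div_iff (hg.mapJac_ne_zero hs.1 (mem_coordAt hs.2.2)
    (by rwa [hs.2.1])) (hg.mapJac_ne_zero hx hζ hα)]
  exact hinv _ hs.1 _ hx hs.2.1 _ _ _ (mem_coordAt hs.2.2) hζ (by rwa [hs.2.1])

/-- Holomorphy downstairs is tested upstairs, by `isHolAt_iff`, where the coefficient is a quotient
by a nonvanishing holomorphic Jacobian. -/
theorem isFormOn_pushForm (hg : IsSheeted g U U' k) (hk : k ≠ 0)
    (hreg : ∀ x ∈ U, IsRegularPt n x) {χ : HolCoord M n → M → ℂ} (hχ : IsFormOn U χ)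
    (hinv : ∀ x ∈ U, ∀ x' ∈ U, g x = g x' → ∀ (ζ ζ' : HolCoord M n) (α : HolCoord M' n),
      x ∈ ζ.source → x' ∈ ζ'.source → g x ∈ α.source →
      χ ζ x * mapJac g ζ' α x' = χ ζ' x' * mapJac g ζ α x) :
    IsFormOn U' (pushForm g U χ) := by
  constructor
  · intro α y hy hα
    obtain ⟨x, hx, rfl⟩ := hg.exists_preimage hk hy
    obtain ⟨ζ, hζ⟩ := hreg x hx
    rw [hg.isHolAt_iff x hx]
    have hE : (fun y => χ ζ y / mapJac g ζ α y) =ᶠ[𝓝 x] pushForm g U χ α ∘ g := by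
      filter_upwards [hg.isOpen.mem_nhds hx, ζ.open_source.mem_nhds hζ,
        (hg.isHolMapAt hx).continuousAt.eventually_mem (α.open_source.mem_nhds hα)] with y h1 h2 h3
      exact (pushForm_eq hg hinv h1 h2 h3).symm
    exact (isHolAt_congr hE).1 (isHolAt_div ⟨ζ, hζ⟩ (hχ.isHolAt ζ x hx hζ)
      (isHolAt_mapJac (hg.eventually_isHolMapAt hx) hζ hα) (hg.mapJac_ne_zero hx hζ hα))
  · intro α β y hy hα hβ
    obtain ⟨x, hx, rfl⟩ := hg.exists_preimage hk hy
    obtain ⟨ζ, hζ⟩ := hreg x hx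
    rw [pushForm_eq hg hinv hx hζ hα, pushForm_eq hg hinv hx hζ hβ,
      mapJac_trans_right (hg.isHolMapAt hx) hζ hα hβ]
    have h1 := HolCoord.transJac_ne_zero hα hβ
    have h2 := hg.mapJac_ne_zero hx hζ hα
    field_simp

theorem pullForm_pushForm (hg : IsSheeted g U U' k) (hk : k ≠ 0)
    (hreg : ∀ x ∈ U, IsRegularPt n x) {χ : HolCoord M n → M → ℂ} (hχ : IsFormOn U χ)
    (hinv : ∀ x ∈ U, ∀ x' ∈ U, g x = g x' → ∀ (ζ ζ' : HolCoord M n) (α : HolCoord M' n),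
      x ∈ ζ.source → x' ∈ ζ'.source → g x ∈ α.source →
      χ ζ x * mapJac g ζ' α x' = χ ζ' x' * mapJac g ζ α x)
    (hreg' : ∀ y ∈ U', IsRegularPt n y) {ζ : HolCoord M n} {x : M} (hx : x ∈ U)
    (hζ : x ∈ ζ.source) : pullForm g U (pushForm g U χ) ζ x = χ ζ x := by
  obtain ⟨α, hα⟩ := hreg' _ (hg.mapsTo hx)
  rw [pullForm_eq hg (isFormOn_pushForm hg hk hreg hχ hinv) hx hζ hα,
    pushForm_eq hg hinv hx hζ hα, div_mul_cancel₀ _ (hg.mapJac_ne_zero hx hζ hα)]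

end Maps

/-! ## The measure defined by a form -/

section CoordPart

variable {M : Type*} [TopologicalSpace M] [ReducedComplexSpace M] [SecondCountableTopology M]
  {n : ℕ}

/-- The `j`-th set of the partition of the manifold of regular points of dimension `n`. -/
def coordPart (M : Type*) [TopologicalSpace M] [SecondCountableTopology M]
    [ReducedComplexSpace M] (n : ℕ) (j : ℕ) : Set M :=
  {x | ∃ ζ, coordCover M n j = some ζ ∧ x ∈ ζ.source ∧
    ∀ i < j, ∀ η, coordCover M n i = some η → x ∉ η.source}

theorem coordPart_eq_empty {j : ℕ} (hj : coordCover M n j = none) : coordPart M n j = ∅ := by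
  ext x
  simp [coordPart, hj]

theorem mem_coordPart {j : ℕ} {ζ : HolCoord M n} (hj : coordCover M n j = some ζ) {x : M} :
    x ∈ coordPart M n j ↔ x ∈ ζ.source ∧
      ∀ i < j, ∀ η, coordCover M n i = some η → x ∉ η.source := by
  simp [coordPart, hj]

theorem coordPiece_eq {j : ℕ} {ζ : HolCoord M n} (hj : coordCover M n j = some ζ) :
    coordPiece M n j = ζ.target ∩ ζ.inv ⁻¹' coordPart M n j := by
  ext p
  simp only [coordPiece, mem_inter_iff, mem_preimage, mem_coordPart hj]
  constructor
  · rintro ⟨ζ', h, hp, hi⟩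
    obtain rfl := Option.some.inj (hj.symm.trans h)
    exact ⟨hp, ζ.inv_mem hp, hi⟩
  · exact fun h => ⟨ζ, hj, h.1, h.2.2⟩

theorem coordPiece_eq_empty {j : ℕ} (hj : coordCover M n j = none) : coordPiece M n j = ∅ := by
  ext x
  simp [coordPiece, hj]

theorem pairwise_disjoint_coordPart :
    Pairwise (Function.onFun Disjoint (coordPart M n)) := by
  have key : ∀ i j, i < j → Disjoint (coordPart M n i) (coordPart M n j) := by
    intro i j hij
    rw [Set.disjoint_left]
    rintro x ⟨ζ, hζ, hx, -⟩ ⟨η, -, -, hi⟩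
    exact hi i hij ζ hζ hx
  intro i j hij
  rcases lt_or_gt_of_ne hij with h | h
  · exact key i j h
  · exact (key j i h).symm

theorem exists_mem_coordPart {x : M} (hx : IsRegularPt n x) : ∃ j, x ∈ coordPart M n j := by
  classical
  have hex := Classical.choose_spec (exists_coordCover M n) x hx
  obtain ⟨η, hη, hxη⟩ := Nat.find_spec hex
  exact ⟨Nat.find hex, η, hη, hxη, fun i hi θ hθ hm => Nat.find_min hex hi ⟨θ, hθ, hm⟩⟩

end CoordPart

section FormMeasure

variable {M : Type*} [TopologicalSpace M] [ReducedComplexSpace M] [MeasurableSpace M]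
  [BorelSpace M]
  {M' : Type*} [TopologicalSpace M'] [ReducedComplexSpace M'] [MeasurableSpace M']
  [BorelSpace M'] {n : ℕ}

/-- The measure `i^(n²) φ ∧ conj φ` on the domain of the coordinates `ζ`. -/
noncomputable def coordDensity (φ : HolCoord M n → M → ℂ) (ζ : HolCoord M n) : Measure M :=
  Measure.map ζ.inv ((((2 : ℝ≥0∞) ^ n) • volume.restrict ζ.target).withDensity
    fun p => ‖φ ζ (ζ.inv p)‖ₑ ^ 2)

theorem HolCoord.aemeasurable_inv (ζ : HolCoord M n) :
    AEMeasurable ζ.inv (volume.restrict ζ.target) :=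
  ζ.toOpenPartialHomeomorph.continuousOn_symm.aemeasurable ζ.open_target.measurableSet

theorem HolCoord.measurableSet_target_inter (ζ : HolCoord M n) {E : Set M}
    (hE : MeasurableSet E) : MeasurableSet (ζ.target ∩ ζ.inv ⁻¹' E) := by
  have h1 : Measurable (ζ.target.domRestrict ζ.inv) :=
    (continuousOn_iff_continuous_domRestrict.1
      ζ.toOpenPartialHomeomorph.continuousOn_symm).measurable
  have h2 : MeasurableSet (Subtype.val '' (ζ.target.domRestrict ζ.inv ⁻¹' E)) :=
    ζ.open_target.measurableSet.subtype_image (h1 hE)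
  convert h2 using 1
  ext p
  simp [and_comm]

theorem coordDensity_apply (φ : HolCoord M n → M → ℂ) (ζ : HolCoord M n) {E : Set M}
    (hE : MeasurableSet E) : coordDensity φ ζ E =
      2 ^ n * ∫⁻ p in ζ.target ∩ ζ.inv ⁻¹' E, ‖φ ζ (ζ.inv p)‖ₑ ^ 2 := by
  have hae : AEMeasurable ζ.inv ((((2 : ℝ≥0∞) ^ n) • volume.restrict ζ.target).withDensity
      fun p => ‖φ ζ (ζ.inv p)‖ₑ ^ 2) :=
    (ζ.aemeasurable_inv.smul_measure _).mono_ac (withDensity_absolutelyContinuous _ _)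
  rw [coordDensity, Measure.map_apply_of_aemeasurable hae hE, withDensity_smul_measure,
    Measure.smul_apply, withDensity_apply',
    Measure.restrict_restrict' ζ.open_target.measurableSet, inter_comm, smul_eq_mul]

/-- Change of variables. -/
theorem coordDensity_image {g : M → M'} {φ : HolCoord M' n → M' → ℂ} {ψ : HolCoord M n → M → ℂ}
    {ζ : HolCoord M n} {α : HolCoord M' n} {E : Set M} (hE : MeasurableSet E)
    (hgE : MeasurableSet (g '' E)) (hg : ∀ x ∈ E, IsHolMapAt g x) (hinj : InjOn g E)
    (hζ : E ⊆ ζ.source) (hα : MapsTo g E α.source)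
    (h : ∀ x ∈ E, ψ ζ x = φ α (g x) * mapJac g ζ α x) :
    coordDensity ψ ζ E = coordDensity φ α (g '' E) := by
  rw [coordDensity_apply _ _ hE, coordDensity_apply _ _ hgE]
  congr 1
  let f : (Fin n → ℂ) → (Fin n → ℂ) := fun p => α (g (ζ.inv p))
  have himg : α.target ∩ α.inv ⁻¹' (g '' E) = f '' (ζ.target ∩ ζ.inv ⁻¹' E) := by
    ext q
    constructor
    · rintro ⟨hq, x, hx, hxq⟩
      refine ⟨ζ x, ⟨ζ.apply_mem (hζ hx), ?_⟩, ?_⟩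
      · rwa [mem_preimage, ζ.inv_apply (hζ hx)]
      · change α (g (ζ.inv (ζ x))) = q
        rw [ζ.inv_apply (hζ hx), hxq, α.apply_inv hq]
    · rintro ⟨p, ⟨hp, hpE⟩, rfl⟩
      have hm : g (ζ.inv p) ∈ α.source := hα hpE
      refine ⟨α.apply_mem hm, ζ.inv p, hpE, ?_⟩
      change g (ζ.inv p) = α.inv (α (g (ζ.inv p)))
      rw [α.inv_apply hm]
  have hfinj : InjOn f (ζ.target ∩ ζ.inv ⁻¹' E) := by
    rintro p ⟨hp, hpE⟩ q ⟨hq, hqE⟩ hpq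
    have h1 : g (ζ.inv p) = g (ζ.inv q) := by
      rw [← α.inv_apply (hα hpE), ← α.inv_apply (hα hqE)]
      exact congrArg α.inv hpq
    rw [← ζ.apply_inv hp, ← ζ.apply_inv hq, hinj hpE hqE h1]
  have hder : ∀ p ∈ ζ.target ∩ ζ.inv ⁻¹' E, HasFDerivAt f (fderiv ℂ f p) p := by
    rintro p ⟨hp, hpE⟩
    have := (hg _ hpE).analyticAt (hζ hpE) (hα hpE)
    rw [ζ.apply_inv hp] at this
    exact this.differentiableAt.hasFDerivAt
  -- The real Jacobian of `f` is the squared modulus of the complex one, which is exactly the ratio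
  -- of the two densities.
  rw [himg, lintegral_image_eq_lintegral_abs_det_fderiv_mul volume
    (ζ.measurableSet_target_inter hE)
    (fun p hp => ((hder p hp).restrictScalars ℝ).hasFDerivWithinAt) hfinj]
  refine setLIntegral_congr_fun (ζ.measurableSet_target_inter hE) ?_
  rintro p ⟨hp, hpE⟩
  have hm : g (ζ.inv p) ∈ α.source := hα hpE
  simp only [f]
  rw [α.inv_apply hm, h _ hpE, abs_det_restrictScalars, enorm_mul, mul_pow, mul_comm]
  congr 1
  rw [mapJac, ζ.apply_inv hp, ENNReal.ofReal_pow (norm_nonneg _), ofReal_norm]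

/-- Change of variables for the identity map. -/
theorem coordDensity_congr {φ : HolCoord M n → M → ℂ} {U E : Set M} (hφ : IsFormOn U φ)
    {ζ η : HolCoord M n} (hE : MeasurableSet E) (hU : E ⊆ U) (hζ : E ⊆ ζ.source)
    (hη : E ⊆ η.source) : coordDensity φ ζ E = coordDensity φ η E := by
  have := coordDensity_image (g := id) (φ := φ) (ψ := φ) (ζ := ζ) (α := η) hE
    (by rwa [image_id]) (fun x _ => isHolMapAt_id x) (injOn_id E) hζ hη
    (fun x hx => by rw [mapJac_id]; exact hφ.trans ζ η x (hU hx) (hζ hx) (hη hx))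
  rwa [image_id] at this

variable [SecondCountableTopology M] [SecondCountableTopology M']

theorem measurableSet_coordPart (M : Type*) [TopologicalSpace M] [ReducedComplexSpace M]
    [MeasurableSpace M] [BorelSpace M] [SecondCountableTopology M] (n j : ℕ) :
    MeasurableSet (coordPart M n j) := by
  rcases hj : coordCover M n j with _ | ζ
  · simp [coordPart_eq_empty hj]
  · have : coordPart M n j = ζ.source ∩ ⋂ i, ⋂ (_ : i < j),
        (coordCover M n i).elim univ (fun η => η.sourceᶜ) := by
      ext x
      simp only [mem_coordPart hj, mem_inter_iff, mem_iInter]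
      refine and_congr_right fun _ => forall_congr' fun i => forall_congr' fun _ => ?_
      cases coordCover M n i <;> simp
    rw [this]
    refine ζ.open_source.measurableSet.inter (MeasurableSet.iInter fun i => MeasurableSet.iInter
      fun _ => ?_)
    cases coordCover M n i with
    | none => exact MeasurableSet.univ
    | some η => exact η.open_source.measurableSet.compl

/-- The measure `i^(n²) φ ∧ conj φ`. -/
noncomputable def formMeasure (φ : HolCoord M n → M → ℂ) : Measure M :=
  Measure.sum fun j => (coordCover M n j).elim 0 fun ζ =>
    (coordDensity φ ζ).restrict (coordPart M n j)

/-- Frees `formMeasure` from the chosen cover: cut `E` along the partition and compare the two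
coordinates on each piece. -/
theorem formMeasure_apply (φ : HolCoord M n → M → ℂ) {U E : Set M} (hφ : IsFormOn U φ)
    {ζ : HolCoord M n} (hE : MeasurableSet E) (hU : E ⊆ U) (hζ : E ⊆ ζ.source) :
    formMeasure φ E = coordDensity φ ζ E := by
  have hcov : E = ⋃ j, E ∩ coordPart M n j := by
    ext x
    simp only [mem_iUnion, mem_inter_iff, exists_and_left, iff_self_and]
    exact fun hx => exists_mem_coordPart ⟨ζ, hζ hx⟩
  have hm : ∀ j, MeasurableSet (E ∩ coordPart M n j) := fun j =>
    hE.inter (measurableSet_coordPart M n j)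
  rw [formMeasure, Measure.sum_apply _ hE]
  nth_rw 2 [hcov]
  rw [measure_iUnion (fun i j hij => (pairwise_disjoint_coordPart hij).mono inter_subset_right
    inter_subset_right) hm]
  refine tsum_congr fun j => ?_
  rcases hj : coordCover M n j with _ | η
  · simp [coordPart_eq_empty hj]
  · simp only [Option.elim_some]
    rw [Measure.restrict_apply hE]
    exact coordDensity_congr hφ (hm j) (inter_subset_left.trans hU)
      (fun x hx => ((mem_coordPart hj).1 hx.2).1) (inter_subset_left.trans hζ)

/-- The link between the measure on `M` and the `L²` norm on the disjoint union of the coordinate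
pieces. -/
theorem formMeasure_univ (φ : HolCoord M n → M → ℂ) :
    formMeasure φ univ = ∫⁻ t, ‖coordRep φ t‖ₑ ^ 2 ∂(coordMeasure M n) := by
  rw [formMeasure, Measure.sum_apply _ MeasurableSet.univ, coordMeasure, lintegral_sum_measure]
  refine tsum_congr fun j => ?_
  rw [lintegral_smul_measure, (measurableEmbedding_prodMk_left j).lintegral_map, smul_eq_mul]
  rcases hj : coordCover M n j with _ | ζ
  · simp [coordPiece_eq_empty hj]
  · simp only [Option.elim_some]
    rw [Measure.restrict_apply MeasurableSet.univ, univ_inter,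
      coordDensity_apply _ _ (measurableSet_coordPart M n j), coordPiece_eq hj]
    simp [coordRep, hj]

theorem formMeasure_congr {φ ψ : HolCoord M n → M → ℂ} {E : Set M} (hE : MeasurableSet E)
    (h : ∀ ζ : HolCoord M n, ∀ x ∈ E, x ∈ ζ.source → φ ζ x = ψ ζ x) :
    formMeasure φ E = formMeasure ψ E := by
  rw [formMeasure, formMeasure, Measure.sum_apply _ hE, Measure.sum_apply _ hE]
  refine tsum_congr fun j => ?_
  rcases hj : coordCover M n j with _ | ζ
  · simp
  · simp only [Option.elim_some]
    rw [Measure.restrict_apply hE, Measure.restrict_apply hE,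
      coordDensity_apply _ _ (hE.inter (measurableSet_coordPart M n j)),
      coordDensity_apply _ _ (hE.inter (measurableSet_coordPart M n j))]
    congr 1
    refine setLIntegral_congr_fun
      (ζ.measurableSet_target_inter (hE.inter (measurableSet_coordPart M n j))) fun p hp => ?_
    simp only [h ζ _ hp.2.1 (ζ.inv_mem hp.1)]

/-- Each point of `U` has a neighbourhood on which `g` preserves the measures. -/
theorem IsSheeted.exists_nhds_formMeasure_image {g : M → M'} {U : Set M} {U' : Set M'} {k : ℕ}
    (hg : IsSheeted g U U' k) (hreg : ∀ x ∈ U, IsRegularPt n x) (hreg' : ∀ y ∈ U', IsRegularPt n y)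
    {φ : HolCoord M' n → M' → ℂ} (hφ : IsFormOn U' φ) {x : M} (hx : x ∈ U) :
    ∃ O : Set M, IsOpen O ∧ x ∈ O ∧ O ⊆ U ∧ InjOn g O ∧ ∀ E ⊆ O, MeasurableSet E →
      MeasurableSet (g '' E) ∧ formMeasure (pullForm g U φ) E = formMeasure φ (g '' E) := by
  obtain ⟨e, hxe, heU, heq⟩ := hg.exists_local x hx
  obtain ⟨ζ, hζ⟩ := hreg x hx
  obtain ⟨α, hα⟩ := hreg' _ (hg.mapsTo hx)
  have hO : IsOpen (ζ.source ∩ (e.source ∩ e ⁻¹' α.source)) :=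
    ζ.open_source.inter (e.isOpen_inter_preimage α.open_source)
  have hinj : InjOn g e.source := e.injOn.congr heq
  refine ⟨_, hO, ⟨hζ, hxe, by rwa [mem_preimage, heq hxe]⟩, fun y hy => heU hy.2.1,
    hinj.mono fun y hy => hy.2.1, fun E hEO hE => ?_⟩
  have hEe : E ⊆ e.source := fun y hy => (hEO hy).2.1
  have hEU : E ⊆ U := hEe.trans heU
  have himg : g '' E = Subtype.val '' (e.target.domRestrict e.symm ⁻¹' E) := by
    ext y
    constructor
    · rintro ⟨x, hx, rfl⟩
      have hxs := hEe hx
      rw [← heq hxs]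
      refine ⟨⟨e x, e.map_source hxs⟩, ?_, rfl⟩
      simpa [e.left_inv hxs] using hx
    · rintro ⟨⟨y, hy⟩, hyE, rfl⟩
      refine ⟨e.symm y, hyE, ?_⟩
      exact (heq (hEe hyE)).symm.trans (e.right_inv hy)
  have hmeas : MeasurableSet (g '' E) := by
    rw [himg]
    refine e.open_target.measurableSet.subtype_image ?_
    exact (continuousOn_iff_continuous_domRestrict.1 e.continuousOn_symm).measurable hE
  have hmaps : MapsTo g E α.source := fun y hy => by
    rw [← heq (hEe hy)]
    exact (hEO hy).2.2
  refine ⟨hmeas, ?_⟩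
  rw [formMeasure_apply _ (isFormOn_pullForm hg hreg' hφ) hE hEU fun y hy => (hEO hy).1,
    formMeasure_apply _ hφ hmeas (hg.mapsTo.mono_left hEU).image_subset hmaps.image_subset]
  exact coordDensity_image hE hmeas (fun y hy => hg.isHolMapAt (hEU hy)) (hinj.mono hEe)
    (fun y hy => (hEO hy).1) hmaps fun y hy => pullForm_eq hg hφ (hEU hy) (hEO hy).1 (hmaps hy)

/-- The integral of the pull-back of a form by a `k`-sheeted covering is `k` times the integral of
the form. -/
theorem IsSheeted.formMeasure_pullForm {g : M → M'} {U : Set M} {U' : Set M'} {k : ℕ}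
    (hg : IsSheeted g U U' k) (hreg : ∀ x ∈ U, IsRegularPt n x) (hreg' : ∀ y ∈ U', IsRegularPt n y)
    {φ : HolCoord M' n → M' → ℂ} (hφ : IsFormOn U' φ) :
    formMeasure (pullForm g U φ) U = k * formMeasure φ U' := by
  classical
  rcases U.eq_empty_or_nonempty with rfl | ⟨x₀, hx₀⟩
  · rcases U'.eq_empty_or_nonempty with rfl | ⟨y, hy⟩
    · simp
    · have := hg.card_fibre y hy
      simp only [empty_inter, encard_empty] at this
      have : k = 0 := by exact_mod_cast this.symm
      simp [this]
  choose! O hO hxO hOU hOinj hOE using fun x (hx : x ∈ U) =>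
    hg.exists_nhds_formMeasure_image hreg hreg' hφ hx
  obtain ⟨T, hT, hTU⟩ := TopologicalSpace.isOpen_iUnion_countable (fun x : U => O x)
    (fun x => hO x x.2)
  have hTU' : ⋃ x ∈ T, O (x : M) = U := by
    rw [hTU]
    exact subset_antisymm (iUnion_subset fun x => hOU x x.2)
      fun x hx => mem_iUnion.2 ⟨⟨x, hx⟩, hxO x hx⟩
  have hTne : T.Nonempty := by
    have : x₀ ∈ ⋃ x ∈ T, O (x : M) := by rw [hTU']; exact hx₀
    obtain ⟨x, hx⟩ := mem_iUnion.1 this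
    obtain ⟨hxT, -⟩ := mem_iUnion.1 hx
    exact ⟨x, hxT⟩
  obtain ⟨c, rfl⟩ := hT.exists_eq_range hTne
  -- A countable partition of `U` into Borel sets on which `g` is injective and preserves the
  -- measures.
  let S : ℕ → Set M := disjointed fun j => O (c j)
  have hSm : ∀ j, MeasurableSet (S j) :=
    MeasurableSet.disjointed fun j => (hO _ (c j).2).measurableSet
  have hSO : ∀ j, S j ⊆ O (c j) := fun j => disjointed_subset _ j
  have hSd : Pairwise (Function.onFun Disjoint S) := disjoint_disjointed _
  have hSU : ⋃ j, S j = U := by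
    exact iUnion_disjointed.trans ((biUnion_range (g := fun x : U => O x)).symm.trans hTU')
  have hSE := fun j => hOE _ (c j).2 (S j) (hSO j) (hSm j)
  -- A point of `U'` lies in `g '' S j` for exactly `k` indices `j`: each of its preimages lies in
  -- one piece, and distinct preimages lie in distinct pieces.
  have hsum : ∀ y, ∑' j, (g '' S j).indicator (1 : M' → ℝ≥0∞) y =
      U'.indicator (fun _ => (k : ℝ≥0∞)) y := by
    intro y
    have h1 : ∑' j, (g '' S j).indicator (1 : M' → ℝ≥0∞) y =
        (({j | y ∈ g '' S j} : Set ℕ).encard : ℝ≥0∞) := by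
      rw [← ENNReal.tsum_set_one, tsum_subtype {j | y ∈ g '' S j} (fun _ => (1 : ℝ≥0∞))]
      refine tsum_congr fun j => ?_
      by_cases h : y ∈ g '' S j
      · rw [indicator_of_mem h, indicator_of_mem (show j ∈ {j | y ∈ g '' S j} from h)]
        rfl
      · rw [indicator_of_notMem h, indicator_of_notMem (show j ∉ {j | y ∈ g '' S j} from h)]
    rw [h1]
    by_cases hy : y ∈ U'
    swap
    · have : {j | y ∈ g '' S j} = ∅ := by
        ext j
        simp only [mem_ofPred_eq, mem_empty_iff_false, iff_false]
        rintro ⟨x, hx, rfl⟩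
        exact hy (hg.mapsTo (hOU _ (c j).2 (hSO j hx)))
      rw [indicator_of_notMem hy, this]
      simp
    rw [indicator_of_mem hy]
    have hex : ∀ x ∈ U ∩ g ⁻¹' {y}, ∃ j, x ∈ S j := fun x hx => by
      have := hx.1
      rw [← hSU] at this
      exact mem_iUnion.1 this
    choose! idx hidx using hex
    have hbij : idx '' (U ∩ g ⁻¹' {y}) = {j | y ∈ g '' S j} := by
      ext j
      constructor
      · rintro ⟨x, hx, rfl⟩
        exact ⟨x, hidx x hx, hx.2⟩
      · rintro ⟨x, hx, hxy⟩
        have hxF : x ∈ U ∩ g ⁻¹' {y} := ⟨hOU _ (c j).2 (hSO j hx), hxy⟩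
        refine ⟨x, hxF, ?_⟩
        by_contra hne
        exact Set.disjoint_left.1 (hSd hne) (hidx x hxF) hx
    have hinj : InjOn idx (U ∩ g ⁻¹' {y}) := by
      intro x hx x' hx' h
      have h2 := hidx x' hx'
      rw [← h] at h2
      exact hOinj _ (c (idx x)).2 (hSO _ (hidx x hx)) (hSO _ h2)
        ((show g x = y from hx.2).trans (show g x' = y from hx'.2).symm)
    rw [← hbij, hinj.encard_image, hg.card_fibre y hy]
    simp
  calc formMeasure (pullForm g U φ) U = ∑' j, formMeasure (pullForm g U φ) (S j) := by
        rw [← measure_iUnion hSd hSm, hSU]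
    _ = ∑' j, ∫⁻ y, (g '' S j).indicator 1 y ∂(formMeasure φ) := by
        refine tsum_congr fun j => ?_
        rw [(hSE j).2, lintegral_indicator_one (hSE j).1]
    _ = ∫⁻ y, ∑' j, (g '' S j).indicator 1 y ∂(formMeasure φ) :=
        (lintegral_tsum fun j => (measurable_one.indicator (hSE j).1).aemeasurable).symm
    _ = k * formMeasure φ U' := by
        simp_rw [hsum]
        rw [lintegral_indicator hg.isOpen'.measurableSet, setLIntegral_const]

end FormMeasure

/-! ## The Bergman space as a Hilbert space of functions -/

section Bergman

variable {M : Type*} [TopologicalSpace M] [SecondCountableTopology M] [ReducedComplexSpace M]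
  {n : ℕ}

namespace BergmanSpace

theorem ext_coeff {φ ψ : BergmanSpace M n} (h : φ.coeff = ψ.coeff) : φ = ψ := Subtype.ext h

theorem coeff_add (φ ψ : BergmanSpace M n) : (φ + ψ).coeff = φ.coeff + ψ.coeff := rfl

theorem coeff_sub (φ ψ : BergmanSpace M n) : (φ - ψ).coeff = φ.coeff - ψ.coeff := rfl

theorem coeff_smul (c : ℂ) (φ : BergmanSpace M n) : (c • φ).coeff = c • φ.coeff := rfl

theorem coeff_mem (φ : BergmanSpace M n) : φ.coeff ∈ holForms M n := φ.2.1

theorem memLp (φ : BergmanSpace M n) : MemLp (coordRep φ.coeff) 2 (coordMeasure M n) := φ.2.2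

theorem isFormOn (φ : BergmanSpace M n) (U : Set M) : IsFormOn U φ.coeff :=
  isFormOn_of_mem_holForms φ.coeff_mem U

theorem inner_eq (φ ψ : BergmanSpace M n) : inner ℂ φ ψ =
    ∫ t, coordRep ψ.coeff t * conj (coordRep φ.coeff t) ∂(coordMeasure M n) := rfl

/-- The coefficients of a form, as an element of an `L²` space. -/
noncomputable def toLp (M : Type*) [TopologicalSpace M] [SecondCountableTopology M]
    [ReducedComplexSpace M] (n : ℕ) :
    BergmanSpace M n →ₗᵢ[ℂ] Lp ℂ 2 (coordMeasure M n) :=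
  LinearMap.isometryOfInner
    { toFun := fun φ => φ.memLp.toLp
      map_add' := fun φ ψ => by
        rw [← MemLp.toLp_add]
        congr 1
        funext t
        simp only [coordRep, coeff_add, Pi.add_apply]
        cases coordCover M n t.1 <;> simp
      map_smul' := fun c φ => by
        rw [RingHom.id_apply, ← MemLp.toLp_const_smul]
        congr 1
        funext t
        simp only [coordRep, coeff_smul, Pi.smul_apply]
        cases coordCover M n t.1 <;> simp }
    (fun φ ψ => by
      rw [L2.inner_def, inner_eq]
      refine integral_congr_ae ?_
      filter_upwards [φ.memLp.coeFn_toLp, ψ.memLp.coeFn_toLp] with t h1 h2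
      change inner ℂ (φ.memLp.toLp _ t) (ψ.memLp.toLp _ t) = _
      rw [h1, h2, RCLike.inner_apply])

theorem toLp_ae_eq (φ : BergmanSpace M n) : toLp M n φ =ᵐ[coordMeasure M n] coordRep φ.coeff :=
  φ.memLp.coeFn_toLp

theorem formMeasure_univ_eq [MeasurableSpace M] [BorelSpace M] (φ : BergmanSpace M n) :
    formMeasure φ.coeff univ = ‖φ‖ₑ ^ 2 := by
  rw [formMeasure_univ]
  have h1 : ‖φ‖ₑ = ‖toLp M n φ‖ₑ := by
    rw [← ofReal_norm, ← ofReal_norm, (toLp M n).norm_map]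
  rw [h1, Lp.enorm_def, eLpNorm_congr_ae φ.toLp_ae_eq,
    eLpNorm_eq_lintegral_rpow_enorm_toReal (by norm_num) (by norm_num)]
  simp only [ENNReal.toReal_ofNat, ENNReal.rpow_ofNat, one_div]
  rw [← ENNReal.rpow_natCast, ← ENNReal.rpow_mul]
  norm_num

/-- Point evaluations are bounded, locally uniformly. -/
theorem exists_norm_coeff_le (ζ : HolCoord M n) {x : M} (hx : x ∈ ζ.source) :
    ∃ C : ℝ, ∃ r > 0, Metric.ball (ζ x) r ⊆ ζ.target ∧
      ∀ φ : BergmanSpace M n, ∀ p ∈ Metric.ball (ζ x) r, ‖φ.coeff ζ (ζ.inv p)‖ ≤ C * ‖φ‖ := by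
  let _ : MeasurableSpace M := borel M
  have : BorelSpace M := ⟨rfl⟩
  obtain ⟨R, hR, hRt⟩ := Metric.isOpen_iff.1 ζ.open_target _ (ζ.apply_mem hx)
  -- All balls of radius `R / 2` about points of the half-size ball stay in the chart and have the
  -- same volume `v`, so the mean value inequality gives the uniform constant `v ^ (-1/2)`. The
  -- factor `2 ^ n ≥ 1` of the measure is discarded.
  let v : ℝ≥0∞ := volume (Metric.ball (0 : Fin n → ℂ) (R / 2))
  have hv0 : v ≠ 0 := (Metric.measure_ball_pos volume _ (by positivity)).ne'
  have hvt : v ≠ ∞ := measure_ball_lt_top.ne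
  have hv : 0 < v.toReal := ENNReal.toReal_pos hv0 hvt
  refine ⟨(Real.sqrt v.toReal)⁻¹, R / 2, by positivity,
    (Metric.ball_subset_ball (by linarith)).trans hRt, fun φ p hp => ?_⟩
  have hsub : Metric.ball p (R / 2) ⊆ ζ.target := by
    refine (Metric.ball_subset_ball' ?_).trans hRt
    have := Metric.mem_ball.1 hp
    linarith
  have hd : DifferentiableOn ℂ (fun q => φ.coeff ζ (ζ.inv q)) (Metric.ball p (R / 2)) := by
    intro q hq
    have := (ζ.isHolAt_iff_inv (ζ.inv_mem (hsub hq))).1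
      (φ.coeff_mem.1 ζ _ (ζ.inv_mem (hsub hq)))
    rw [ζ.apply_inv (hsub hq)] at this
    exact this.differentiableAt.differentiableWithinAt
  have h1 := enorm_sq_mul_measure_ball_le volume hd
  have h2 : ∫⁻ q in Metric.ball p (R / 2), ‖φ.coeff ζ (ζ.inv q)‖ₑ ^ 2 ≤ ‖φ‖ₑ ^ 2 := by
    calc ∫⁻ q in Metric.ball p (R / 2), ‖φ.coeff ζ (ζ.inv q)‖ₑ ^ 2
        ≤ ∫⁻ q in ζ.target ∩ ζ.inv ⁻¹' ζ.source, ‖φ.coeff ζ (ζ.inv q)‖ₑ ^ 2 :=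
          lintegral_mono_set fun q hq => ⟨hsub hq, ζ.inv_mem (hsub hq)⟩
      _ ≤ 2 ^ n * ∫⁻ q in ζ.target ∩ ζ.inv ⁻¹' ζ.source, ‖φ.coeff ζ (ζ.inv q)‖ₑ ^ 2 :=
          le_mul_of_one_le_left zero_le (one_le_pow_of_one_le' one_le_two n)
      _ = formMeasure φ.coeff ζ.source := by
          rw [formMeasure_apply _ (φ.isFormOn univ) ζ.open_source.measurableSet (subset_univ _)
            Subset.rfl, coordDensity_apply _ _ ζ.open_source.measurableSet]
      _ ≤ formMeasure φ.coeff univ := measure_mono (subset_univ _)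
      _ = ‖φ‖ₑ ^ 2 := φ.formMeasure_univ_eq
  rw [Measure.addHaar_ball_center] at h1
  have h3 := h1.trans h2
  have h4 : ‖φ.coeff ζ (ζ.inv p)‖ ^ 2 * v.toReal ≤ ‖φ‖ ^ 2 := by
    have := ENNReal.toReal_mono (by simp) h3
    simpa using this
  rw [inv_mul_eq_div, le_div_iff₀ (by positivity)]
  refine le_of_sq_le_sq ?_ (norm_nonneg _)
  rwa [mul_pow, Real.sq_sqrt hv.le]

theorem exists_norm_coeff_apply_le (ζ : HolCoord M n) (x : M) :
    ∃ C : ℝ, ∀ φ : BergmanSpace M n, ‖φ.coeff ζ x‖ ≤ C * ‖φ‖ := by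
  by_cases hx : x ∈ ζ.source
  · obtain ⟨C, r, hr, -, h⟩ := exists_norm_coeff_le ζ hx
    refine ⟨C, fun φ => ?_⟩
    have := h φ (ζ x) (Metric.mem_ball_self hr)
    rwa [ζ.inv_apply hx] at this
  · refine ⟨0, fun φ => ?_⟩
    rw [φ.coeff_mem.2.2 ζ x hx]
    simp

/-- Evaluation of the coefficient at a point. -/
noncomputable def evalCLM (ζ : HolCoord M n) (x : M) : BergmanSpace M n →L[ℂ] ℂ :=
  LinearMap.mkContinuousOfExistsBound
    { toFun := fun φ => φ.coeff ζ x
      map_add' := fun _ _ => rfl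
      map_smul' := fun _ _ => rfl } (exists_norm_coeff_apply_le ζ x)

theorem evalCLM_apply (ζ : HolCoord M n) (x : M) (φ : BergmanSpace M n) :
    evalCLM ζ x φ = φ.coeff ζ x := rfl

/-- By the locally uniform bound on evaluations, the coefficients of a Cauchy sequence converge
locally uniformly, hence to a holomorphic form. The limit in `L²` agrees with it almost everywhere,
by passing to a subsequence; so the limit form is square integrable and is the limit in norm. -/
instance : CompleteSpace (BergmanSpace M n) := by
  refine Metric.complete_of_cauchySeq_tendsto fun u hu => ?_
  have hex : ∀ ζ x, ∃ c, Tendsto (fun k => (u k).coeff ζ x) atTop (𝓝 c) := fun ζ x =>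
    cauchySeq_tendsto_of_complete (hu.map (evalCLM ζ x).uniformContinuous)
  choose φ hφ using hex
  have hhol : φ ∈ holForms M n := by
    refine ⟨fun ζ x hx => ?_, fun ζ η x hx hx' => ?_, fun ζ x hx => ?_⟩
    · obtain ⟨C, r, hr, hrt, hC⟩ := exists_norm_coeff_le ζ hx
      rw [ζ.isHolAt_iff_inv hx]
      have hunif : TendstoUniformlyOn (fun k p => (u k).coeff ζ (ζ.inv p))
          (fun p => φ ζ (ζ.inv p)) atTop (Metric.ball (ζ x) r) := by
        refine UniformCauchySeqOn.tendstoUniformlyOn_of_tendsto ?_ fun p _ => hφ ζ _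
        rw [Metric.uniformCauchySeqOn_iff]
        intro ε hε
        obtain ⟨N, hN⟩ := Metric.cauchySeq_iff.1 hu (ε / (|C| + 1)) (by positivity)
        refine ⟨N, fun k hk l hl p hp => ?_⟩
        have h1 := hC (u k - u l) p hp
        have h2 := hN k hk l hl
        rw [dist_eq_norm] at h2 ⊢
        rw [lt_div_iff₀ (by positivity)] at h2
        refine lt_of_le_of_lt h1 (lt_of_le_of_lt ?_ h2)
        rw [mul_comm]
        exact mul_le_mul_of_nonneg_left (by linarith [le_abs_self C]) (norm_nonneg _)
      refine analyticAt_of_differentiableOn Metric.isOpen_ball (fun p hp => ?_)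
        (Metric.mem_ball_self hr)
      obtain ⟨δ, hδ, hδr⟩ := Metric.isOpen_iff.1 Metric.isOpen_ball p hp
      refine DifferentiableAt.differentiableWithinAt
        (differentiableAt_of_tendstoUniformlyOn_ball hδ (fun k q hq => ?_) (hunif.mono hδr))
      have hqt := hrt (hδr hq)
      have := (ζ.isHolAt_iff_inv (ζ.inv_mem hqt)).1 ((u k).coeff_mem.1 ζ _ (ζ.inv_mem hqt))
      rw [ζ.apply_inv hqt] at this
      exact this.differentiableAt.differentiableWithinAt
    · refine tendsto_nhds_unique (hφ ζ x) ?_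
      refine ((hφ η x).mul_const _).congr fun k => ?_
      exact ((u k).coeff_mem.2.1 ζ η x hx hx').symm
    · refine tendsto_nhds_unique (hφ ζ x) ?_
      simp_rw [fun k => (u k).coeff_mem.2.2 ζ x hx]
      exact tendsto_const_nhds
  have hrep : ∀ t, Tendsto (fun k => coordRep (u k).coeff t) atTop (𝓝 (coordRep φ t)) := by
    intro t
    unfold coordRep
    cases coordCover M n t.1 with
    | none => exact tendsto_const_nhds
    | some ζ => exact hφ ζ _
  obtain ⟨f, hf⟩ := cauchySeq_tendsto_of_complete
    ((toLp M n).isometry.uniformContinuous.comp_cauchySeq hu)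
  obtain ⟨ns, hns, hae⟩ := (tendstoInMeasure_of_tendsto_Lp hf).exists_seq_tendsto_ae
  have hfφ : f =ᵐ[coordMeasure M n] coordRep φ := by
    filter_upwards [hae, ae_all_iff.2 fun k => (u k).toLp_ae_eq] with t h1 h2
    refine tendsto_nhds_unique h1 (((hrep t).comp hns.tendsto_atTop).congr fun i => ?_)
    exact (h2 (ns i)).symm
  let Φ : BergmanSpace M n := ⟨φ, hhol, (Lp.memLp f).ae_eq hfφ⟩
  have hΦ : toLp M n Φ = f := Lp.ext (Φ.toLp_ae_eq.trans hfφ.symm)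
  refine ⟨Φ, (toLp M n).isometry.isUniformInducing.isInducing.tendsto_nhds_iff.2 ?_⟩
  rw [hΦ]
  exact hf

/-- The form that represents the evaluation of the coefficient at a point. -/
noncomputable def kern (ζ : HolCoord M n) (x : M) : BergmanSpace M n :=
  (InnerProductSpace.toDual ℂ (BergmanSpace M n)).symm (evalCLM ζ x)

theorem inner_kern (ζ : HolCoord M n) (x : M) (φ : BergmanSpace M n) :
    inner ℂ (kern ζ x) φ = φ.coeff ζ x := by
  rw [kern, InnerProductSpace.toDual_symm_apply, evalCLM_apply]

/-- Parseval's identity for the two representing forms. The right side does not involve `S`, which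
is the independence of the basis. -/
theorem hasSum_coeff_mul_conj_coeff {S : Set (BergmanSpace M n)} (hS : IsBergmanBasis S)
    (ζ η : HolCoord M n) (x y : M) :
    HasSum (fun φ : S => φ.1.coeff ζ x * conj (φ.1.coeff η y))
      (inner ℂ (kern ζ x) (kern η y)) := by
  have hsp : (Submodule.span ℂ (range (Subtype.val : S → BergmanSpace M n)))ᗮ = ⊥ := by
    rw [Submodule.eq_bot_iff]
    intro ψ hψ
    refine hS.2 ψ fun φ hφ => ?_
    exact (Submodule.mem_orthogonal _ _).1 hψ φ (Submodule.subset_span ⟨⟨φ, hφ⟩, rfl⟩)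
  have h := (HilbertBasis.mkOfOrthogonalEqBot hS.1 hsp).hasSum_inner_mul_inner (kern ζ x)
    (kern η y)
  simp only [HilbertBasis.coe_mkOfOrthogonalEqBot, inner_kern] at h
  rw [inner_kern ζ x (kern η y)]
  refine h.congr_fun fun φ => ?_
  rw [← inner_conj_symm φ.1 (kern η y), inner_kern]

end BergmanSpace

open BergmanSpace in
theorem bergmanKernel_eq (ζ η : HolCoord M n) (x y : M) : bergmanKernel M n ζ η x y =
    Complex.I ^ (n ^ 2) * inner ℂ (kern ζ x) (kern η y) := by
  rw [bergmanKernel, (hasSum_coeff_mul_conj_coeff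
    (Classical.choose_spec (exists_isBergmanBasis M n)) ζ η x y).tsum_eq]

theorem bergmanKernelWellDefined (M : Type*) [TopologicalSpace M] [SecondCountableTopology M]
    [ReducedComplexSpace M] (n : ℕ) : BergmanKernelWellDefined M n := by
  intro S hS ζ η x _ y _
  rw [bergmanKernel_eq]
  exact (BergmanSpace.hasSum_coeff_mul_conj_coeff hS ζ η x y).mul_left _

end Bergman

/-! ## Extension of square integrable forms across a subvariety -/

/-- Identity theorem on a ball: vanishing near one of its points would force vanishing near the
centre. -/
theorem eventually_frequently_ne_zero {E : Type*} [NormedAddCommGroup E] [NormedSpace ℂ E]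
    {g : E → ℂ} {a : E} {W : Set E} (hW : IsOpen W) (ha : a ∈ W) (hg : AnalyticOnNhd ℂ g W)
    (hg0 : ¬ ∀ᶠ x in 𝓝 a, g x = 0) : ∀ᶠ p in 𝓝 a, ∃ᶠ q in 𝓝 p, g q ≠ 0 := by
  obtain ⟨ε, hε, hεW⟩ := Metric.isOpen_iff.1 hW a ha
  filter_upwards [Metric.ball_mem_nhds a hε] with p hp H
  have h1 : g =ᶠ[𝓝 p] 0 := H.mono fun q hq => not_not.1 hq
  have h2 := (hg.mono hεW).eqOn_zero_of_preconnected_of_eventuallyEq_zero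
    (convex_ball a ε).isPreconnected hp h1
  exact hg0 (by filter_upwards [Metric.ball_mem_nhds a hε] with q hq using h2 hq)

section Extension

variable {M : Type*} [TopologicalSpace M] [ReducedComplexSpace M] {n : ℕ}

/-- In coordinates at a point of the closure of its complement, a subvariety lies in the zero set
of a holomorphic function that does not vanish identically. -/
theorem AnalyticSubvariety.exists_zeros (V : AnalyticSubvariety M) (ζ : HolCoord M n) {x : M}
    (hζ : x ∈ ζ.source) (hx : x ∈ closure V.compl) :
    ∃ (W : Set (Fin n → ℂ)) (g : (Fin n → ℂ) → ℂ), IsOpen W ∧ ζ x ∈ W ∧ W ⊆ ζ.target ∧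
      AnalyticOnNhd ℂ g W ∧ (¬ ∀ᶠ p in 𝓝 (ζ x), g p = 0) ∧
      ∀ p ∈ W, g p ≠ 0 → ζ.inv p ∈ V.compl := by
  obtain ⟨O, k, h, hO, hxO, hh, hiff⟩ := V.locally_zeros x
  have hW : IsOpen (ζ.target ∩ ζ.inv ⁻¹' O) :=
    ζ.toOpenPartialHomeomorph.symm.isOpen_inter_preimage hO
  have hana : ∀ i, AnalyticOnNhd ℂ (fun p => h i (ζ.inv p)) (ζ.target ∩ ζ.inv ⁻¹' O) := by
    rintro i p ⟨hp, hpO⟩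
    have := (ζ.isHolAt_iff_inv (ζ.inv_mem hp)).1 (hh i _ hpO)
    rwa [ζ.apply_inv hp] at this
  -- If all local equations vanished near `x`, a neighbourhood of `x` would lie in `V`.
  have hex : ∃ i, ¬ ∀ᶠ p in 𝓝 (ζ x), h i (ζ.inv p) = 0 := by
    by_contra! H
    have h1 : ∀ᶠ y in 𝓝 x, ∀ i, h i y = 0 := by
      filter_upwards [(ζ.continuousAt_apply hζ).eventually (eventually_all.2 H),
        ζ.open_source.mem_nhds hζ] with y hy hyζ i
      have := hy i
      rwa [ζ.inv_apply hyζ] at this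
    obtain ⟨y, hy, hyV⟩ := (mem_closure_iff_frequently.1 hx).and_eventually
      (h1.and (hO.mem_nhds hxO)) |>.exists
    exact hy ((hiff y hyV.2).2 hyV.1)
  obtain ⟨i, hi⟩ := hex
  refine ⟨_, fun p => h i (ζ.inv p), hW, ⟨ζ.apply_mem hζ, ?_⟩, inter_subset_left, hana i, hi, ?_⟩
  · rwa [mem_preimage, ζ.inv_apply hζ]
  · rintro p ⟨hp, hpO⟩ hne hV
    exact hne ((hiff _ hpO).1 hV i)

/-- Near such a point `V` lies in the zero set of a function that vanishes on no open set. So within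
the regular part the closure of the complement is open as well as closed, and extending forms by
zero off this closure creates no new singularities. -/
theorem AnalyticSubvariety.eventually_mem_closure_compl (V : AnalyticSubvariety M)
    (ζ : HolCoord M n) {x : M} (hζ : x ∈ ζ.source) (hx : x ∈ closure V.compl) :
    ∀ᶠ y in 𝓝 x, y ∈ closure V.compl := by
  obtain ⟨W, g, hW, hxW, hWt, hg, hg0, hgV⟩ := V.exists_zeros ζ hζ hx
  filter_upwards [(ζ.continuousAt_apply hζ).eventually (eventually_frequently_ne_zero hW hxW hg hg0),
    (ζ.continuousAt_apply hζ).eventually (hW.mem_nhds hxW), ζ.open_source.mem_nhds hζ]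
    with y hy hyW hyζ
  rw [mem_closure_iff_frequently]
  refine (ζ.tendsto_inv hyζ).frequently ?_
  exact (hy.and_eventually (hW.mem_nhds hyW)).mono fun p hp => hgV p hp.2 hp.1

open Classical in
/-- The continuous extension of a form on `U` to the closure of `U`, by zero on the exterior. -/
noncomputable def extForm (U : Set M) (φ : HolCoord M n → M → ℂ) : HolCoord M n → M → ℂ :=
  fun ζ x => if x ∈ ζ.source ∧ x ∈ closure U then limUnder (𝓝[U] x) (φ ζ) else 0

theorem extForm_eq_zero {U : Set M} {φ : HolCoord M n → M → ℂ} {ζ : HolCoord M n} {x : M}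
    (hx : x ∉ closure U) : extForm U φ ζ x = 0 := if_neg fun h => hx h.2

theorem aestronglyMeasurable_coordRep [SecondCountableTopology M] {φ : HolCoord M n → M → ℂ} (hφ : φ ∈ holForms M n) :
    AEStronglyMeasurable (coordRep φ) (coordMeasure M n) := by
  refine AEMeasurable.aestronglyMeasurable ?_
  rw [coordMeasure, aemeasurable_sum_measure_iff]
  intro j
  refine AEMeasurable.smul_measure ?_ _
  rw [(measurableEmbedding_prodMk_left j).aemeasurable_map_iff]
  rcases hj : coordCover M n j with _ | ζ
  · rw [coordPiece_eq_empty hj]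
    simp
  · have h1 : coordRep φ ∘ (fun p => (j, p)) = fun p => φ ζ (ζ.inv p) := by
      funext p
      simp [coordRep, hj]
    change AEMeasurable (coordRep φ ∘ fun p => (j, p)) _
    rw [h1]
    have h2 : ContinuousOn (fun p => φ ζ (ζ.inv p)) ζ.target := by
      intro p hp
      have := (ζ.isHolAt_iff_inv (ζ.inv_mem hp)).1 (hφ.1 ζ _ (ζ.inv_mem hp))
      rw [ζ.apply_inv hp] at this
      exact this.continuousAt.continuousWithinAt
    refine (h2.aemeasurable ζ.open_target.measurableSet).mono_measure
      (Measure.restrict_mono ?_ le_rfl)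
    rw [coordPiece_eq hj]
    exact inter_subset_left

variable [SecondCountableTopology M] [MeasurableSpace M] [BorelSpace M]

/-- The local extension theorem, with `V` replaced by the larger zero set of one function `g` from
`exists_zeros`. The same `F` serves on the complement and for the limits that define `extForm`. -/
theorem AnalyticSubvariety.exists_analyticAt_extension (V : AnalyticSubvariety M)
    {φ : HolCoord M n → M → ℂ} (hφ : IsFormOn V.compl φ) (hfin : formMeasure φ V.compl ≠ ∞)
    (ζ : HolCoord M n) {x : M} (hζ : x ∈ ζ.source) (hx : x ∈ closure V.compl) :
    ∃ F : (Fin n → ℂ) → ℂ, AnalyticAt ℂ F (ζ x) ∧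
      (∀ᶠ y in 𝓝 x, y ∈ V.compl → φ ζ y = F (ζ y)) ∧
      ∀ᶠ y in 𝓝 x, extForm V.compl φ ζ y = F (ζ y) := by
  obtain ⟨W, g, hW, hxW, hWt, hg, hg0, hgV⟩ := V.exists_zeros ζ hζ hx
  have hana : ∀ p ∈ ζ.target, ζ.inv p ∈ V.compl →
      AnalyticAt ℂ (fun p => φ ζ (ζ.inv p)) p := by
    intro p hp hpU
    have := (ζ.isHolAt_iff_inv (ζ.inv_mem hp)).1 (hφ.isHolAt ζ _ hpU (ζ.inv_mem hp))
    rwa [ζ.apply_inv hp] at this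
  have hm : MeasurableSet (V.compl ∩ ζ.source) :=
    (V.isOpen_compl.inter ζ.open_source).measurableSet
  have hI : ∫⁻ p in {p ∈ W | g p ≠ 0}, ‖φ ζ (ζ.inv p)‖ₑ ^ 2 ≠ ∞ := by
    refine ne_top_of_le_ne_top hfin ?_
    calc ∫⁻ p in {p ∈ W | g p ≠ 0}, ‖φ ζ (ζ.inv p)‖ₑ ^ 2
        ≤ ∫⁻ p in ζ.target ∩ ζ.inv ⁻¹' (V.compl ∩ ζ.source), ‖φ ζ (ζ.inv p)‖ₑ ^ 2 :=
          lintegral_mono_set fun p hp =>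
            ⟨hWt hp.1, hgV p hp.1 hp.2, ζ.inv_mem (hWt hp.1)⟩
      _ ≤ 2 ^ n * ∫⁻ p in ζ.target ∩ ζ.inv ⁻¹' (V.compl ∩ ζ.source), ‖φ ζ (ζ.inv p)‖ₑ ^ 2 :=
          le_mul_of_one_le_left zero_le (one_le_pow_of_one_le' one_le_two n)
      _ = formMeasure φ (V.compl ∩ ζ.source) := by
          rw [formMeasure_apply _ hφ hm inter_subset_left inter_subset_right,
            coordDensity_apply _ _ hm]
      _ ≤ formMeasure φ V.compl := measure_mono inter_subset_left
  obtain ⟨F, hF, hFg⟩ := exists_analyticAt_extension_of_lintegral_lt_top volume hW hxW hg hg0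
    (fun p hp => (hana p (hWt hp.1) (hgV p hp.1 hp.2)).differentiableAt.differentiableWithinAt) hI
  -- So far the equality holds only where `g ≠ 0`. Points of the complement of `V` with `g = 0` are
  -- limits of such points, and both sides are continuous there.
  have hU : ∀ᶠ y in 𝓝 x, y ∈ V.compl → φ ζ y = F (ζ y) := by
    filter_upwards [(ζ.continuousAt_apply hζ).eventually
      (eventually_frequently_ne_zero hW hxW hg hg0),
      (ζ.continuousAt_apply hζ).eventually hFg.eventually_nhds,
      (ζ.continuousAt_apply hζ).eventually hF.eventually_analyticAt,
      ζ.open_source.mem_nhds hζ] with y hy hyF hyA hyζ hyU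
    have hc : ContinuousAt (fun p => φ ζ (ζ.inv p) - F p) (ζ y) :=
      (hana _ (ζ.apply_mem hyζ) (by rwa [ζ.inv_apply hyζ])).continuousAt.sub hyA.continuousAt
    have h1 : ∃ᶠ p in 𝓝 (ζ y), φ ζ (ζ.inv p) - F p ∈ ({0} : Set ℂ) :=
      (hy.and_eventually hyF).mono fun p hp => sub_eq_zero.2 (hp.2 hp.1)
    have h2 := isClosed_singleton.mem_of_frequently_of_tendsto h1 hc
    have h3 : φ ζ (ζ.inv (ζ y)) - F (ζ y) = 0 := h2
    rw [ζ.inv_apply hyζ] at h3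
    exact sub_eq_zero.1 h3
  refine ⟨F, hF, hU, ?_⟩
  filter_upwards [hU.eventually_nhds, (ζ.continuousAt_apply hζ).eventually hF.eventually_analyticAt,
    ζ.open_source.mem_nhds hζ, V.eventually_mem_closure_compl ζ hζ hx] with y hy hyA hyζ hyc
  rw [extForm, if_pos ⟨hyζ, hyc⟩]
  have : NeBot (𝓝[V.compl] y) := mem_closure_iff_nhdsWithin_neBot.1 hyc
  refine Tendsto.limUnder_eq ?_
  have h1 : Tendsto (fun z => F (ζ z)) (𝓝[V.compl] y) (𝓝 (F (ζ y))) :=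
    (ContinuousAt.comp (f := ζ) (g := F) hyA.continuousAt
      (ζ.continuousAt_apply hyζ)).mono_left nhdsWithin_le_nhds
  refine h1.congr' ?_
  filter_upwards [nhdsWithin_le_nhds hy, self_mem_nhdsWithin] with z hz hzU
  exact (hz hzU).symm

theorem AnalyticSubvariety.extForm_eq (V : AnalyticSubvariety M)
    {φ : HolCoord M n → M → ℂ} (hφ : IsFormOn V.compl φ) (hfin : formMeasure φ V.compl ≠ ∞)
    (ζ : HolCoord M n) {x : M} (hζ : x ∈ ζ.source) (hx : x ∈ V.compl) :
    extForm V.compl φ ζ x = φ ζ x := by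
  obtain ⟨F, -, h1, h2⟩ := V.exists_analyticAt_extension hφ hfin ζ hζ (subset_closure hx)
  rw [h1.self_of_nhds hx, h2.self_of_nhds]

/-- On the closure of the complement the transformation law passes to the limit by continuity; off
the closure the coefficients vanish locally. -/
theorem AnalyticSubvariety.extForm_mem_holForms (V : AnalyticSubvariety M)
    {φ : HolCoord M n → M → ℂ} (hφ : IsFormOn V.compl φ) (hfin : formMeasure φ V.compl ≠ ∞) :
    extForm V.compl φ ∈ holForms M n := by
  refine ⟨fun ζ x hζ => ?_, fun ζ η x hζ hη => ?_, fun ζ x hζ => if_neg fun h => hζ h.1⟩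
  · by_cases hx : x ∈ closure V.compl
    · obtain ⟨F, hF, -, h2⟩ := V.exists_analyticAt_extension hφ hfin ζ hζ hx
      exact (isHolAt_congr h2).2 (ζ.isHolAt_comp_apply hζ hF)
    · have h0 : extForm V.compl φ ζ =ᶠ[𝓝 x] fun _ => 0 := by
        filter_upwards [isClosed_closure.isOpen_compl.mem_nhds hx] with y hy
        exact extForm_eq_zero hy
      exact (isHolAt_congr h0).2 ((ζ.isHolAt_iff_inv hζ).2 analyticAt_const)
  · by_cases hx : x ∈ closure V.compl
    · obtain ⟨F, hF, h1, h2⟩ := V.exists_analyticAt_extension hφ hfin ζ hζ hx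
      obtain ⟨G, hG, k1, k2⟩ := V.exists_analyticAt_extension hφ hfin η hη hx
      have : NeBot (𝓝[V.compl] x) := mem_closure_iff_nhdsWithin_neBot.1 hx
      rw [h2.self_of_nhds, k2.self_of_nhds]
      have hFc : ContinuousAt (fun y => F (ζ y)) x :=
        ContinuousAt.comp (f := ζ) (g := F) hF.continuousAt (ζ.continuousAt_apply hζ)
      have hGc : ContinuousAt (fun y => G (η y)) x :=
        ContinuousAt.comp (f := η) (g := G) hG.continuousAt (η.continuousAt_apply hη)
      have hJc : ContinuousAt (fun y => ζ.transJac η y) x :=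
        ReducedComplexSpace.continuousAt (isHolAt_mapJac (g := id)
          (Eventually.of_forall isHolMapAt_id) hζ hη)
      refine tendsto_nhds_unique (hFc.mono_left (nhdsWithin_le_nhds (s := V.compl)))
        (Tendsto.congr' ?_ ((hGc.mul hJc).mono_left nhdsWithin_le_nhds))
      filter_upwards [nhdsWithin_le_nhds h1, nhdsWithin_le_nhds k1, self_mem_nhdsWithin,
        nhdsWithin_le_nhds (ζ.open_source.mem_nhds hζ),
        nhdsWithin_le_nhds (η.open_source.mem_nhds hη)] with y hy1 hy2 hyU hyζ hyη
      change G (η y) * ζ.transJac η y = F (ζ y)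
      rw [← hy1 hyU, ← hy2 hyU]
      exact (hφ.trans ζ η y hyU hyζ hyη).symm
    · rw [extForm_eq_zero hx, extForm_eq_zero hx, zero_mul]

/-- In coordinates this set lies locally in the zero set of a function that does not vanish
identically, which is a null set; so extension does not change the norm. -/
theorem AnalyticSubvariety.formMeasure_frontier (V : AnalyticSubvariety M)
    (ψ : HolCoord M n → M → ℂ) : formMeasure ψ (closure V.compl \ V.compl) = 0 := by
  have hm : MeasurableSet (closure V.compl \ V.compl) :=
    isClosed_closure.measurableSet.diff V.isOpen_compl.measurableSet
  rw [formMeasure, Measure.sum_apply _ hm, ENNReal.tsum_eq_zero]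
  intro j
  rcases coordCover M n j with _ | ζ
  · simp
  simp only [Option.elim_some]
  refine measure_mono_null (Subset.rfl) (le_antisymm ((Measure.restrict_apply_le _ _).trans ?_)
    zero_le)
  rw [coordDensity_apply _ _ hm, nonpos_iff_eq_zero]
  refine mul_eq_zero_of_right _ (setLIntegral_measure_zero _ _ ?_)
  refine measure_null_of_locally_null _ ?_
  rintro p ⟨hp, hpc, hpV⟩
  have hpζ := ζ.inv_mem hp
  obtain ⟨W, g, hW, hxW, hWt, hg, hg0, hgV⟩ := V.exists_zeros ζ hpζ hpc
  obtain ⟨ε, hε, hz⟩ := exists_ball_measure_zeros_eq_zero volume hW hxW hg hg0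
  rw [ζ.apply_inv hp] at hxW hz
  refine ⟨(Metric.ball p ε ∩ W) ∩ (ζ.target ∩ ζ.inv ⁻¹' (closure V.compl \ V.compl)),
    inter_mem (mem_nhdsWithin_of_mem_nhds (inter_mem (Metric.ball_mem_nhds p hε)
      (hW.mem_nhds hxW))) self_mem_nhdsWithin, measure_mono_null ?_ hz⟩
  rintro q ⟨⟨hqb, hqW⟩, -, -, hqV⟩
  exact ⟨hqb, hqW, by_contra fun h => hqV (hgV q hqW h)⟩

theorem mem_bergmanSubmodule {φ : HolCoord M n → M → ℂ} (hφ : φ ∈ holForms M n)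
    (hfin : formMeasure φ univ ≠ ∞) : φ ∈ bergmanSubmodule M n := by
  refine ⟨hφ, aestronglyMeasurable_coordRep hφ, ?_⟩
  rw [formMeasure_univ] at hfin
  rw [eLpNorm_eq_lintegral_rpow_enorm_toReal (by norm_num) (by norm_num)]
  simp only [ENNReal.toReal_ofNat, ENNReal.rpow_ofNat, one_div]
  exact ENNReal.rpow_lt_top_of_nonneg (by norm_num) hfin

/-- Square integrable forms on the complement of a subvariety extend. -/
theorem AnalyticSubvariety.exists_extension (V : AnalyticSubvariety M)
    {φ : HolCoord M n → M → ℂ} (hφ : IsFormOn V.compl φ) (hfin : formMeasure φ V.compl ≠ ∞) :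
    ∃ Φ : BergmanSpace M n, (∀ ζ, ∀ x ∈ V.compl, x ∈ ζ.source → Φ.coeff ζ x = φ ζ x) ∧
      (∀ ζ, ∀ x ∉ closure V.compl, Φ.coeff ζ x = 0) ∧ ‖Φ‖ₑ ^ 2 = formMeasure φ V.compl := by
  have hmU := V.isOpen_compl.measurableSet
  have hmc : MeasurableSet (closure V.compl) := isClosed_closure.measurableSet
  have hhol := V.extForm_mem_holForms hφ hfin
  have hmeas : formMeasure (extForm V.compl φ) univ = formMeasure φ V.compl := by
    have h0 : formMeasure (extForm V.compl φ) (closure V.compl)ᶜ = 0 := by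
      rw [formMeasure_congr (ψ := 0) hmc.compl fun ζ x hx _ => extForm_eq_zero hx]
      rw [formMeasure, Measure.sum_apply _ hmc.compl, ENNReal.tsum_eq_zero]
      intro j
      rcases coordCover M n j with _ | ζ
      · simp
      · simp only [Option.elim_some]
        refine le_antisymm ((Measure.restrict_apply_le _ _).trans ?_) zero_le
        rw [coordDensity_apply _ _ hmc.compl]
        simp
    rw [← measure_add_measure_compl hmc, h0, add_zero,
      ← measure_inter_add_sdiff (closure V.compl) hmU, inter_eq_right.2 subset_closure,
      V.formMeasure_frontier, add_zero]
    exact formMeasure_congr hmU fun ζ x hx hζ => V.extForm_eq hφ hfin ζ hζ hx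
  let Φ : BergmanSpace M n := ⟨_, mem_bergmanSubmodule hhol (by rwa [hmeas])⟩
  refine ⟨Φ,
    fun ζ x hx hζ => V.extForm_eq hφ hfin ζ hζ hx, fun ζ x hx => extForm_eq_zero hx, ?_⟩
  exact (BergmanSpace.formMeasure_univ_eq Φ).symm.trans hmeas

end Extension

/-! ### Forms vanishing off the closure of an open set: uniqueness and orthogonality -/

section Uniqueness

variable {M : Type*} [TopologicalSpace M] [SecondCountableTopology M] [ReducedComplexSpace M]
  {n : ℕ}

namespace BergmanSpace

theorem coeff_eq_zero_of_mem_closure {φ : BergmanSpace M n} {U : Set M}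
    (h : ∀ ζ, ∀ x ∈ U, x ∈ ζ.source → φ.coeff ζ x = 0) {ζ : HolCoord M n} {x : M}
    (hx : x ∈ closure U) : φ.coeff ζ x = 0 := by
  by_cases hζ : x ∈ ζ.source
  swap
  · exact φ.coeff_mem.2.2 ζ x hζ
  have hc := ReducedComplexSpace.continuousAt (φ.coeff_mem.1 ζ x hζ)
  refine isClosed_singleton.mem_of_frequently_of_tendsto (s := {(0 : ℂ)}) ?_ hc
  exact ((mem_closure_iff_frequently.1 hx).and_eventually (ζ.open_source.mem_nhds hζ)).mono
    fun y hy => h ζ y hy.1 hy.2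

/-- Forms that vanish outside of the closure of `U` are determined by their values on `U`. -/
theorem eq_of_eqOn {φ ψ : BergmanSpace M n} {U : Set M}
    (h : ∀ ζ, ∀ x ∈ U, x ∈ ζ.source → φ.coeff ζ x = ψ.coeff ζ x)
    (hφ : ∀ ζ, ∀ x ∉ closure U, φ.coeff ζ x = 0) (hψ : ∀ ζ, ∀ x ∉ closure U, ψ.coeff ζ x = 0) :
    φ = ψ := by
  refine ext_coeff (funext fun ζ => funext fun x => ?_)
  by_cases hx : x ∈ closure U
  · refine sub_eq_zero.1 (coeff_eq_zero_of_mem_closure (φ := φ - ψ) (fun ζ x hx hζ => ?_) hx)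
    exact sub_eq_zero.2 (h ζ x hx hζ)
  · rw [hφ ζ x hx, hψ ζ x hx]

/-- A form that vanishes outside of the closure of `U` is orthogonal to the forms that vanish
on `U`. -/
theorem inner_eq_zero_of_eqOn_zero {φ ψ : BergmanSpace M n} {U : Set M}
    (hφ : ∀ ζ, ∀ x ∉ closure U, φ.coeff ζ x = 0)
    (hψ : ∀ ζ, ∀ x ∈ U, x ∈ ζ.source → ψ.coeff ζ x = 0) : inner ℂ φ ψ = 0 := by
  rw [inner_eq]
  refine integral_eq_zero_of_ae (Eventually.of_forall fun t => ?_)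
  rcases hj : coordCover M n t.1 with _ | ζ
  · simp [coordRep, hj]
  · simp only [coordRep, hj, Option.elim_some, Pi.zero_apply]
    by_cases hx : ζ.inv t.2 ∈ closure U
    · rw [coeff_eq_zero_of_mem_closure hψ hx, zero_mul]
    · rw [hφ ζ _ hx, map_zero, mul_zero]

end BergmanSpace

end Uniqueness

/-- Polarization. The common source needs no inner product of its own. -/
theorem inner_map_map_of_norm_sq_eq {E E₁ E₂ : Type*} [NormedAddCommGroup E] [Module ℂ E]
    [NormedAddCommGroup E₁] [InnerProductSpace ℂ E₁] [NormedAddCommGroup E₂]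
    [InnerProductSpace ℂ E₂] (A : E →ₗ[ℂ] E₁) (B : E →ₗ[ℂ] E₂) {k : ℝ}
    (h : ∀ x, ‖A x‖ ^ 2 = k * ‖B x‖ ^ 2) (x y : E) :
    inner ℂ (A x) (A y) = k * inner ℂ (B x) (B y) := by
  have h1 := h (x + y)
  have h2 := h (x - y)
  have h3 := h (x - Complex.I • y)
  have h4 := h (x + Complex.I • y)
  simp only [map_add, map_sub, map_smul] at h1 h2 h3 h4
  rw [inner_eq_sum_norm_sq_div_four, inner_eq_sum_norm_sq_div_four]
  change ((‖A x + A y‖ : ℂ) ^ 2 - (‖A x - A y‖ : ℂ) ^ 2 + ((‖A x - Complex.I • A y‖ : ℂ) ^ 2 -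
      (‖A x + Complex.I • A y‖ : ℂ) ^ 2) * Complex.I) / 4 =
    k * (((‖B x + B y‖ : ℂ) ^ 2 - (‖B x - B y‖ : ℂ) ^ 2 + ((‖B x - Complex.I • B y‖ : ℂ) ^ 2 -
      (‖B x + Complex.I • B y‖ : ℂ) ^ 2) * Complex.I) / 4)
  have e1 := congrArg ((↑) : ℝ → ℂ) h1
  have e2 := congrArg ((↑) : ℝ → ℂ) h2
  have e3 := congrArg ((↑) : ℝ → ℂ) h3
  have e4 := congrArg ((↑) : ℝ → ℂ) h4
  push_cast at e1 e2 e3 e4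
  rw [e1, e2, e3, e4]
  ring

/-! ### Pull-back operators between Bergman spaces -/

section Pull

variable {M : Type*} [TopologicalSpace M] [SecondCountableTopology M] [ReducedComplexSpace M]
  {M' : Type*} [TopologicalSpace M'] [SecondCountableTopology M'] [ReducedComplexSpace M']
  {n : ℕ}

/-- `G` is the pull-back of forms by the map `g`, which is defined on `U`; the forms are extended by
zero to the exterior of `U`. -/
structure IsPull (g : M → M') (U : Set M) (G : BergmanSpace M' n →ₗ[ℂ] BergmanSpace M n) :
    Prop where
  coeff_eq : ∀ φ (ζ : HolCoord M n) (α : HolCoord M' n), ∀ x ∈ U, x ∈ ζ.source → g x ∈ α.source →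
    (G φ).coeff ζ x = φ.coeff α (g x) * mapJac g ζ α x
  coeff_eq_zero : ∀ φ ζ, ∀ x ∉ closure U, (G φ).coeff ζ x = 0

/-- The pulled back form has `k` times the integral, hence finite norm, and extends across `V`. The
extension is determined by its values on the complement, which makes the construction linear. -/
theorem IsSheeted.exists_isPull [MeasurableSpace M] [BorelSpace M] [MeasurableSpace M']
    [BorelSpace M'] {V : AnalyticSubvariety M} {U' : Set M'} {g : M → M'}
    {k : ℕ} (hg : IsSheeted g V.compl U' k) (hreg : ∀ x ∈ V.compl, IsRegularPt n x)
    (hreg' : ∀ y ∈ U', IsRegularPt n y) :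
    ∃ G : BergmanSpace M' n →ₗ[ℂ] BergmanSpace M n, IsPull g V.compl G ∧
      ∀ φ, ‖G φ‖ₑ ^ 2 = k * formMeasure φ.coeff U' := by
  have hmeas : ∀ φ : BergmanSpace M' n,
      formMeasure (pullForm g V.compl φ.coeff) V.compl = k * formMeasure φ.coeff U' := fun φ =>
    hg.formMeasure_pullForm hreg hreg' (φ.isFormOn U')
  have hfin : ∀ φ : BergmanSpace M' n,
      formMeasure (pullForm g V.compl φ.coeff) V.compl ≠ ∞ := fun φ => by
    rw [hmeas]
    refine ENNReal.mul_ne_top (ENNReal.natCast_ne_top k)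
      (ne_top_of_le_ne_top ?_ (measure_mono (subset_univ _)))
    rw [φ.formMeasure_univ_eq]
    simp
  choose G h1 h2 h3 using fun φ : BergmanSpace M' n =>
    V.exists_extension (isFormOn_pullForm hg hreg' (φ.isFormOn U')) (hfin φ)
  have h4 : ∀ φ (ζ : HolCoord M n) (α : HolCoord M' n), ∀ x ∈ V.compl, x ∈ ζ.source →
      g x ∈ α.source → (G φ).coeff ζ x = φ.coeff α (g x) * mapJac g ζ α x :=
    fun φ ζ α x hx hζ hα => by rw [h1 φ ζ x hx hζ, pullForm_eq hg (φ.isFormOn U') hx hζ hα]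
  refine ⟨{ toFun := G, map_add' := fun φ ψ => ?_, map_smul' := fun c φ => ?_ },
    ⟨h4, h2⟩, fun φ => by rw [← hmeas, ← h3]; rfl⟩
  · refine BergmanSpace.eq_of_eqOn (U := V.compl) (fun ζ x hx hζ => ?_) (h2 _) fun ζ x hx => ?_
    · obtain ⟨α, hα⟩ := hreg' _ (hg.mapsTo hx)
      change _ = (G φ).coeff ζ x + (G ψ).coeff ζ x
      rw [h4 _ ζ α x hx hζ hα, h4 φ ζ α x hx hζ hα, h4 ψ ζ α x hx hζ hα, ← add_mul]
      rfl
    · change (G φ).coeff ζ x + (G ψ).coeff ζ x = 0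
      rw [h2 φ ζ x hx, h2 ψ ζ x hx, add_zero]
  · refine BergmanSpace.eq_of_eqOn (U := V.compl) (fun ζ x hx hζ => ?_) (h2 _) fun ζ x hx => ?_
    · obtain ⟨α, hα⟩ := hreg' _ (hg.mapsTo hx)
      change _ = c * (G φ).coeff ζ x
      rw [h4 _ ζ α x hx hζ hα, h4 φ ζ α x hx hζ hα, ← mul_assoc]
      rfl
    · change c * (G φ).coeff ζ x = 0
      rw [h2 φ ζ x hx, mul_zero]

end Pull

/-! ### Functoriality of pull-backs, projections, and descent of invariant forms -/

section PullAlgebra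

variable {M : Type*} [TopologicalSpace M] [SecondCountableTopology M] [ReducedComplexSpace M]
  {M' : Type*} [TopologicalSpace M'] [SecondCountableTopology M'] [ReducedComplexSpace M']
  {M'' : Type*} [TopologicalSpace M''] [SecondCountableTopology M''] [ReducedComplexSpace M'']
  {n : ℕ}

namespace IsPull

variable {U : Set M} {U' : Set M'} {U'' : Set M''}

/-- The chain rule on `U`, where the inner pull-back needs to be known only on `U'`. Both sides
vanish off the closure of `U`, so agreement on `U` suffices. -/
theorem comp_apply {k k' : ℕ} {g : M → M'} {g' : M' → M''} {g'' : M → M''}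
    {G : BergmanSpace M' n →ₗ[ℂ] BergmanSpace M n}
    {G' : BergmanSpace M'' n →ₗ[ℂ] BergmanSpace M' n}
    {G'' : BergmanSpace M'' n →ₗ[ℂ] BergmanSpace M n} (hG : IsPull g U G) (hG' : IsPull g' U' G')
    (hG'' : IsPull g'' U G'') (hg : IsSheeted g U U' k) (hg' : IsSheeted g' U' U'' k')
    (hreg' : ∀ y ∈ U', IsRegularPt n y) (hreg'' : ∀ y ∈ U'', IsRegularPt n y)
    (h : EqOn g'' (g' ∘ g) U) (φ : BergmanSpace M'' n) : G (G' φ) = G'' φ := by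
  refine BergmanSpace.eq_of_eqOn (fun ζ x hx hζ => ?_) (hG.coeff_eq_zero _) (hG''.coeff_eq_zero _)
  obtain ⟨α, hα⟩ := hreg' _ (hg.mapsTo hx)
  obtain ⟨β, hβ⟩ := hreg'' _ (hg'.mapsTo (hg.mapsTo hx))
  have hE : g'' =ᶠ[𝓝 x] g' ∘ g := h.eventuallyEq_of_mem (hg.isOpen.mem_nhds hx)
  rw [hG.coeff_eq _ ζ α x hx hζ hα, hG'.coeff_eq _ α β _ (hg.mapsTo hx) hα hβ,
    hG''.coeff_eq _ ζ β x hx hζ (by rwa [h hx]), mapJac_congr hE hζ, h hx,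
    mapJac_comp (hg.isHolMapAt hx) (hg'.isHolMapAt (hg.mapsTo hx)) hζ hα hβ]
  simp only [Function.comp_apply]
  ring

/-- Together with `inner_id_apply`, this says that pull-back by the identity is the orthogonal
projection onto the forms vanishing off the closure of `U`. -/
theorem id_apply_eq {P : BergmanSpace M n →ₗ[ℂ] BergmanSpace M n} (hP : IsPull id U P)
    {φ : BergmanSpace M n} (hφ : ∀ ζ, ∀ x ∉ closure U, φ.coeff ζ x = 0) : P φ = φ := by
  refine BergmanSpace.eq_of_eqOn (fun ζ x hx hζ => ?_) (hP.coeff_eq_zero _) hφ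
  rw [hP.coeff_eq _ ζ ζ x hx hζ hζ, mapJac_id, ζ.transJac_self hζ, mul_one, id]

theorem inner_id_apply {P : BergmanSpace M n →ₗ[ℂ] BergmanSpace M n} (hP : IsPull id U P)
    {φ : BergmanSpace M n} (hφ : ∀ ζ, ∀ x ∉ closure U, φ.coeff ζ x = 0) (ψ : BergmanSpace M n) :
    inner ℂ φ (P ψ) = inner ℂ φ ψ := by
  rw [← sub_eq_zero, ← inner_sub_right]
  refine BergmanSpace.inner_eq_zero_of_eqOn_zero hφ fun ζ x hx hζ => ?_
  rw [BergmanSpace.coeff_sub, Pi.sub_apply, Pi.sub_apply, hP.coeff_eq _ ζ ζ x hx hζ hζ, mapJac_id, ζ.transJac_self hζ, mul_one,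
    id, sub_self]

end IsPull

/-- Invariant square integrable forms are pull-backs. -/
theorem IsSheeted.exists_isPull_apply_eq [MeasurableSpace M] [BorelSpace M] [MeasurableSpace M']
    [BorelSpace M'] {U : Set M} {V' : AnalyticSubvariety M'} {g : M → M'} {k : ℕ}
    (hg : IsSheeted g U V'.compl k) (hk : k ≠ 0) (hreg : ∀ x ∈ U, IsRegularPt n x)
    (hreg' : ∀ y ∈ V'.compl, IsRegularPt n y) {G : BergmanSpace M' n →ₗ[ℂ] BergmanSpace M n}
    (hG : IsPull g U G) {χ : BergmanSpace M n}
    (hχ : ∀ ζ, ∀ x ∉ closure U, χ.coeff ζ x = 0)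
    (hinv : ∀ x ∈ U, ∀ x' ∈ U, g x = g x' → ∀ (ζ ζ' : HolCoord M n) (α : HolCoord M' n),
      x ∈ ζ.source → x' ∈ ζ'.source → g x ∈ α.source →
      χ.coeff ζ x * mapJac g ζ' α x' = χ.coeff ζ' x' * mapJac g ζ α x) :
    ∃ φ, G φ = χ ∧ ∀ α, ∀ y ∉ closure V'.compl, φ.coeff α y = 0 := by
  have hpush := isFormOn_pushForm hg hk hreg (χ.isFormOn U) hinv
  -- The pull-back of the push-forward is `χ`, so `k` times this integral is at most `‖χ‖²`; it is
  -- finite because `k ≠ 0`.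
  have hfin : formMeasure (pushForm g U χ.coeff) V'.compl ≠ ∞ := by
    have h1 := hg.formMeasure_pullForm hreg hreg' hpush
    rw [formMeasure_congr hg.isOpen.measurableSet fun ζ x hx hζ =>
      pullForm_pushForm hg hk hreg (χ.isFormOn U) hinv hreg' hx hζ] at h1
    intro h
    rw [h, ENNReal.mul_top (by exact_mod_cast hk)] at h1
    have h2 : formMeasure χ.coeff U ≤ ‖χ‖ₑ ^ 2 := by
      rw [← χ.formMeasure_univ_eq]
      exact measure_mono (subset_univ _)
    rw [h1] at h2
    exact (lt_of_lt_of_le (by simp) h2).false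
  obtain ⟨φ, h1, h2, -⟩ := V'.exists_extension hpush hfin
  refine ⟨φ, BergmanSpace.eq_of_eqOn (fun ζ x hx hζ => ?_) (hG.coeff_eq_zero _) hχ, h2⟩
  obtain ⟨α, hα⟩ := hreg' _ (hg.mapsTo hx)
  rw [hG.coeff_eq _ ζ α x hx hζ hα, h1 α _ (hg.mapsTo hx) hα, pushForm_eq hg hinv hx hζ hα,
    div_mul_cancel₀ _ (hg.mapJac_ne_zero hx hζ hα)]

end PullAlgebra

/-! ### The identity between the reproducing forms -/

section Kernel

variable {M : Type*} [TopologicalSpace M] [SecondCountableTopology M] [ReducedComplexSpace M]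
  {M' : Type*} [TopologicalSpace M'] [SecondCountableTopology M'] [ReducedComplexSpace M']
  {n : ℕ}

theorem BergmanSpace.coeff_sum {ι : Type*} (s : Finset ι) (φ : ι → BergmanSpace M n)
    (ζ : HolCoord M n) (x : M) : (∑ i ∈ s, φ i).coeff ζ x = ∑ i ∈ s, (φ i).coeff ζ x := by
  classical
  induction s using Finset.induction_on with
  | empty => rfl
  | insert i s hi ih => rw [Finset.sum_insert hi, Finset.sum_insert hi, coeff_add, Pi.add_apply,
      Pi.add_apply, ih]

theorem norm_sq_eq_mul_norm_sq {E E' : Type*} [NormedAddCommGroup E] [NormedAddCommGroup E']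
    {a : E} {b : E'} {k : ℕ} {c : ℝ≥0∞} (ha : ‖a‖ₑ ^ 2 = k * c) (hb : ‖b‖ₑ ^ 2 = (1 : ℕ) * c) :
    ‖a‖ ^ 2 = k * ‖b‖ ^ 2 := by
  rw [Nat.cast_one, one_mul] at hb
  have := congrArg ENNReal.toReal (ha.trans (congrArg _ hb.symm))
  simpa using this

/-- A finite group acting on the sheets of a finite covering, transitively on the fibres, relates
the kernels upstairs and downstairs. -/
theorem IsSheeted.sum_inner_kern [MeasurableSpace M] [BorelSpace M] [MeasurableSpace M']
    [BorelSpace M'] {V : AnalyticSubvariety M} {V' : AnalyticSubvariety M'}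
    (hreg : ∀ x ∈ V.compl, IsRegularPt n x) (hreg' : ∀ y ∈ V'.compl, IsRegularPt n y)
    {f : M → M'} {m : ℕ} (hm : m ≠ 0) (hf : IsSheeted f V.compl V'.compl m)
    {Γ : Type*} [Group Γ] [Fintype Γ] (hΓ : Fintype.card Γ = m) {g : Γ → M → M}
    (hg : ∀ γ, IsSheeted (g γ) V.compl V.compl 1) (hone : EqOn (g 1) id V.compl)
    (hmul : ∀ γ δ, EqOn (g (γ * δ)) (g γ ∘ g δ) V.compl)
    (hfg : ∀ γ, EqOn (f ∘ g γ) f V.compl)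
    (htrans : ∀ x ∈ V.compl, ∀ y ∈ V.compl, f x = f y → ∃ γ, g γ x = y)
    {z w : M} (hz : z ∈ V.compl) (hw : w ∈ V.compl) {ζ ω : HolCoord M n} {a : Γ → HolCoord M n}
    {α β : HolCoord M' n} (hζ : z ∈ ζ.source) (hω : w ∈ ω.source)
    (ha : ∀ γ, g γ z ∈ (a γ).source) (hα : f z ∈ α.source) (hβ : f w ∈ β.source) :
    ∑ γ, inner ℂ (BergmanSpace.kern (a γ) (g γ z)) (BergmanSpace.kern ω w) *
        mapJac (g γ) ζ (a γ) z =
      inner ℂ (BergmanSpace.kern α (f z)) (BergmanSpace.kern β (f w)) *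
        mapJac f ζ α z * conj (mapJac f ω β w) := by
  choose G hG hGn using fun γ => (hg γ).exists_isPull hreg hreg
  obtain ⟨F, hF, hFn⟩ := hf.exists_isPull hreg hreg'
  have hid := IsSheeted.id_of_isOpen V.isOpen_compl
  obtain ⟨P, hP, hPn⟩ := hid.exists_isPull hreg hreg
  have hid' := IsSheeted.id_of_isOpen V'.isOpen_compl
  obtain ⟨P', hP', hPn'⟩ := hid'.exists_isPull hreg' hreg'
  -- Pull-back is contravariant, hence the reversed order of the product.
  have hGG : ∀ γ δ φ, G γ (G δ φ) = G (δ * γ) φ := fun γ δ φ =>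
    (hG γ).comp_apply (hG δ) (hG _) (hg γ) (hg δ) hreg hreg (hmul δ γ) φ
  have hG1 : ∀ φ, G 1 φ = P φ := fun φ => by
    have := hP.comp_apply (hG 1) hP hid (hg 1) hreg hreg hone.symm φ
    rwa [hP.id_apply_eq ((hG 1).coeff_eq_zero _)] at this
  have hGF : ∀ γ φ, G γ (F φ) = F φ := fun γ φ =>
    (hG γ).comp_apply hF hF (hg γ) hf hreg hreg' (hfg γ).symm φ
  have hGin : ∀ γ φ ψ, inner ℂ (G γ φ) (G γ ψ) = inner ℂ (P φ) (P ψ) := fun γ φ ψ => by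
    have := inner_map_map_of_norm_sq_eq (G γ) P
      (fun x => norm_sq_eq_mul_norm_sq (hGn γ x) (hPn x)) φ ψ
    simpa using this
  have hFin : ∀ φ ψ, inner ℂ (F φ) (F ψ) = m * inner ℂ (P' φ) (P' ψ) := fun φ ψ => by
    have := inner_map_map_of_norm_sq_eq F P'
      (fun x => norm_sq_eq_mul_norm_sq (hFn x) (hPn' x)) φ ψ
    simpa using this
  have hPl : ∀ φ ψ, (∀ ζ, ∀ x ∉ closure V.compl, ψ.coeff ζ x = 0) →
      inner ℂ (P φ) (P ψ) = inner ℂ φ ψ := fun φ ψ hψ => by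
    rw [hP.id_apply_eq hψ, ← inner_conj_symm, hP.inner_id_apply hψ, inner_conj_symm]
  set J := mapJac f ω β w
  -- The adjoint of `F`, in effect: both sides are tested against an arbitrary `ψ`, through the
  -- invariant form `∑ γ, G γ ψ`.
  have key : F (conj J • BergmanSpace.kern β (f w)) = ∑ γ, G γ (BergmanSpace.kern ω w) := by
    refine ext_inner_right ℂ fun ψ => ?_
    have hχ0 : ∀ ζ, ∀ x ∉ closure V.compl, (∑ γ, G γ ψ).coeff ζ x = 0 := fun ζ x hx => by
      rw [BergmanSpace.coeff_sum]
      exact Finset.sum_eq_zero fun γ _ => (hG γ).coeff_eq_zero _ _ _ hx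
    have hχG : ∀ γ, G γ (∑ δ, G δ ψ) = ∑ δ, G δ ψ := fun γ => by
      rw [map_sum]
      simp_rw [hGG]
      exact Fintype.sum_equiv (Equiv.mulRight γ) _ _ fun δ => rfl
    -- Transitivity enters here: two points of a fibre differ by some `γ`, so invariance under the
    -- group gives invariance along the fibres, and the form descends.
    obtain ⟨φ, hFφ, hφ0⟩ := hf.exists_isPull_apply_eq hm hreg hreg' hF hχ0 (by
      intro x hx x' hx' hxx η η' κ hη hη' hκ
      obtain ⟨γ, rfl⟩ := htrans x hx x' hx' hxx
      have h1 := (hG γ).coeff_eq (∑ δ, G δ ψ) η η' x hx hη hη'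
      rw [hχG] at h1
      have hE : f ∘ g γ =ᶠ[𝓝 x] f := (hfg γ).eventuallyEq_of_mem (V.isOpen_compl.mem_nhds hx)
      rw [h1, ← mapJac_congr hE hη, mapJac_comp ((hg γ).isHolMapAt hx) (hf.isHolMapAt hx') hη hη'
        (by rwa [← hxx])]
      ring)
    -- Up to the projection `P`, the adjoint of `G γ` is `G γ⁻¹`; inversion permutes the sum, and
    -- `kern ω w` evaluates it at `w`.
    have hR : inner ℂ (∑ γ, G γ (BergmanSpace.kern ω w)) ψ = (F φ).coeff ω w := by
      rw [sum_inner, hFφ, BergmanSpace.coeff_sum]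
      refine Fintype.sum_equiv (Equiv.inv Γ) _ _ fun γ => ?_
      rw [Equiv.inv_apply, ← BergmanSpace.inner_kern, ← hP.inner_id_apply ((hG γ).coeff_eq_zero _),
        ← hG1, ← inv_mul_cancel γ, ← hGG, hGin, hPl _ _ ((hG _).coeff_eq_zero _)]
    -- The `m` on the left counts the group: pairing the invariant form with each `G γ ψ` gives the
    -- same value. The `m` on the right counts the sheets and comes from `hFin`. They cancel at the
    -- end.
    have hL : (m : ℂ) * inner ℂ (F (conj J • BergmanSpace.kern β (f w))) ψ =
        m * (F φ).coeff ω w := by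
      have h1 : ∀ γ, inner ℂ (F (conj J • BergmanSpace.kern β (f w))) ψ =
          inner ℂ (F (conj J • BergmanSpace.kern β (f w))) (G γ ψ) := fun γ => by
        conv_rhs => rw [← hGF γ, hGin, hP.id_apply_eq (hF.coeff_eq_zero _),
          hP.inner_id_apply (hF.coeff_eq_zero _)]
      calc _ = ∑ γ : Γ, inner ℂ (F (conj J • BergmanSpace.kern β (f w))) ψ := by simp [hΓ]
        _ = inner ℂ (F (conj J • BergmanSpace.kern β (f w))) (F φ) := by
          rw [hFφ, inner_sum]
          exact Finset.sum_congr rfl fun γ _ => h1 γ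
        _ = _ := by
          rw [hFin, hP'.id_apply_eq hφ0, ← inner_conj_symm, hP'.inner_id_apply hφ0,
            inner_conj_symm, inner_smul_left, Complex.conj_conj, BergmanSpace.inner_kern,
            hF.coeff_eq _ ω β w hw hω hβ, mul_comm J]
    rw [hR]
    exact mul_left_cancel₀ (by exact_mod_cast hm) hL
  have h1 := congrArg (fun φ : BergmanSpace M n => φ.coeff ζ z) key
  simp only [BergmanSpace.coeff_sum] at h1
  rw [hF.coeff_eq _ ζ α z hz hζ hα, BergmanSpace.coeff_smul, Pi.smul_apply,
    Pi.smul_apply, smul_eq_mul] at h1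
  simp_rw [BergmanSpace.inner_kern]
  rw [mul_right_comm, mul_comm _ (conj J), h1]
  exact Finset.sum_congr rfl fun γ _ => ((hG γ).coeff_eq _ ζ (a γ) z hz hζ (ha γ)).symm

end Kernel

/-! ### From coverings between subtypes to locally biholomorphic maps of open subsets -/

section Coverings

variable {M : Type*} [TopologicalSpace M] [ReducedComplexSpace M]
  {M' : Type*} [TopologicalSpace M'] [ReducedComplexSpace M'] {U : Set M} {U' : Set M'} {n : ℕ}

theorem isHolAtOn_iff (hU : IsOpen U) {h : U → ℂ} {k : M → ℂ} {x : U}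
    (hk : ∀ᶠ y in 𝓝 x, h y = k y) : IsHolAtOn h x ↔ IsHolAt k x := by
  refine isHolAt_congr ?_
  rw [EventuallyEq, ← hU.isOpenEmbedding_subtypeVal.map_nhds_eq, eventually_map]
  filter_upwards [hk] with y hy
  rw [Subtype.val_injective.extend_apply, hy]

theorem isHolAtOn_congr (hU : IsOpen U) {h k : U → ℂ} {x : U} (hk : h =ᶠ[𝓝 x] k) :
    IsHolAtOn h x ↔ IsHolAtOn k x := by
  refine isHolAtOn_iff hU ?_
  filter_upwards [hk] with y hy
  rw [Subtype.val_injective.extend_apply, hy]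

theorem isSheeted_of_isLocalHomeomorph (hU : IsOpen U) (hU' : IsOpen U') {φ : U → U'} {k : ℕ}
    (hφ : IsLocalHomeomorph φ) (hcard : ∀ y, (φ ⁻¹' {y}).encard = k)
    (hhol : ∀ (x : U) (h : U' → ℂ), IsHolAtOn h (φ x) ↔ IsHolAtOn (h ∘ φ) x)
    {g : M → M'} (hg : ∀ x : U, g x = φ x) : IsSheeted g U U' k where
  isOpen := hU
  isOpen' := hU'
  mapsTo x hx := by
    rw [hg ⟨x, hx⟩]
    exact (φ _).2
  exists_local x hx := by
    obtain ⟨e, hxe, rfl⟩ := hφ ⟨x, hx⟩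
    have : Nonempty U := ⟨⟨x, hx⟩⟩
    have : Nonempty U' := ⟨e ⟨x, hx⟩⟩
    let i := hU.isOpenEmbedding_subtypeVal.toOpenPartialHomeomorph
    let i' := hU'.isOpenEmbedding_subtypeVal.toOpenPartialHomeomorph
    have hi : ∀ y : U, i.symm y = y := fun y => i.left_inv (mem_univ y)
    refine ⟨(i.symm.trans e).trans i', ?_, ?_, ?_⟩
    · simp only [OpenPartialHomeomorph.trans_source, mem_inter_iff, mem_preimage]
      refine ⟨⟨?_, ?_⟩, ?_⟩
      · exact i.map_source (x := ⟨x, hx⟩) (mem_univ _)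
      · rwa [hi ⟨x, hx⟩]
      · exact mem_univ _
    · intro y hy
      simp only [OpenPartialHomeomorph.trans_source, mem_inter_iff] at hy
      obtain ⟨z, -, rfl⟩ : y ∈ Subtype.val '' (univ : Set U) := hy.1.1
      exact z.2
    · intro y hy
      simp only [OpenPartialHomeomorph.trans_source, mem_inter_iff] at hy
      obtain ⟨z, rfl⟩ : ∃ z : U, (z : M) = y := ⟨i.symm y, i.right_inv hy.1.1⟩
      change ((e (i.symm z) : U') : M') = _
      rw [hi, hg]
  isHolAt_iff x hx h := by
    rw [hg ⟨x, hx⟩, ← isHolAtOn_iff (h := fun y : U' => h y) hU' (Eventually.of_forall fun y => rfl),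
      hhol, isHolAtOn_iff (k := h ∘ g) hU (Eventually.of_forall fun y => ?_)]
    simp [hg]
  card_fibre y hy := by
    rw [← hcard ⟨y, hy⟩, ← Subtype.val_injective.encard_image]
    congr 1
    ext x
    constructor
    · rintro ⟨hx, hxy⟩
      exact ⟨⟨x, hx⟩, Subtype.ext ((hg ⟨x, hx⟩).symm.trans hxy), rfl⟩
    · rintro ⟨x, hx, rfl⟩
      exact ⟨x.2, (hg x).trans (congrArg Subtype.val hx)⟩

variable {f : U → U'} {m : ℕ}

theorem IsHolCovering.isSheeted (hf : IsHolCovering f m) (hU : IsOpen U) (hU' : IsOpen U')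
    {g : M → M'} (hg : ∀ x : U, g x = f x) : IsSheeted g U U' m :=
  isSheeted_of_isLocalHomeomorph hU hU' hf.isCoveringMap.isLocalHomeomorph hf.card_fibre
    hf.isHolAt_iff hg

/-- Deck transformations are only assumed to be homeomorphisms. Near `γ x` a function factors as `(h
∘ e.symm) ∘ f` through a local inverse of `f`, and composing with `γ` gives the same function of `f`
near `x`; so holomorphy at both points is the same condition downstairs. -/
theorem IsHolCovering.isSheeted_deck (hf : IsHolCovering f m) (hU : IsOpen U) {γ : U ≃ₜ U}
    (hγ : γ ∈ deckGroup f) {g : M → M} (hg : ∀ x : U, g x = γ x) : IsSheeted g U U 1 := by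
  refine isSheeted_of_isLocalHomeomorph hU hU γ.isLocalHomeomorph (fun y => ?_) (fun x h => ?_) hg
  · rw [← γ.image_symm, image_singleton, encard_singleton, Nat.cast_one]
  · obtain ⟨e, he, hfe⟩ := hf.isCoveringMap.isLocalHomeomorph (γ x)
    have h1 : h =ᶠ[𝓝 (γ x)] (h ∘ e.symm) ∘ f := by
      filter_upwards [e.open_source.mem_nhds he] with y hy
      simp only [Function.comp_apply]
      rw [hfe, e.left_inv hy]
    have h2 : h ∘ γ =ᶠ[𝓝 x] (h ∘ e.symm) ∘ f := by
      filter_upwards [(γ.continuous.tendsto x).eventually h1] with y hy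
      simp only [Function.comp_apply] at hy ⊢
      rw [hy, hγ y]
    rw [isHolAtOn_congr hU h1, isHolAtOn_congr hU h2, ← hf.isHolAt_iff, ← hf.isHolAt_iff, hγ x]

theorem jacobian_eq_mapJac (hU : IsOpen U) {φ : U → M'} {g : M → M'} (hg : ∀ x : U, g x = φ x)
    {ζ : HolCoord M n} (α : HolCoord M' n) {z : U} (hz : z.1 ∈ ζ.source) :
    jacobian φ ζ α z = mapJac g ζ α z := by
  unfold jacobian mapJac
  congr 1
  refine Filter.EventuallyEq.fderiv_eq ?_
  filter_upwards [(ζ.tendsto_inv hz).eventually (hU.mem_nhds z.2)] with p hp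
  obtain ⟨y, hy⟩ : ∃ y : U, (y : M) = ζ.inv p := ⟨⟨_, hp⟩, rfl⟩
  rw [← hy, Subtype.val_injective.extend_apply, hg]

end Coverings

/-- The deck transformation group of a connected covering is transitive on the fibres as soon as it
has as many elements as the fibres. -/
theorem IsCoveringMap.exists_deck_apply_eq {X Y : Type*} [TopologicalSpace X] [TopologicalSpace Y]
    [PreconnectedSpace X] {f : X → Y} (hf : IsCoveringMap f) {m : ℕ}
    (hfib : ∀ y, (f ⁻¹' {y}).encard = m) [Finite (deckGroup f)] (hcard : Nat.card (deckGroup f) = m)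
    {x y : X} (hxy : f x = f y) : ∃ γ ∈ deckGroup f, γ x = y := by
  -- Two deck transformations are lifts of `f` through `f`; on a connected space, lifts that agree
  -- at one point are equal. So the orbit of `x` has `m` points and fills the fibre.
  have hinj : Function.Injective fun γ : deckGroup f => γ.1 x := fun γ δ h => by
    refine Subtype.ext (Homeomorph.ext fun z => congrFun (hf.eq_of_comp_eq γ.1.continuous
      δ.1.continuous (funext fun z => ?_) x h) z)
    exact (γ.2 z).trans (δ.2 z).symm
  have hsub : range (fun γ : deckGroup f => γ.1 x) ⊆ f ⁻¹' {f y} := by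
    rintro _ ⟨γ, rfl⟩
    exact (γ.2 x).trans hxy
  have hfin : (f ⁻¹' {f y}).Finite := Set.finite_of_encard_eq_coe (hfib _)
  have heq := hfin.eq_of_subset_of_encard_le' hsub (by
    rw [hfib, ← image_univ, hinj.encard_image, encard_univ, ← hcard, ENat.card_eq_coe_natCard])
  obtain ⟨γ, hγ⟩ : y ∈ range (fun γ : deckGroup f => γ.1 x) := heq ▸ rfl
  exact ⟨γ.1, γ.2, hγ⟩

/-! ### The main theorem -/

theorem mainTheorem4 {M₁ : Type*} [TopologicalSpace M₁] [T2Space M₁] [SecondCountableTopology M₁]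
    [ReducedComplexSpace M₁] {M₂ : Type*} [TopologicalSpace M₂] [T2Space M₂]
    [SecondCountableTopology M₂] [ReducedComplexSpace M₂] (n m : ℕ)
    (V₁ : AnalyticSubvariety M₁) (V₂ : AnalyticSubvariety M₂)
    (hV₁ : V₁.carrier ≠ univ) (hV₂ : V₂.carrier ≠ univ)
    (hreg₁ : ∀ x ∈ V₁.compl, IsRegularPt n x) (hreg₂ : ∀ x ∈ V₂.compl, IsRegularPt n x)
    (f : V₁.compl → V₂.compl) (hf : IsHolCovering f m)
    (hcard : Nat.card (deckGroup f) = m)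
    (hconn : IsConnected V₁.compl ∨ ∀ x y, f x = f y → ∃ γ ∈ deckGroup f, γ x = y) :
    BergmanKernelWellDefined M₁ n ∧ BergmanKernelWellDefined M₂ n ∧
    ∀ (ζ ω : HolCoord M₁ n) (z w : V₁.compl), z.1 ∈ ζ.source → w.1 ∈ ω.source →
      (∑ᶠ γ : deckGroup f,
        pullbackKernel (fun x => (γ.1 x).1) (fun x => x.1)
          (fun x => hreg₁ _ (γ.1 x).2) (fun x => hreg₁ _ x.2) (bergmanKernel M₁ n) ζ ω z w) =
        pullbackKernel (fun x => (f x).1) (fun x => (f x).1)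
          (fun x => hreg₂ _ (f x).2) (fun x => hreg₂ _ (f x).2) (bergmanKernel M₂ n) ζ ω z w ∧
      (∑ᶠ γ : deckGroup f,
        pullbackKernel (fun x => x.1) (fun x => (γ.1 x).1)
          (fun x => hreg₁ _ x.2) (fun x => hreg₁ _ (γ.1 x).2) (bergmanKernel M₁ n) ζ ω z w) =
        pullbackKernel (fun x => (f x).1) (fun x => (f x).1)
          (fun x => hreg₂ _ (f x).2) (fun x => hreg₂ _ (f x).2) (bergmanKernel M₂ n) ζ ω z w := by
  refine ⟨bergmanKernelWellDefined M₁ n, bergmanKernelWellDefined M₂ n, fun ζ ω z w hz hw => ?_⟩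
  let _ : MeasurableSpace M₁ := borel M₁
  have : BorelSpace M₁ := ⟨rfl⟩
  let _ : MeasurableSpace M₂ := borel M₂
  have : BorelSpace M₂ := ⟨rfl⟩
  -- The fibre through `z` is not empty.
  have hm : m ≠ 0 := by
    rintro rfl
    have h0 : f ⁻¹' {f z} = ∅ := Set.encard_eq_zero.1 (by simpa using hf.card_fibre (f z))
    exact (h0 ▸ rfl : z ∈ (∅ : Set V₁.compl))
  have : Finite (deckGroup f) := Nat.finite_of_card_ne_zero (by rwa [hcard])
  have := Fintype.ofFinite (deckGroup f)
  have htrans : ∀ x y, f x = f y → ∃ γ ∈ deckGroup f, γ x = y := by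
    rcases hconn with hc | ht
    · have := Subtype.preconnectedSpace hc.isPreconnected
      exact fun x y hxy => hf.isCoveringMap.exists_deck_apply_eq hf.card_fibre hcard hxy
    · exact ht
  -- Values off the complement of `V₁` are irrelevant: this set is open, and only germs at its
  -- points enter.
  let f' : M₁ → M₂ := Function.extend Subtype.val (fun x => (f x).1) fun _ => (f z).1
  let g : deckGroup f → M₁ → M₁ := fun γ => Function.extend Subtype.val (fun x => (γ.1 x).1) id
  have hf' : ∀ x : V₁.compl, f' x = f x := fun x => Subtype.val_injective.extend_apply _ _ x
  have hg : ∀ (γ : deckGroup f) (x : V₁.compl), g γ x = γ.1 x := fun γ x =>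
    Subtype.val_injective.extend_apply _ _ x
  have hsf := hf.isSheeted V₁.isOpen_compl V₂.isOpen_compl hf'
  have hsg := fun γ : deckGroup f => hf.isSheeted_deck V₁.isOpen_compl γ.2 (hg γ)
  have hJf : ∀ {η : HolCoord M₁ n} (α : HolCoord M₂ n) {x : V₁.compl}, x.1 ∈ η.source →
      jacobian (fun x => (f x).1) η α x = mapJac f' η α x := fun α x hx =>
    jacobian_eq_mapJac V₁.isOpen_compl hf' α hx
  have hJg : ∀ γ {η : HolCoord M₁ n} (α : HolCoord M₁ n) {x : V₁.compl}, x.1 ∈ η.source →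
      jacobian (fun x => (γ.1 x).1) η α x = mapJac (g γ) η α x := fun γ η α x hx =>
    jacobian_eq_mapJac V₁.isOpen_compl (hg γ) α hx
  have hJi : ∀ {η : HolCoord M₁ n} (α : HolCoord M₁ n) {x : V₁.compl}, x.1 ∈ η.source →
      jacobian (fun x : V₁.compl => x.1) η α x = η.transJac α x := fun α x hx =>
    jacobian_eq_mapJac (g := id) V₁.isOpen_compl (fun _ => rfl) α hx
  -- Stated for arbitrary points and coordinates because the second formula uses it with the two
  -- arguments exchanged. `sum_inner_kern` is applied in the chosen coordinates at `y`, and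
  -- `transJac` converts the result to `θ`.
  have key : ∀ (η θ : HolCoord M₁ n) (x y : V₁.compl), x.1 ∈ η.source → y.1 ∈ θ.source →
      ∑ γ : deckGroup f, inner ℂ (BergmanSpace.kern (coordAt (hreg₁ _ (γ.1 x).2)) (γ.1 x).1)
          (BergmanSpace.kern (coordAt (hreg₁ _ y.2)) y.1) *
          mapJac (g γ) η (coordAt (hreg₁ _ (γ.1 x).2)) x *
          conj (θ.transJac (coordAt (hreg₁ _ y.2)) y) =
        inner ℂ (BergmanSpace.kern (coordAt (hreg₂ _ (f x).2)) (f x).1)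
          (BergmanSpace.kern (coordAt (hreg₂ _ (f y).2)) (f y).1) *
          mapJac f' η (coordAt (hreg₂ _ (f x).2)) x *
          conj (mapJac f' θ (coordAt (hreg₂ _ (f y).2)) y) := by
    intro η θ x y hx hy
    have hfx : f' x ∈ (coordAt (hreg₂ _ (f x).2)).source := by
      rw [hf']
      exact mem_coordAt _
    have hfy : f' y ∈ (coordAt (hreg₂ _ (f y).2)).source := by
      rw [hf']
      exact mem_coordAt _
    have h := IsSheeted.sum_inner_kern hreg₁ hreg₂ hm hsf
      (Nat.card_eq_fintype_card.symm.trans hcard) hsg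
      (fun x hx => hg 1 ⟨x, hx⟩)
      (fun γ δ x hx => by
        rw [hg _ ⟨x, hx⟩, Function.comp_apply, hg δ ⟨x, hx⟩, hg]
        rfl)
      (fun γ x hx => by
        rw [Function.comp_apply, hg γ ⟨x, hx⟩, hf', hf' ⟨x, hx⟩, γ.2])
      (fun x hx y hy hxy => by
        rw [hf' ⟨x, hx⟩, hf' ⟨y, hy⟩] at hxy
        obtain ⟨γ, hγ, h⟩ := htrans _ _ (Subtype.ext hxy)
        exact ⟨⟨γ, hγ⟩, (hg ⟨γ, hγ⟩ ⟨x, hx⟩).trans (congrArg Subtype.val h)⟩)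
      x.2 y.2 hx (mem_coordAt (hreg₁ _ y.2)) (a := fun γ => coordAt (hreg₁ _ (γ.1 x).2))
      (fun γ => by
        rw [hg]
        exact mem_coordAt _) hfx hfy
    simp only [hg, hf'] at h
    rw [← Finset.sum_mul, h,
      mapJac_trans_left (hsf.isHolMapAt y.2) hy (mem_coordAt (hreg₁ _ y.2)) hfy, map_mul]
    ring
  rw [finsum_eq_sum_of_fintype, finsum_eq_sum_of_fintype]
  simp only [pullbackKernel, bergmanKernel_eq, hJf _ hz, hJf _ hw, hJg _ _ hz, hJg _ _ hw,
    hJi _ hz, hJi _ hw]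
  constructor
  · have h := congrArg (Complex.I ^ (n ^ 2) * ·) (key ζ ω z w hz hw)
    simpa only [Finset.mul_sum, mul_assoc] using h
  -- Hermitian symmetry: exchange the points and conjugate the inner products, leaving the constant
  -- `I ^ (n ^ 2)` unconjugated.
  · have h := congrArg (fun c => Complex.I ^ (n ^ 2) * conj c) (key ω ζ w z hw hz)
    simp only [map_sum, map_mul, Complex.conj_conj, inner_conj_symm, Finset.mul_sum] at h
    refine (Finset.sum_congr rfl fun γ _ => ?_).trans (h.trans ?_) <;> ring
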